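/- Let $\mathbb H$ be the first Heisenberg group, i.e. $\mathbb R^3$ with the product $(x,y,z)(x',y',z')=(x+x',\,y+y',\,z+z'+\tfrac12(xy'-x'y))$. For $f:\mathbb R^2\to\mathbb R$, with coordinates $(y,t)$ on $\mathbb R^2$, let $\Gamma_f=\{(0,y,t)(f(y,t),0,0):(y,t)\in\mathbb R^2\}\subset\mathbb H$ be its intrinsic graph, let $\nabla^f=\partial_y+f\,\partial_t$, and let $\mathscr A_f(E)=\int_E\sqrt{1+(\nabla^f f)^2}\,d\mathcal L^2$ be the area functional. A locally Lipschitz function $f$ is called stable if for all $\varphi\in C_c^\infty(\mathbb R^2)$ $$\frac{d}{d\epsilon}\mathscr A_{f+\epsilon\varphi}(\operatorname{spt}\varphi)\Big|_{\epsilon=0}=0\quad\text{and}\quad \frac{d^2}{d\epsilon^2}\mathscr A_{f+\epsilon\varphi}(\operatorname{spt}\varphi)\Big|_{\epsilon=0}\ge 0 .$$ A Lagrangian parametrization of $\mathbb R^2$ associated with $\nabla^f$ is a continuous surjective map $\Psi:\mathbb R^2\to\mathbb R^2$ of the form $\Psi(s,\tau)=(s,\chi(s,\tau))$ such that $\tau\mapsto\chi(s,\tau)$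 is non-decreasing for every $s$, and such that for every $\tau$ the function $s\mapsto\chi(s,\tau)$ is absolutely continuous on every bounded interval and satisfies $\partial_s\chi(s,\tau)=f(s,\chi(s,\tau))$ for almost every $s$. **Theorem.** Let $f:\mathbb R^2\to\mathbb R$ be locally Lipschitz and stable. Then $f$ is differentiable everywhere and $\nabla^f f$ is constant on $\mathbb R^2$, and $\Gamma_f$ is an intrinsic plane, i.e. a coset of a two-dimensional connected Lie subgroup of $\mathbb H$. More precisely, there is exactly one Lagrangian parametrization $\Psi(s,\tau)=(s,\chi(s,\tau))$ of $\mathbb R^2$ associated with $\nabla^f$ such that $\chi(0,\tau)=\tau$ for all $\tau\in\mathbb R$, and there are constants $a,b\in\mathbb R$ such that $$\chi(s,\tau)=a\,\frac{s^2}{2}+b\,s+\tau\qquad\text{for all }s,\tau\in\mathbb R .$$ -/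

import Mathlib

open MeasureTheory

/-- The first Heisenberg group: `ℝ³` in exponential coordinates. -/
@[ext]
structure Heis where
  x : ℝ
  y : ℝ
  z : ℝ

namespace Heis

/-- `(x, y, z)(x', y', z') = (x + x', y + y', z + z' + (x y' - x' y) / 2)`. -/
noncomputable instance : Mul Heis :=
  ⟨fun p q => ⟨p.x + q.x, p.y + q.y, p.z + q.z + (p.x * q.y - q.x * p.y) / 2⟩⟩

instance : One Heis := ⟨⟨0, 0, 0⟩⟩

instance : Inv Heis := ⟨fun p => ⟨-p.x, -p.y, -p.z⟩⟩

theorem mul_def (p q : Heis) :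
    p * q = ⟨p.x + q.x, p.y + q.y, p.z + q.z + (p.x * q.y - q.x * p.y) / 2⟩ := rfl

theorem one_def : (1 : Heis) = ⟨0, 0, 0⟩ := rfl

theorem inv_def (p : Heis) : p⁻¹ = ⟨-p.x, -p.y, -p.z⟩ := rfl

noncomputable instance : Group Heis :=
  Group.ofLeftAxioms
    (fun p q r => by
      simp only [mul_def, Heis.mk.injEq]
      exact ⟨by ring, by ring, by ring⟩)
    (fun p => by simp [mul_def, one_def])
    (fun p => by
      simp only [mul_def, one_def, inv_def, Heis.mk.injEq]
      exact ⟨by ring, by ring, by ring⟩)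

/-- The Euclidean topology of `ℝ³`. -/
instance : TopologicalSpace Heis :=
  TopologicalSpace.induced (fun p : Heis => (p.x, p.y, p.z)) inferInstance

/-- The exponential map from the Lie algebra to the group, where `(α, β, γ)` stands for the
left-invariant vector field `α X + β Y + γ Z`, with `X = ∂x - (y/2) ∂z`, `Y = ∂y + (x/2) ∂z`
and `Z = ∂z`. In exponential coordinates it is the identity. -/
def exp (v : ℝ × ℝ × ℝ) : Heis := ⟨v.1, v.2.1, v.2.2⟩

/-- `s ↦ exp (s v)` is the one-parameter subgroup with velocity `v` at the identity. -/
theorem exp_add_smul (v : ℝ × ℝ × ℝ) (s r : ℝ) :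
    exp ((s + r) • v) = exp (s • v) * exp (r • v) := by
  simp only [exp, mul_def, Prod.smul_fst, Prod.smul_snd, smul_eq_mul, Heis.mk.injEq]
  exact ⟨by ring, by ring, by ring⟩

/-- A connected closed subgroup `W` (hence a Lie subgroup) whose Lie algebra
`{v | exp (s v) ∈ W for all real s}` is two-dimensional. All connected Lie subgroups of the
Heisenberg group are closed, since that group is nilpotent and simply connected. -/
structure IsTwoDimLieSubgroup (W : Subgroup Heis) : Prop where
  isClosed : IsClosed (W : Set Heis)
  isConnected : IsConnected (W : Set Heis)
  lieAlgebra : ∃ V : Submodule ℝ (ℝ × ℝ × ℝ), Module.finrank ℝ V = 2 ∧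
    ∀ v : ℝ × ℝ × ℝ, v ∈ V ↔ ∀ s : ℝ, exp (s • v) ∈ W

/-- An intrinsic plane is a coset of a two-dimensional Lie subgroup. (Such a subgroup contains the
commutator subgroup, so it is normal, and left and right cosets are the same.) -/
def IsIntrinsicPlane (S : Set Heis) : Prop :=
  ∃ (W : Subgroup Heis) (g : Heis), IsTwoDimLieSubgroup W ∧
    S = (fun w : Heis => g * w) '' (W : Set Heis)

/-- The intrinsic graph `Γ_f = {(0, y, t) * (f (y, t), 0, 0) : (y, t) ∈ ℝ²}`. -/
def intrinsicGraph (f : ℝ × ℝ → ℝ) : Set Heis :=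
  Set.range fun p : ℝ × ℝ => (⟨0, p.1, p.2⟩ : Heis) * ⟨f p, 0, 0⟩

/-- `∇^f u = ∂_y u + f ∂_t u`. For a locally Lipschitz `u` this is defined almost everywhere, by
Rademacher's theorem, and the pointwise and distributional derivatives agree; where `u` is not
differentiable the value here is `0`. -/
noncomputable def intrinsicDeriv (f u : ℝ × ℝ → ℝ) (p : ℝ × ℝ) : ℝ :=
  fderiv ℝ u p (1, f p)

/-- The area functional `𝒜_f (E) = ∫_E √(1 + (∇^f f)²) dℒ²`. -/
noncomputable def graphArea (f : ℝ × ℝ → ℝ) (E : Set (ℝ × ℝ)) : ℝ :=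
  ∫ p in E, Real.sqrt (1 + (intrinsicDeriv f f p) ^ 2)

/-- The first variation `I_f (φ) = d/dε 𝒜_{f + ε φ} (spt φ)` at `ε = 0`. (The function of `ε` is
smooth when `f` is locally Lipschitz and `φ` is smooth with compact support.) -/
noncomputable def firstVariation (f φ : ℝ × ℝ → ℝ) : ℝ :=
  deriv (fun ε : ℝ => graphArea (fun p => f p + ε * φ p) (tsupport φ)) 0

/-- The second variation `II_f (φ) = d²/dε² 𝒜_{f + ε φ} (spt φ)` at `ε = 0`. -/
noncomputable def secondVariation (f φ : ℝ × ℝ → ℝ) : ℝ :=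
  iteratedDeriv 2 (fun ε : ℝ => graphArea (fun p => f p + ε * φ p) (tsupport φ)) 0

/-- `I_f (φ) = 0` for all `φ ∈ C_c^∞(ℝ²)`. -/
def IsStationary (f : ℝ × ℝ → ℝ) : Prop :=
  ∀ φ : ℝ × ℝ → ℝ, ContDiff ℝ ((⊤ : ℕ∞) : WithTop ℕ∞) φ → HasCompactSupport φ →
    firstVariation f φ = 0

/-- Stationary, and `II_f (φ) ≥ 0` for all `φ ∈ C_c^∞(ℝ²)`. -/
def IsStable (f : ℝ × ℝ → ℝ) : Prop :=
  IsStationary f ∧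
  ∀ φ : ℝ × ℝ → ℝ, ContDiff ℝ ((⊤ : ℕ∞) : WithTop ℕ∞) φ → HasCompactSupport φ →
    0 ≤ secondVariation f φ

/-- `Ψ (s, τ) = (s, χ (s, τ))` is a Lagrangian parametrization `ℝ² → ℝ²` associated with the vector
field `∇^f = ∂_y + f ∂_t`. -/
structure IsLagrangianParametrization (f χ : ℝ × ℝ → ℝ) : Prop where
  continuous : Continuous χ
  surjective : Function.Surjective fun p : ℝ × ℝ => (p.1, χ p)
  monotone : ∀ s : ℝ, Monotone fun τ : ℝ => χ (s, τ)
  absolutelyContinuous : ∀ τ s₁ s₂ : ℝ,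
    AbsolutelyContinuousOnInterval (fun s : ℝ => χ (s, τ)) s₁ s₂
  hasDerivAt : ∀ τ : ℝ, ∀ᵐ s : ℝ,
    HasDerivAt (fun r : ℝ => χ (r, τ)) (f (s, χ (s, τ))) s

end Heis

/-!
A stable `f` is shown to be affine in `y` and independent of `t`; everything else is then explicit.
Write `A = ∇^f f`, and call an integral curve of `∂_y + f ∂_t` a characteristic. The argument stays in
the plane: no change of variables is made, and Lagrangian information enters through test functions
built from the flow `χ` of characteristics and its label function `τ`.

*Variations.* Mollification extends both variation formulas, `∫ g(A) (∇^f φ + f_t φ) = 0` and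
`∫ w(A) (∇^f φ + f_t φ)² + 2 g(A) φ φ_t ≥ 0` with `g(a) = a / √(1 + a²)` and `w = g'`, to Lipschitz `φ`
(`IsStable.variation`).

*Characteristics are parabolas.* Take `φ = ξ / J_h`, where `J_h` is a difference quotient of the flow in
its label, and let `h → 0`: this gives `∫ g(A) ∇^f ξ ∂_t τ = 0` (`IsCharFlow.integral_transport`).
Choosing for `ξ` the deviation of `f` from affine interpolation along characteristics, strict
monotonicity of `g` shows that `f` is affine along each of them (`affine_along_characteristic`). A
continuation argument makes this global: the characteristics are parabolas, whose second derivative is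
a locally Lipschitz representative of `A` (`IsLipStationary.exists_parabola`).

*Second variation.* With `φ = ψ / √J_h` and `h → 0`, and an integration by parts of `f_t ∇^f (ψ²)` based
on `∇^f f_t = A_t - f_t²`, stability becomes
`∫ w(A) ∂_t τ ¾ (2 A_t - f_t²) ψ² ≤ ∫ w(A) ∂_t τ (∇^f ψ)²` (`IsCharFlow.stability_inequality`).
The parabolas do not cross, so `1 + f_t σ + A_t σ² / 2 > 0` for all `σ`, whence `2 A_t ≥ f_t²`. For
`ψ = a(τ) b(y / T)` the right-hand side is proportional to `1 / T`, since `w(A) a(τ)² ∂_t τ` has the same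
integral on every line `y = const`. Letting `T → ∞` gives `2 A_t = f_t²`, and then `σ = -2 / f_t` would
violate the strict inequality unless `f_t = 0`. Hence `f` does not depend on `t`, and it is affine along
characteristics, so it is affine in `y` (`IsStable.exists_affine`).
-/

open Filter Metric Set
open scoped Topology NNReal

namespace Heis

/-! ### Locally Lipschitz functions on the plane -/

theorem locLip_mul {α : Type*} [PseudoMetricSpace α] {u v : α → ℝ} (hu : LocallyLipschitz u)
    (hv : LocallyLipschitz v) : LocallyLipschitz fun p => u p * v p :=
  (ContDiff.locallyLipschitz (𝕂 := ℝ) (f := fun q : ℝ × ℝ => q.1 * q.2)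
    (contDiff_fst.mul contDiff_snd)).comp (hu.prodMk hv)

theorem locLip_add {α : Type*} [PseudoMetricSpace α] {u v : α → ℝ} (hu : LocallyLipschitz u)
    (hv : LocallyLipschitz v) : LocallyLipschitz fun p => u p + v p :=
  (ContDiff.locallyLipschitz (𝕂 := ℝ) (f := fun q : ℝ × ℝ => q.1 + q.2)
    (contDiff_fst.add contDiff_snd)).comp (hu.prodMk hv)

theorem locLip_sub {α : Type*} [PseudoMetricSpace α] {u v : α → ℝ} (hu : LocallyLipschitz u)
    (hv : LocallyLipschitz v) : LocallyLipschitz fun p => u p - v p :=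
  (ContDiff.locallyLipschitz (𝕂 := ℝ) (f := fun q : ℝ × ℝ => q.1 - q.2)
    (contDiff_fst.sub contDiff_snd)).comp (hu.prodMk hv)

theorem locLip_fst : LocallyLipschitz (Prod.fst : ℝ × ℝ → ℝ) := LipschitzWith.prod_fst.locallyLipschitz

theorem locLip_snd : LocallyLipschitz (Prod.snd : ℝ × ℝ → ℝ) := LipschitzWith.prod_snd.locallyLipschitz

/-- A real function that is `C¹` on the values of `u` may be composed with `u`. -/
theorem locLip_comp_contDiffAt {α : Type*} [PseudoMetricSpace α] {u : α → ℝ} {g : ℝ → ℝ}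
    (hu : LocallyLipschitz u) (hg : ∀ p, ContDiffAt ℝ 1 g (u p)) :
    LocallyLipschitz fun p => g (u p) := by
  intro p
  obtain ⟨K, s, hs, hK⟩ := (hg p).exists_lipschitzOnWith
  obtain ⟨K', s', hs', hK'⟩ := hu p
  exact ⟨K * K', u ⁻¹' s ∩ s', inter_mem (hu.continuous.continuousAt hs) hs',
    hK.comp (hK'.mono inter_subset_right) fun x hx => hx.1⟩

theorem locLip_inv {α : Type*} [PseudoMetricSpace α] {u : α → ℝ}
    (hu : LocallyLipschitz u) (h0 : ∀ p, u p ≠ 0) : LocallyLipschitz fun p => (u p)⁻¹ :=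
  locLip_comp_contDiffAt hu fun p => contDiffAt_inv ℝ (h0 p)

theorem locLip_sqrt {α : Type*} [PseudoMetricSpace α] {u : α → ℝ}
    (hu : LocallyLipschitz u) (h0 : ∀ p, 0 < u p) : LocallyLipschitz fun p => √(u p) :=
  locLip_comp_contDiffAt hu fun p => Real.contDiffAt_sqrt (h0 p).ne'

theorem locLip_exists_lipschitzOnWith {u : ℝ × ℝ → ℝ} (hu : LocallyLipschitz u) (R : ℝ) :
    ∃ K : ℝ≥0, LipschitzOnWith K u (closedBall 0 R) :=
  LocallyLipschitzOn.exists_lipschitzOnWith_of_compact (isCompact_closedBall 0 R)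
    (hu.locallyLipschitzOn)

theorem locLip_ae_differentiableAt {u : ℝ × ℝ → ℝ} (hu : LocallyLipschitz u) :
    ∀ᵐ p : ℝ × ℝ, DifferentiableAt ℝ u p := by
  have h : ∀ n : ℕ, ∀ᵐ p : ℝ × ℝ, p ∈ closedBall (0 : ℝ × ℝ) n →
      DifferentiableWithinAt ℝ u (closedBall 0 n) p := fun n => by
    obtain ⟨K, hK⟩ := locLip_exists_lipschitzOnWith hu n
    exact hK.ae_differentiableWithinAt_of_mem
  filter_upwards [ae_all_iff.2 h] with p hp
  obtain ⟨n, hn⟩ := exists_nat_gt ‖p‖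
  have hb : p ∈ ball (0 : ℝ × ℝ) n := by simpa using hn
  exact (hp n (ball_subset_closedBall hb)).differentiableAt
    (mem_of_superset (isOpen_ball.mem_nhds hb) ball_subset_closedBall)

theorem locLip_exists_norm_fderiv_le {u : ℝ × ℝ → ℝ} (hu : LocallyLipschitz u) (R : ℝ) :
    ∃ C : ℝ, 0 ≤ C ∧ ∀ p ∈ closedBall (0 : ℝ × ℝ) R, |u p| ≤ C ∧ ‖fderiv ℝ u p‖ ≤ C := by
  obtain ⟨K, hK⟩ := locLip_exists_lipschitzOnWith hu (R + 1)
  obtain ⟨C, hC⟩ := (isCompact_closedBall (0 : ℝ × ℝ) R).exists_bound_of_continuousOn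
    hu.continuous.continuousOn
  refine ⟨max K C, le_max_of_le_left K.2, fun p hp => ⟨(hC p hp).trans (le_max_right _ _),
    (norm_fderiv_le_of_lipschitzOn ℝ ?_ hK).trans (le_max_left _ _)⟩⟩
  rw [mem_closedBall_zero_iff] at hp
  exact mem_of_superset (isOpen_ball.mem_nhds (show p ∈ ball (0 : ℝ × ℝ) (R + 1) by
    simpa using hp.trans_lt (lt_add_one R))) ball_subset_closedBall

theorem locLip_lipschitzWith {u : ℝ × ℝ → ℝ} (hu : LocallyLipschitz u) (hc : HasCompactSupport u) :
    ∃ K : ℝ≥0, LipschitzWith K u := by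
  obtain ⟨R, hR⟩ := hc.isCompact.isBounded.subset_closedBall 0
  obtain ⟨C, hC0, hC⟩ := locLip_exists_norm_fderiv_le hu R
  obtain ⟨K, hK⟩ := locLip_exists_lipschitzOnWith hu (|R| + 1)
  obtain ⟨M, hM⟩ := hc.exists_bound_of_continuous hu.continuous
  have hM0 : 0 ≤ M := (norm_nonneg _).trans (hM 0)
  have hz : ∀ p : ℝ × ℝ, |R| < ‖p‖ → u p = 0 := fun p hp => by
    by_contra h
    have := hR (subset_tsupport _ h)
    rw [mem_closedBall_zero_iff] at this
    exact absurd (this.trans (le_abs_self R)) (not_le.2 hp)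
  refine ⟨K + M.toNNReal, LipschitzWith.of_dist_le_mul fun p q => ?_⟩
  have key : ∀ p q : ℝ × ℝ, ‖p‖ ≤ |R| → dist (u p) (u q) ≤ (K + M) * dist p q := fun p q hp => by
    by_cases hq : ‖q‖ ≤ |R| + 1
    · refine (hK.dist_le_mul p ?_ q ?_).trans ?_
      · simpa using hp.trans (by linarith)
      · simpa using hq
      · nlinarith [dist_nonneg (x := p) (y := q)]
    · push Not at hq
      rw [hz q (by linarith), dist_zero_right]
      have h1 : 1 ≤ dist p q := by
        rw [dist_eq_norm, norm_sub_rev]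
        linarith [norm_sub_norm_le q p]
      have := hM p
      nlinarith [K.2, dist_nonneg (x := p) (y := q), K.coe_nonneg]
  rw [NNReal.coe_add, Real.coe_toNNReal M hM0]
  by_cases hp : ‖p‖ ≤ |R|
  · exact key p q hp
  · by_cases hq : ‖q‖ ≤ |R|
    · rw [dist_comm, dist_comm p]
      exact key q p hq
    · push Not at hp hq
      rw [hz p hp, hz q hq, dist_self]
      have := K.coe_nonneg
      positivity

theorem tsupport_fderiv_apply_eq_zero {u : ℝ × ℝ → ℝ} {p : ℝ × ℝ} (hp : p ∉ tsupport u) :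
    u p = 0 ∧ fderiv ℝ u p = 0 :=
  ⟨image_eq_zero_of_notMem_tsupport hp, by
    by_contra h
    exact hp (support_fderiv_subset ℝ h)⟩

/-- Dominated convergence for bounded functions supported in a fixed ball. -/
theorem tendsto_integral_of_bounded {F : ℕ → ℝ × ℝ → ℝ} {F' : ℝ × ℝ → ℝ} (R C : ℝ)
    (hm : ∀ n, AEStronglyMeasurable (F n)) (hb : ∀ n, ∀ᵐ p, p ∈ closedBall 0 R → |F n p| ≤ C)
    (hs : ∀ n p, p ∉ closedBall 0 R → F n p = 0)
    (hl : ∀ᵐ p, Tendsto (fun n => F n p) atTop (𝓝 (F' p))) :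
    Tendsto (fun n => ∫ p, F n p) atTop (𝓝 (∫ p, F' p)) := by
  refine tendsto_integral_of_dominated_convergence
    ((closedBall (0 : ℝ × ℝ) R).indicator fun _ => C) hm ?_ (fun n => ?_) hl
  · exact (integrable_indicator_iff measurableSet_closedBall).2
      (integrableOn_const (isCompact_closedBall _ _).measure_lt_top.ne)
  · filter_upwards [hb n] with p hp
    by_cases h : p ∈ closedBall (0 : ℝ × ℝ) R
    · simpa [h] using hp h
    · simp [h, hs n p h]

/-- A bounded measurable function supported in a ball is integrable. -/
theorem integrable_of_bounded {F : ℝ × ℝ → ℝ} (R C : ℝ)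
    (hm : AEStronglyMeasurable F) (hb : ∀ᵐ p, p ∈ closedBall 0 R → |F p| ≤ C)
    (hs : ∀ p, p ∉ closedBall 0 R → F p = 0) : Integrable F := by
  refine Integrable.mono' (g := (closedBall (0 : ℝ × ℝ) R).indicator fun _ => C) ?_ hm ?_
  · exact (integrable_indicator_iff measurableSet_closedBall).2
      (integrableOn_const (isCompact_closedBall _ _).measure_lt_top.ne)
  · filter_upwards [hb] with p hp
    by_cases h : p ∈ closedBall (0 : ℝ × ℝ) R
    · simpa [h] using hp h
    · simp [h, hs p h]

/-- The divergence theorem for compactly supported functions. -/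
theorem integral_fderiv_apply_eq_zero {u : ℝ × ℝ → ℝ} (hu : LocallyLipschitz u)
    (hc : HasCompactSupport u) (v : ℝ × ℝ) : ∫ p, fderiv ℝ u p v = 0 := by
  obtain ⟨K, hK⟩ := locLip_lipschitzWith hu hc
  have h := LipschitzWith.integral_lineDeriv_mul_eq (μ := volume)
    (LipschitzWith.const (1 : ℝ) : LipschitzWith 0 fun _ : ℝ × ℝ => (1 : ℝ)) hK hc (-v)
  simp only [lineDeriv, deriv_const, zero_mul, integral_zero, neg_neg, mul_one] at h
  change 0 = ∫ p, lineDeriv ℝ u p v at h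
  rw [h]
  refine integral_congr_ae ?_
  filter_upwards [locLip_ae_differentiableAt hu] with p hp
  exact hp.lineDeriv_eq_fderiv.symm

/-! ### The area integrand -/

/-- The derivative of `x ↦ √(1 + x²)`. -/
noncomputable def areaSlope (x : ℝ) : ℝ := x / √(1 + x ^ 2)

/-- The second derivative of `x ↦ √(1 + x²)`. -/
noncomputable def areaCurv (x : ℝ) : ℝ := 1 / √(1 + x ^ 2) ^ 3

theorem sqrt_one_add_sq_pos (x : ℝ) : 0 < √(1 + x ^ 2) := Real.sqrt_pos.2 (by positivity)

theorem hasDerivAt_area (x : ℝ) : HasDerivAt (fun x : ℝ => √(1 + x ^ 2)) (areaSlope x) x := by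
  have h : HasDerivAt (fun x : ℝ => 1 + x ^ 2) (2 * x) x := by
    simpa using (hasDerivAt_pow 2 x).const_add 1
  convert h.sqrt (by positivity) using 1
  rw [areaSlope, mul_div_mul_left _ _ two_ne_zero]

theorem hasDerivAt_areaSlope (x : ℝ) : HasDerivAt areaSlope (areaCurv x) x := by
  have hp := sqrt_one_add_sq_pos x
  have h : HasDerivAt areaSlope _ x := (hasDerivAt_id x).div (hasDerivAt_area x) hp.ne'
  refine h.congr_deriv ?_
  have hs : √(1 + x ^ 2) ^ 2 = 1 + x ^ 2 := Real.sq_sqrt (by positivity)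
  rw [areaCurv, areaSlope, id, hs]
  field_simp
  rw [hs]
  ring

theorem areaCurv_pos (x : ℝ) : 0 < areaCurv x := by
  have := sqrt_one_add_sq_pos x
  rw [areaCurv]; positivity

theorem areaCurv_le_one (x : ℝ) : areaCurv x ≤ 1 := by
  have h : 1 ≤ √(1 + x ^ 2) := Real.one_le_sqrt.2 (by nlinarith)
  rw [areaCurv, div_le_one (by positivity)]
  exact one_le_pow₀ h

theorem abs_areaSlope_le_one (x : ℝ) : |areaSlope x| ≤ 1 := by
  rw [areaSlope, abs_div, abs_of_pos (sqrt_one_add_sq_pos x), div_le_one (sqrt_one_add_sq_pos x)]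
  exact Real.abs_le_sqrt (by linarith)

theorem areaSlope_strictMono : StrictMono areaSlope :=
  strictMono_of_hasDerivAt_pos hasDerivAt_areaSlope areaCurv_pos

theorem continuous_areaSlope : Continuous areaSlope :=
  continuous_iff_continuousAt.2 fun x => (hasDerivAt_areaSlope x).continuousAt

theorem continuous_areaCurv : Continuous areaCurv := by
  unfold areaCurv
  exact continuous_const.div (by fun_prop) fun x => (pow_pos (sqrt_one_add_sq_pos x) 3).ne'

theorem contDiff_areaSlope : ContDiff ℝ 1 areaSlope := by
  rw [contDiff_one_iff_deriv]
  refine ⟨fun x => (hasDerivAt_areaSlope x).differentiableAt, ?_⟩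
  rw [show deriv areaSlope = areaCurv from funext fun x => (hasDerivAt_areaSlope x).deriv]
  exact continuous_areaCurv

theorem contDiff_areaCurv : ContDiff ℝ 1 areaCurv := by
  unfold areaCurv
  have h : ContDiff ℝ 1 fun x : ℝ => √(1 + x ^ 2) :=
    ContDiff.sqrt (by fun_prop) fun x => by positivity
  exact contDiff_const.div (h.pow 3) fun x => (pow_pos (sqrt_one_add_sq_pos x) 3).ne'

/-! ### Differentiation of the area along a quadratic family -/

section Quadratic

variable {α : Type*} [MeasurableSpace α] {μ : Measure α} {h₀ h₁ h₂ : α → ℝ}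
  {C : ℝ}

theorem deriv_integral_area [IsFiniteMeasure μ] (m₀ : Measurable h₀) (m₁ : Measurable h₁) (m₂ : Measurable h₂)
    (b₀ : ∀ᵐ p ∂μ, |h₀ p| ≤ C) (b₁ : ∀ᵐ p ∂μ, |h₁ p| ≤ C) (b₂ : ∀ᵐ p ∂μ, |h₂ p| ≤ C) :
    deriv (fun ε : ℝ => ∫ p, √(1 + (h₀ p + ε * h₁ p + ε ^ 2 * h₂ p) ^ 2) ∂μ) 0 =
      ∫ p, areaSlope (h₀ p) * h₁ p ∂μ ∧
    iteratedDeriv 2 (fun ε : ℝ => ∫ p, √(1 + (h₀ p + ε * h₁ p + ε ^ 2 * h₂ p) ^ 2) ∂μ) 0 =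
      ∫ p, areaCurv (h₀ p) * h₁ p ^ 2 + 2 * areaSlope (h₀ p) * h₂ p ∂μ := by
  set H : ℝ → α → ℝ := fun ε p => h₀ p + ε * h₁ p + ε ^ 2 * h₂ p with hH
  set H' : ℝ → α → ℝ := fun ε p => h₁ p + 2 * ε * h₂ p with hH'
  have mH : ∀ ε, Measurable (H ε) := fun ε => by fun_prop
  have mH' : ∀ ε, Measurable (H' ε) := fun ε => by fun_prop
  have dH : ∀ ε p, HasDerivAt (fun ε => H ε p) (H' ε p) ε := fun ε p => by
    have := (((hasDerivAt_id ε).mul_const (h₁ p)).const_add (h₀ p)).add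
      ((hasDerivAt_pow 2 ε).mul_const (h₂ p))
    convert! this using 1
    simp [hH']
  have dH' : ∀ ε p, HasDerivAt (fun ε => H' ε p) (2 * h₂ p) ε := fun ε p => by
    have := (((hasDerivAt_id ε).const_mul 2).mul_const (h₂ p)).const_add (h₁ p)
    convert! this using 1
    simp
  have bH : ∀ᵐ p ∂μ, ∀ ε ∈ ball (0 : ℝ) 1, |H ε p| ≤ 3 * C ∧ |H' ε p| ≤ 3 * C := by
    filter_upwards [b₀, b₁, b₂] with p a₀ a₁ a₂ ε hε
    rw [mem_ball_zero_iff, Real.norm_eq_abs] at hε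
    have h2 : |ε| ^ 2 ≤ 1 := pow_le_one₀ (abs_nonneg _) hε.le
    have e1 : |ε * h₁ p| ≤ C := by
      rw [abs_mul]; nlinarith [abs_nonneg (h₁ p), abs_nonneg ε]
    have e2 : |ε ^ 2 * h₂ p| ≤ C := by
      rw [abs_mul, abs_pow]; nlinarith [abs_nonneg (h₂ p), abs_nonneg ε]
    have e3 : |2 * ε * h₂ p| ≤ 2 * C := by
      rw [abs_mul, abs_mul, abs_two]; nlinarith [abs_nonneg (h₂ p), abs_nonneg ε]
    refine ⟨?_, ?_⟩
    · calc |H ε p| ≤ |h₀ p + ε * h₁ p| + |ε ^ 2 * h₂ p| := abs_add_le _ _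
        _ ≤ |h₀ p| + |ε * h₁ p| + |ε ^ 2 * h₂ p| := by gcongr; exact abs_add_le _ _
        _ ≤ 3 * C := by linarith
    · calc |H' ε p| ≤ |h₁ p| + |2 * ε * h₂ p| := abs_add_le _ _
        _ ≤ 3 * C := by linarith
  have D1 : ∀ ε ∈ ball (0 : ℝ) 1, HasDerivAt (fun ε : ℝ => ∫ p, √(1 + (H ε p) ^ 2) ∂μ)
      (∫ p, areaSlope (H ε p) * H' ε p ∂μ) ε := fun ε hε => by
    refine (hasDerivAt_integral_of_dominated_loc_of_deriv_le (μ := μ) (bound := fun _ => 3 * C)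
      (F' := fun ε p => areaSlope (H ε p) * H' ε p)
      (isOpen_ball.mem_nhds hε) (Eventually.of_forall fun x => ?_) ?_ ?_ ?_
      (integrable_const _) ?_).2
    · have := mH x
      exact Measurable.aestronglyMeasurable (by fun_prop)
    · refine Integrable.of_bound (C := 1 + 3 * C) ?_ ?_
      · have := mH ε
        exact Measurable.aestronglyMeasurable (by fun_prop)
      · filter_upwards [bH] with p hp
        rw [Real.norm_eq_abs, abs_of_pos (sqrt_one_add_sq_pos _)]
        refine Real.sqrt_le_iff.2 ⟨by linarith [abs_nonneg (H ε p), (hp ε hε).1], ?_⟩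
        have := (hp ε hε).1
        nlinarith [abs_nonneg (H ε p), sq_abs (H ε p)]
    · exact ((continuous_areaSlope.measurable.comp (mH ε)).mul (mH' ε)).aestronglyMeasurable
    · filter_upwards [bH] with p hp x hx
      rw [Real.norm_eq_abs, abs_mul]
      nlinarith [abs_nonneg (H' x p), abs_areaSlope_le_one (H x p), (hp x hx).2]
    · refine Eventually.of_forall fun p x _ => ?_
      have h : HasDerivAt ((fun x : ℝ => √(1 + x ^ 2)) ∘ fun ε => H ε p) _ x :=
        (hasDerivAt_area (H x p)).comp x (dH x p)
      exact h
  have h0 : (0 : ℝ) ∈ ball (0 : ℝ) 1 := mem_ball_self one_pos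
  have D2 : HasDerivAt (fun ε : ℝ => ∫ p, areaSlope (H ε p) * H' ε p ∂μ)
      (∫ p, areaCurv (H 0 p) * H' 0 p * H' 0 p + areaSlope (H 0 p) * (2 * h₂ p) ∂μ) 0 := by
    refine (hasDerivAt_integral_of_dominated_loc_of_deriv_le (μ := μ)
      (bound := fun _ => 3 * C * (3 * C) + 2 * C)
      (F' := fun ε p => areaCurv (H ε p) * H' ε p * H' ε p + areaSlope (H ε p) * (2 * h₂ p))
      (isOpen_ball.mem_nhds h0) (Eventually.of_forall fun x => ?_) ?_ ?_ ?_
      (integrable_const _) ?_).2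
    · exact ((continuous_areaSlope.measurable.comp (mH x)).mul (mH' x)).aestronglyMeasurable
    · refine Integrable.of_bound (C := 3 * C)
        ((continuous_areaSlope.measurable.comp (mH 0)).mul (mH' 0)).aestronglyMeasurable ?_
      filter_upwards [bH] with p hp
      rw [Real.norm_eq_abs, abs_mul]
      nlinarith [abs_nonneg (H' 0 p), abs_areaSlope_le_one (H 0 p), (hp 0 h0).2]
    · have := continuous_areaSlope.measurable.comp (mH 0)
      have := continuous_areaCurv.measurable.comp (mH 0)
      have := mH' 0
      refine Measurable.aestronglyMeasurable ?_
      simp only [Function.comp_def] at *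
      fun_prop
    · filter_upwards [bH, b₂] with p hp a₂ x hx
      have e1 : |areaCurv (H x p) * H' x p * H' x p| ≤ 3 * C * (3 * C) := by
        rw [abs_mul, abs_mul, abs_of_pos (areaCurv_pos _)]
        have := (hp x hx).2
        have := abs_nonneg (H' x p)
        have := areaCurv_le_one (H x p)
        have := areaCurv_pos (H x p)
        have : areaCurv (H x p) * |H' x p| ≤ 3 * C := by nlinarith
        gcongr
        linarith
      have e2 : |areaSlope (H x p) * (2 * h₂ p)| ≤ 2 * C := by
        rw [abs_mul, abs_mul, abs_two]
        nlinarith [abs_nonneg (h₂ p), abs_areaSlope_le_one (H x p), abs_nonneg (areaSlope (H x p))]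
      exact (abs_add_le _ _).trans (add_le_add e1 e2)
    · exact Eventually.of_forall fun p x _ =>
        by
        have h := (hasDerivAt_areaSlope (H x p)).comp x (dH x p)
        exact h.mul (dH' x p)
  refine ⟨?_, ?_⟩
  · rw [(D1 0 h0).deriv]
    simp [hH, hH']
  · rw [iteratedDeriv_succ, iteratedDeriv_one]
    have : deriv (fun ε : ℝ => ∫ p, √(1 + (H ε p) ^ 2) ∂μ) =ᶠ[𝓝 0]
        fun ε : ℝ => ∫ p, areaSlope (H ε p) * H' ε p ∂μ := by
      filter_upwards [isOpen_ball.mem_nhds h0] with ε hε using (D1 ε hε).deriv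
    rw [this.deriv_eq, D2.deriv]
    refine integral_congr_ae (Eventually.of_forall fun p => ?_)
    simp only [hH, hH']
    simp
    ring

end Quadratic

/-! ### Regularization of compactly supported Lipschitz functions -/

section Mollify

open scoped Convolution

variable {F : Type*} [NormedAddCommGroup F] [NormedSpace ℝ F]

theorem norm_convolution_normed_le (b : ContDiffBump (0 : ℝ × ℝ)) {g : ℝ × ℝ → F} {M : ℝ}
    (hg : ∀ p, ‖g p‖ ≤ M) (p : ℝ × ℝ) :
    ‖(b.normed volume ⋆[ContinuousLinearMap.lsmul ℝ ℝ, volume] g) p‖ ≤ M := by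
  rw [convolution_def]
  refine (norm_integral_le_of_norm_le (g := fun y => b.normed volume y * M)
    (b.integrable_normed.mul_const M) (Eventually.of_forall fun y => ?_)).trans ?_
  · rw [ContinuousLinearMap.lsmul_apply, norm_smul, Real.norm_of_nonneg (b.nonneg_normed y)]
    exact mul_le_mul_of_nonneg_left (hg _) (b.nonneg_normed y)
  · rw [integral_mul_const, b.integral_normed, one_mul]

theorem hasFDerivAt_convolution_normed (b : ContDiffBump (0 : ℝ × ℝ)) {u : ℝ × ℝ → ℝ} {K : ℝ≥0}
    (hu : LipschitzWith K u) (hc : HasCompactSupport u) (p : ℝ × ℝ) :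
    HasFDerivAt (b.normed volume ⋆[ContinuousLinearMap.lsmul ℝ ℝ, volume] u)
      ((b.normed volume ⋆[ContinuousLinearMap.lsmul ℝ ℝ, volume] fderiv ℝ u) p) p := by
  obtain ⟨M, hM⟩ := hc.exists_bound_of_continuous hu.continuous
  have hb := b.continuous_normed (μ := volume)
  have hK : ∀ q, ‖fderiv ℝ u q‖ ≤ K := fun q => norm_fderiv_le_of_lipschitz ℝ hu
  have key := hasFDerivAt_integral_of_dominated_loc_of_lip (μ := volume) (x₀ := p) (s := univ)
    (F := fun q y => b.normed volume y * u (q - y))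
    (F' := fun y => b.normed volume y • fderiv ℝ u (p - y))
    (bound := fun y => b.normed volume y * K) univ_mem
    (Eventually.of_forall fun q => ?_) ?_ ?_ ?_ (b.integrable_normed.mul_const _) ?_
  · exact key.2
  · have := hu.continuous
    exact Continuous.aestronglyMeasurable (by fun_prop)
  · refine Integrable.mono' (b.integrable_normed.mul_const M) ?_ (Eventually.of_forall fun y => ?_)
    · have := hu.continuous
      exact Continuous.aestronglyMeasurable (by fun_prop)
    · rw [norm_mul, Real.norm_of_nonneg (b.nonneg_normed y)]
      exact mul_le_mul_of_nonneg_left (hM _) (b.nonneg_normed y)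
  · have h1 : Measurable fun y : ℝ × ℝ => fderiv ℝ u (p - y) :=
      (measurable_fderiv ℝ u).comp (measurable_const.sub measurable_id)
    exact (hb.measurable.smul h1).aestronglyMeasurable
  · refine Eventually.of_forall fun y => LipschitzWith.lipschitzOnWith ?_
    refine LipschitzWith.of_dist_le_mul fun q r => ?_
    have := hu.dist_le_mul (q - y) (r - y)
    rw [dist_sub_right, Real.dist_eq] at this
    rw [Real.coe_nnabs, abs_mul, abs_of_nonneg (b.nonneg_normed y), Real.dist_eq, ← mul_sub,
      abs_mul, abs_of_nonneg (b.nonneg_normed y), abs_of_nonneg K.coe_nonneg, mul_assoc]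
    exact mul_le_mul_of_nonneg_left this (b.nonneg_normed y)
  · have h1 := hu.ae_differentiableAt (μ := volume)
    have h2 := (quasiMeasurePreserving_sub_left volume p).ae h1
    filter_upwards [h2] with y hy
    have h3 : HasFDerivAt (fun q => u (q - y)) (fderiv ℝ u (p - y)) p := by
      have := hy.hasFDerivAt.comp p (hasFDerivAt_sub_const (x := p) y)
      simpa using! this
    exact h3.const_smul (b.normed volume y)

/-- A compactly supported locally Lipschitz function is the limit of smooth functions with supports
in a fixed ball, with uniform bounds, and with almost everywhere convergence of the gradients. -/
theorem exists_smooth_approx {u : ℝ × ℝ → ℝ} (hu : LocallyLipschitz u)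
    (hc : HasCompactSupport u) :
    ∃ (R C : ℝ) (v : ℕ → ℝ × ℝ → ℝ), (∀ n, ContDiff ℝ ((⊤ : ℕ∞) : WithTop ℕ∞) (v n)) ∧
      (∀ n, tsupport (v n) ⊆ closedBall 0 R) ∧
      (∀ n p, |v n p| ≤ C) ∧ (∀ n p, ‖fderiv ℝ (v n) p‖ ≤ C) ∧
      (∀ p, Tendsto (fun n => v n p) atTop (𝓝 (u p))) ∧
      ∀ᵐ p, Tendsto (fun n => fderiv ℝ (v n) p) atTop (𝓝 (fderiv ℝ u p)) := by
  obtain ⟨K, hK⟩ := locLip_lipschitzWith hu hc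
  obtain ⟨M, hM⟩ := hc.exists_bound_of_continuous hu.continuous
  obtain ⟨R, hR⟩ := hc.isCompact.isBounded.subset_closedBall 0
  let b : ℕ → ContDiffBump (0 : ℝ × ℝ) := fun n =>
    { rIn := 1 / ((n : ℝ) + 1)
      rOut := 2 * (1 / ((n : ℝ) + 1))
      rIn_pos := Nat.one_div_pos_of_nat
      rIn_lt_rOut := by have : (0 : ℝ) < 1 / ((n : ℝ) + 1) := Nat.one_div_pos_of_nat
                        linarith }
  have hb0 : Tendsto (fun n => (b n).rOut) atTop (𝓝 0) := by
    have := tendsto_one_div_add_atTop_nhds_zero_nat (𝕜 := ℝ)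
    have h := this.const_mul 2
    rw [mul_zero] at h
    exact h
  have hb2 : ∀ n, (b n).rOut ≤ 2 := fun n => by
    have h : 1 / ((n : ℝ) + 1) ≤ 1 := by
      rw [div_le_one (by positivity)]
      linarith [n.cast_nonneg (α := ℝ)]
    change 2 * (1 / ((n : ℝ) + 1)) ≤ 2
    linarith
  have hfd : ∀ n, fderiv ℝ ((b n).normed volume ⋆[ContinuousLinearMap.lsmul ℝ ℝ, volume] u) =
      (b n).normed volume ⋆[ContinuousLinearMap.lsmul ℝ ℝ, volume] fderiv ℝ u := fun n =>
    funext fun p => (hasFDerivAt_convolution_normed (b n) hK hc p).fderiv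
  refine ⟨2 + R, max M K,
    fun n => (b n).normed volume ⋆[ContinuousLinearMap.lsmul ℝ ℝ, volume] u,
    fun n => ?_, fun n => ?_, fun n p => ?_, fun n p => ?_, fun p => ?_, ?_⟩
  · exact (b n).hasCompactSupport_normed.contDiff_convolution_left _ (b n).contDiff_normed
      hu.continuous.locallyIntegrable
  · refine closure_minimal ((support_convolution_subset _).trans ?_) isClosed_closedBall
    rintro _ ⟨x, hx, y, hy, rfl⟩
    rw [(b n).support_normed_eq, mem_ball_zero_iff] at hx
    have hy' := hR (subset_tsupport _ hy)
    rw [mem_closedBall_zero_iff] at hy' ⊢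
    linarith [norm_add_le x y, hb2 n]
  · exact (norm_convolution_normed_le (b n) hM p).trans (le_max_left _ _)
  · rw [hfd n]
    exact (norm_convolution_normed_le (b n)
      (fun q => norm_fderiv_le_of_lipschitz ℝ hK) p).trans (le_max_right _ _)
  · exact ContDiffBump.convolution_tendsto_right_of_continuous hb0 hu.continuous p
  · have hli : LocallyIntegrable (fderiv ℝ u) (volume : Measure (ℝ × ℝ)) := by
      have : MemLp (fderiv ℝ u) ⊤ (volume : Measure (ℝ × ℝ)) :=
        memLp_top_of_bound (measurable_fderiv ℝ u).aestronglyMeasurable K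
          (Eventually.of_forall fun q => norm_fderiv_le_of_lipschitz ℝ hK)
      exact this.locallyIntegrable le_top
    have := ContDiffBump.ae_convolution_tendsto_right_of_locallyIntegrable (φ := b) (K := 2) hb0
      (Eventually.of_forall fun n => le_rfl) hli
    filter_upwards [this] with p hp
    simp_rw [hfd]
    exact hp

end Mollify

/-! ### First and second variation formulas -/

/-- The linearization `∇^f φ + (∂_t f) φ` of `u ↦ ∇^u u` at `f` in the direction `φ`. -/
noncomputable def linDeriv (f φ : ℝ × ℝ → ℝ) (p : ℝ × ℝ) : ℝ :=
  intrinsicDeriv f φ p + fderiv ℝ f p (0, 1) * φ p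

theorem intrinsicDeriv_eq (f u : ℝ × ℝ → ℝ) (p : ℝ × ℝ) :
    intrinsicDeriv f u p = fderiv ℝ u p (1, 0) + f p * fderiv ℝ u p (0, 1) := by
  rw [intrinsicDeriv, ← smul_eq_mul, ← map_smul, ← map_add]
  simp

theorem measurable_intrinsicDeriv {f : ℝ × ℝ → ℝ} (hf : Measurable f) (u : ℝ × ℝ → ℝ) :
    Measurable (intrinsicDeriv f u) := by
  rw [show intrinsicDeriv f u = _ from funext (intrinsicDeriv_eq f u)]
  exact (measurable_fderiv_apply_const ℝ u _).add
    (hf.mul (measurable_fderiv_apply_const ℝ u _))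

theorem measurable_linDeriv {f φ : ℝ × ℝ → ℝ} (hf : Measurable f) (hφ : Measurable φ) :
    Measurable (linDeriv f φ) :=
  (measurable_intrinsicDeriv hf φ).add ((measurable_fderiv_apply_const ℝ f _).mul hφ)

theorem abs_fderiv_apply_le (u : ℝ × ℝ → ℝ) (p : ℝ × ℝ) {C : ℝ} (hC : ‖fderiv ℝ u p‖ ≤ C) :
    |fderiv ℝ u p (1, 0)| ≤ C ∧ |fderiv ℝ u p (0, 1)| ≤ C := by
  constructor
  · have := (fderiv ℝ u p).le_opNorm (1, 0)
    simp [Prod.norm_def] at this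
    exact this.trans hC
  · have := (fderiv ℝ u p).le_opNorm (0, 1)
    simp [Prod.norm_def] at this
    exact this.trans hC

theorem abs_intrinsicDeriv_le {f u : ℝ × ℝ → ℝ} {p : ℝ × ℝ} {C D : ℝ} (hf : |f p| ≤ C)
    (hC : ‖fderiv ℝ u p‖ ≤ D) : |intrinsicDeriv f u p| ≤ D + C * D := by
  have h := abs_fderiv_apply_le u p hC
  rw [intrinsicDeriv_eq]
  refine (abs_add_le _ _).trans (add_le_add h.1 ?_)
  rw [abs_mul]
  exact mul_le_mul hf h.2 (abs_nonneg _) ((abs_nonneg _).trans hf)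

theorem abs_linDeriv_le {f φ : ℝ × ℝ → ℝ} {p : ℝ × ℝ} {C D : ℝ} (hf : |f p| ≤ C)
    (hf' : ‖fderiv ℝ f p‖ ≤ C) (hφ : |φ p| ≤ D)
    (hC : ‖fderiv ℝ φ p‖ ≤ D) : |linDeriv f φ p| ≤ D + C * D + C * D := by
  refine (abs_add_le _ _).trans (add_le_add (abs_intrinsicDeriv_le hf hC) ?_)
  rw [abs_mul]
  exact mul_le_mul (abs_fderiv_apply_le f p hf').2 hφ (abs_nonneg _)
    ((norm_nonneg _).trans hf')

theorem intrinsicDeriv_variation {f φ : ℝ × ℝ → ℝ} {p : ℝ × ℝ} (hf : DifferentiableAt ℝ f p)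
    (hφ : DifferentiableAt ℝ φ p) (ε : ℝ) :
    intrinsicDeriv (fun q => f q + ε * φ q) (fun q => f q + ε * φ q) p =
      intrinsicDeriv f f p + ε * linDeriv f φ p + ε ^ 2 * (φ p * fderiv ℝ φ p (0, 1)) := by
  have h : fderiv ℝ (fun q => f q + ε * φ q) p = fderiv ℝ f p + ε • fderiv ℝ φ p :=
    (hf.hasFDerivAt.add (hφ.hasFDerivAt.const_mul ε)).fderiv
  rw [intrinsicDeriv_eq, linDeriv, intrinsicDeriv_eq, intrinsicDeriv_eq, h]
  simp only [add_apply, smul_apply, smul_eq_mul]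
  ring

theorem variation_eq {f φ : ℝ × ℝ → ℝ} (hf : LocallyLipschitz f)
    (hφ : ContDiff ℝ ((⊤ : ℕ∞) : WithTop ℕ∞) φ) (hc : HasCompactSupport φ) :
    firstVariation f φ = ∫ p, areaSlope (intrinsicDeriv f f p) * linDeriv f φ p ∧
    secondVariation f φ = ∫ p, areaCurv (intrinsicDeriv f f p) * linDeriv f φ p ^ 2 +
      2 * areaSlope (intrinsicDeriv f f p) * (φ p * fderiv ℝ φ p (0, 1)) := by
  have hφ1 : LocallyLipschitz φ :=
    ContDiff.locallyLipschitz (𝕂 := ℝ) (hφ.of_le (by exact_mod_cast le_top))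
  have hφd : Differentiable ℝ φ := hφ.differentiable (by simp)
  have harea : (fun ε : ℝ => graphArea (fun p => f p + ε * φ p) (tsupport φ)) = fun ε : ℝ =>
      ∫ p in tsupport φ, √(1 + (intrinsicDeriv f f p + ε * linDeriv f φ p +
        ε ^ 2 * (φ p * fderiv ℝ φ p (0, 1))) ^ 2) := by
    funext ε
    refine integral_congr_ae (ae_restrict_of_ae ?_)
    filter_upwards [locLip_ae_differentiableAt hf] with p hp
    rw [intrinsicDeriv_variation hp (hφd p)]
  obtain ⟨R, hR⟩ := hc.isCompact.isBounded.subset_closedBall 0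
  obtain ⟨C, hC0, hC⟩ := locLip_exists_norm_fderiv_le hf R
  obtain ⟨D, hD0, hD⟩ := locLip_exists_norm_fderiv_le hφ1 R
  have : IsFiniteMeasure ((volume : Measure (ℝ × ℝ)).restrict (tsupport φ)) :=
    ⟨by rw [Measure.restrict_apply_univ]; exact hc.isCompact.measure_lt_top⟩
  have hm := isClosed_tsupport φ |>.measurableSet
  have hfm := hf.continuous.measurable
  have hφm := hφ1.continuous.measurable
  have bnd : ∀ {h : ℝ × ℝ → ℝ}, (∀ p ∈ closedBall (0 : ℝ × ℝ) R,
      |h p| ≤ (C + C * C) + (D + C * D + C * D) + D * D) →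
      ∀ᵐ p ∂((volume : Measure (ℝ × ℝ)).restrict (tsupport φ)),
        |h p| ≤ (C + C * C) + (D + C * D + C * D) + D * D := fun h =>
    (ae_restrict_iff' hm).2 (Eventually.of_forall fun p hp => h p (hR hp))
  have key := deriv_integral_area (μ := (volume : Measure (ℝ × ℝ)).restrict (tsupport φ))
    (measurable_intrinsicDeriv hfm f) (measurable_linDeriv hfm hφm)
    (hφm.mul (measurable_fderiv_apply_const ℝ φ (0, 1)))
    (bnd fun p hp => (abs_intrinsicDeriv_le (hC p hp).1 (hC p hp).2).trans
      (by have : 0 ≤ C * D := by positivity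
          nlinarith))
    (bnd fun p hp => (abs_linDeriv_le (hC p hp).1 (hC p hp).2 (hD p hp).1 (hD p hp).2).trans
      (by nlinarith))
    (bnd fun p hp => by
      rw [Pi.mul_apply, abs_mul]
      have := mul_le_mul (hD p hp).1 (abs_fderiv_apply_le φ p (hD p hp).2).2 (abs_nonneg _) hD0
      have : 0 ≤ C * D := by positivity
      nlinarith)
  rw [firstVariation, secondVariation, harea]
  refine ⟨key.1.trans ?_, key.2.trans ?_⟩
  · refine setIntegral_eq_integral_of_forall_compl_eq_zero fun p hp => ?_
    have := tsupport_fderiv_apply_eq_zero hp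
    simp [linDeriv, intrinsicDeriv, this.1, this.2]
  · refine setIntegral_eq_integral_of_forall_compl_eq_zero fun p hp => ?_
    have := tsupport_fderiv_apply_eq_zero hp
    simp [linDeriv, intrinsicDeriv, this.1, this.2]

/-- The first variation identity and the second variation inequality hold for all compactly
supported locally Lipschitz directions. -/
theorem IsStable.variation {f : ℝ × ℝ → ℝ} (hf : LocallyLipschitz f) (hs : IsStable f)
    {φ : ℝ × ℝ → ℝ} (hφ : LocallyLipschitz φ) (hc : HasCompactSupport φ) :
    ∫ p, areaSlope (intrinsicDeriv f f p) * linDeriv f φ p = 0 ∧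
    0 ≤ ∫ p, areaCurv (intrinsicDeriv f f p) * linDeriv f φ p ^ 2 +
      2 * areaSlope (intrinsicDeriv f f p) * (φ p * fderiv ℝ φ p (0, 1)) := by
  obtain ⟨R, D, v, hv, hvs, hvb, hvb', hvl, hvl'⟩ := exists_smooth_approx hφ hc
  obtain ⟨C, hC0, hC⟩ := locLip_exists_norm_fderiv_le hf R
  have hD0 : 0 ≤ D := (abs_nonneg _).trans (hvb 0 0)
  have hvc : ∀ n, HasCompactSupport (v n) := fun n =>
    (isCompact_closedBall _ _).of_isClosed_subset (isClosed_tsupport _) (hvs n)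
  have hz : ∀ n p, p ∉ closedBall (0 : ℝ × ℝ) R → v n p = 0 ∧ fderiv ℝ (v n) p = 0 := fun n p hp =>
    tsupport_fderiv_apply_eq_zero fun h => hp (hvs n h)
  have hfm := hf.continuous.measurable
  have hvm : ∀ n, Measurable (v n) := fun n => (hv n).continuous.measurable
  have hAm := measurable_intrinsicDeriv hfm f
  have hlin : ∀ n, ∀ p ∈ closedBall (0 : ℝ × ℝ) R,
      |linDeriv f (v n) p| ≤ D + C * D + C * D := fun n p hp =>
    abs_linDeriv_le (hC p hp).1 (hC p hp).2 (hvb n p) (hvb' n p)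
  have hlim : ∀ᵐ p, Tendsto (fun n => linDeriv f (v n) p) atTop (𝓝 (linDeriv f φ p)) ∧
      Tendsto (fun n => v n p * fderiv ℝ (v n) p (0, 1)) atTop (𝓝 (φ p * fderiv ℝ φ p (0, 1))) := by
    filter_upwards [hvl'] with p hp
    have h1 : ∀ w : ℝ × ℝ, Tendsto (fun n => fderiv ℝ (v n) p w) atTop (𝓝 (fderiv ℝ φ p w)) :=
      fun w => ((ContinuousLinearMap.apply ℝ ℝ w).continuous.tendsto _).comp hp
    exact ⟨(h1 _).add (tendsto_const_nhds.mul (hvl p)), (hvl p).mul (h1 _)⟩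
  have hma := continuous_areaSlope.measurable.comp hAm
  have hmc := continuous_areaCurv.measurable.comp hAm
  constructor
  · have h := tendsto_integral_of_bounded R (D + C * D + C * D)
      (F := fun n p => areaSlope (intrinsicDeriv f f p) * linDeriv f (v n) p)
      (F' := fun p => areaSlope (intrinsicDeriv f f p) * linDeriv f φ p)
      (fun n => (hma.mul (measurable_linDeriv hfm (hvm n))).aestronglyMeasurable)
      (fun n => Eventually.of_forall fun p hp => ?_) (fun n p hp => ?_) ?_
    · refine tendsto_nhds_unique h ?_
      refine tendsto_const_nhds.congr fun n => ?_
      rw [← (variation_eq hf (hv n) (hvc n)).1]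
      exact (hs.1 (v n) (hv n) (hvc n)).symm
    · rw [abs_mul]
      have := hlin n p hp
      nlinarith [abs_areaSlope_le_one (intrinsicDeriv f f p), abs_nonneg (linDeriv f (v n) p)]
    · simp [linDeriv, intrinsicDeriv, hz n p hp]
    · filter_upwards [hlim] with p hp using hp.1.const_mul _
  · have h := tendsto_integral_of_bounded R ((D + C * D + C * D) ^ 2 + 2 * (D * D))
      (F := fun n p => areaCurv (intrinsicDeriv f f p) * linDeriv f (v n) p ^ 2 +
        2 * areaSlope (intrinsicDeriv f f p) * (v n p * fderiv ℝ (v n) p (0, 1)))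
      (F' := fun p => areaCurv (intrinsicDeriv f f p) * linDeriv f φ p ^ 2 +
        2 * areaSlope (intrinsicDeriv f f p) * (φ p * fderiv ℝ φ p (0, 1)))
      (fun n => ((hmc.mul ((measurable_linDeriv hfm (hvm n)).pow_const 2)).add
        ((hma.const_mul 2).mul ((hvm n).mul
          (measurable_fderiv_apply_const ℝ (v n) (0, 1))))).aestronglyMeasurable)
      (fun n => Eventually.of_forall fun p hp => ?_) (fun n p hp => ?_) ?_
    · refine ge_of_tendsto' h fun n => ?_
      rw [← (variation_eq hf (hv n) (hvc n)).2]
      exact hs.2 (v n) (hv n) (hvc n)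
    · refine (abs_add_le _ _).trans (add_le_add ?_ ?_)
      · rw [abs_mul, abs_of_pos (areaCurv_pos _), abs_pow]
        have h1 := pow_le_pow_left₀ (abs_nonneg _) (hlin n p hp) 2
        nlinarith [areaCurv_le_one (intrinsicDeriv f f p), areaCurv_pos (intrinsicDeriv f f p),
          pow_nonneg (abs_nonneg (linDeriv f (v n) p)) 2]
      · rw [abs_mul, abs_mul, abs_mul, abs_two]
        have h1 := mul_le_mul (hvb n p) (abs_fderiv_apply_le (v n) p (hvb' n p)).2
          (abs_nonneg _) hD0
        have h2 := abs_areaSlope_le_one (intrinsicDeriv f f p)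
        have h3 := mul_nonneg (abs_nonneg (v n p)) (abs_nonneg (fderiv ℝ (v n) p (0, 1)))
        nlinarith
    · simp [linDeriv, intrinsicDeriv, hz n p hp]
    · filter_upwards [hlim] with p hp using
        ((hp.1.pow 2).const_mul _).add (hp.2.const_mul _)

/-! ### Flows of characteristics -/

/-- `χ (s, u)` is the position at time `s` of the characteristic (integral curve of `∂_y + f ∂_t`)
with label `u`, and `τ p` is the label of the characteristic through `p`. Labels are positions at a
reference time. -/
structure IsCharFlow (f χ τ : ℝ × ℝ → ℝ) : Prop where
  locLip_field : LocallyLipschitz f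
  locLip_flow : LocallyLipschitz χ
  locLip_label : LocallyLipschitz τ
  flow_label : ∀ p : ℝ × ℝ, χ (p.1, τ p) = p.2
  label_flow : ∀ s u : ℝ, τ (s, χ (s, u)) = u
  hasDerivAt : ∀ u s : ℝ, HasDerivAt (fun r : ℝ => χ (r, u)) (f (s, χ (s, u))) s
  exists_base : ∃ s₀ : ℝ, ∀ u : ℝ, χ (s₀, u) = u

/-- The point at the same time as `p`, on the characteristic whose label exceeds that of `p`
by `h`. -/
noncomputable def shift (χ τ : ℝ × ℝ → ℝ) (h : ℝ) (p : ℝ × ℝ) : ℝ := χ (p.1, τ p + h)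

/-- The difference quotient of `u` in `t` between the characteristic through `p` and its shift
by `h`. -/
noncomputable def charQuot (χ τ u : ℝ × ℝ → ℝ) (h : ℝ) (p : ℝ × ℝ) : ℝ :=
  (u (p.1, shift χ τ h p) - u p) / (shift χ τ h p - p.2)

theorem hasDerivAt_snd_of_differentiableAt {u : ℝ × ℝ → ℝ} {p : ℝ × ℝ}
    (hu : DifferentiableAt ℝ u p) :
    HasDerivAt (fun r : ℝ => u (p.1, r)) (fderiv ℝ u p (0, 1)) p.2 := by
  have h1 : HasDerivAt (fun r : ℝ => (p.1, r)) ((0 : ℝ), (1 : ℝ)) p.2 :=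
    (hasDerivAt_const _ _).prodMk (hasDerivAt_id _)
  exact hu.hasFDerivAt.comp_hasDerivAt p.2 h1

namespace IsCharFlow

variable {f χ τ : ℝ × ℝ → ℝ}

theorem strictMono (H : IsCharFlow f χ τ) (s : ℝ) : StrictMono fun u => χ (s, u) := by
  intro u v huv
  obtain ⟨s₀, h₀⟩ := H.exists_base
  have hne : ∀ r, χ (r, v) - χ (r, u) ≠ 0 := fun r h => by
    have := congrArg (fun t => τ (r, t)) (sub_eq_zero.1 h)
    simp only [H.label_flow] at this
    exact huv.ne' this
  have hc : Continuous fun r => χ (r, v) - χ (r, u) :=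
    (H.locLip_flow.continuous.comp (by fun_prop)).sub (H.locLip_flow.continuous.comp (by fun_prop))
  by_contra hcon
  have h1 : χ (s, v) - χ (s, u) ≤ 0 := by
    simp only [not_lt] at hcon
    linarith
  have h2 : 0 ≤ χ (s₀, v) - χ (s₀, u) := by rw [h₀, h₀]; linarith
  obtain ⟨r, hr⟩ := mem_range_of_exists_le_of_exists_ge hc ⟨s, h1⟩ ⟨s₀, h2⟩
  exact hne r hr

theorem shift_zero (H : IsCharFlow f χ τ) (p : ℝ × ℝ) : shift χ τ 0 p = p.2 := by
  rw [shift, add_zero, H.flow_label]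

theorem lt_shift (H : IsCharFlow f χ τ) {h : ℝ} (hh : 0 < h) (p : ℝ × ℝ) :
    p.2 < shift χ τ h p := by
  rw [← H.shift_zero p]
  exact H.strictMono p.1 (by linarith)

theorem shift_flow (H : IsCharFlow f χ τ) (h s u : ℝ) :
    shift χ τ h (s, χ (s, u)) = χ (s, u + h) := by
  rw [shift, H.label_flow]

theorem label_shift (H : IsCharFlow f χ τ) (h : ℝ) (p : ℝ × ℝ) :
    τ (p.1, shift χ τ h p) = τ p + h := H.label_flow _ _

theorem locLip_shift (H : IsCharFlow f χ τ) (h : ℝ) : LocallyLipschitz (shift χ τ h) :=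
  H.locLip_flow.comp (locLip_fst.prodMk (locLip_add H.locLip_label (LocallyLipschitz.const h)))

theorem locLip_comp_shift (H : IsCharFlow f χ τ) {u : ℝ × ℝ → ℝ} (hu : LocallyLipschitz u) (h : ℝ) :
    LocallyLipschitz fun p : ℝ × ℝ => u (p.1, shift χ τ h p) :=
  hu.comp (locLip_fst.prodMk (H.locLip_shift h))

theorem locLip_charQuot (H : IsCharFlow f χ τ) {u : ℝ × ℝ → ℝ} (hu : LocallyLipschitz u) {h : ℝ}
    (hh : 0 < h) : LocallyLipschitz (charQuot χ τ u h) := by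
  have := locLip_mul (locLip_sub (H.locLip_comp_shift hu h) hu)
    (locLip_inv (locLip_sub (H.locLip_shift h) locLip_snd)
      fun p => (sub_pos.2 (H.lt_shift hh p)).ne')
  simpa only [charQuot, div_eq_mul_inv] using! this

theorem tendsto_shift (H : IsCharFlow f χ τ) {l : ℕ → ℝ} (hl : Tendsto l atTop (𝓝 0))
    (p : ℝ × ℝ) : Tendsto (fun n => shift χ τ (l n) p) atTop (𝓝 p.2) := by
  have hc : Continuous fun h : ℝ => shift χ τ h p :=
    H.locLip_flow.continuous.comp (by fun_prop)
  have := (hc.tendsto 0).comp hl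
  rwa [H.shift_zero] at this

theorem tendsto_charQuot (H : IsCharFlow f χ τ) {l : ℕ → ℝ} (hl : Tendsto l atTop (𝓝 0))
    (hl0 : ∀ n, 0 < l n) {u : ℝ × ℝ → ℝ} {p : ℝ × ℝ} (hu : DifferentiableAt ℝ u p) :
    Tendsto (fun n => charQuot χ τ u (l n) p) atTop (𝓝 (fderiv ℝ u p (0, 1))) := by
  have h1 := (hasDerivAt_iff_tendsto_slope.1 (hasDerivAt_snd_of_differentiableAt hu))
  have h2 : Tendsto (fun n => shift χ τ (l n) p) atTop (𝓝[≠] p.2) :=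
    tendsto_nhdsWithin_iff.2 ⟨H.tendsto_shift hl p,
      Eventually.of_forall fun n => (H.lt_shift (hl0 n) p).ne'⟩
  refine (h1.comp h2).congr fun n => ?_
  simp only [Function.comp, slope_def_field, charQuot]

theorem exists_charQuot_le (H : IsCharFlow f χ τ) {u : ℝ × ℝ → ℝ} (hu : LocallyLipschitz u)
    (R : ℝ) : ∃ C : ℝ, 0 ≤ C ∧ ∀ h ∈ Ioc (0 : ℝ) 1, ∀ p ∈ closedBall (0 : ℝ × ℝ) R,
      |charQuot χ τ u h p| ≤ C := by
  have hc : Continuous fun q : ℝ × (ℝ × ℝ) => shift χ τ q.1 q.2 := by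
    have := H.locLip_flow.continuous
    have := H.locLip_label.continuous
    unfold shift
    fun_prop
  obtain ⟨R', hR'⟩ := ((isCompact_Icc (a := (0 : ℝ)) (b := 1)).prod
    (isCompact_closedBall (0 : ℝ × ℝ) R)).exists_bound_of_continuousOn hc.continuousOn
  obtain ⟨K, hK⟩ := locLip_exists_lipschitzOnWith hu (max R R')
  refine ⟨K, K.coe_nonneg, fun h hh p hp => ?_⟩
  have hpos := sub_pos.2 (H.lt_shift hh.1 p)
  rw [charQuot, abs_div, abs_of_pos hpos, div_le_iff₀ hpos]
  have h1 := hR' (h, p) ⟨⟨hh.1.le, hh.2⟩, hp⟩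
  rw [mem_closedBall_zero_iff, Prod.norm_def, max_le_iff] at hp
  have h2 := hK.dist_le_mul (p.1, shift χ τ h p) (by
    rw [mem_closedBall_zero_iff, Prod.norm_def]
    exact max_le (hp.1.trans (le_max_left _ _)) (h1.trans (le_max_right _ _))) p (by
    rw [mem_closedBall_zero_iff, Prod.norm_def]
    exact max_le (hp.1.trans (le_max_left _ _)) (hp.2.trans (le_max_left _ _)))
  rw [Real.dist_eq, Prod.dist_eq, dist_self, Real.dist_eq, abs_of_pos hpos,
    max_eq_right hpos.le] at h2
  exact h2

/-- The chain rule along characteristics. -/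
theorem hasDerivAt_comp (H : IsCharFlow f χ τ) {u : ℝ × ℝ → ℝ} {p : ℝ × ℝ}
    (hu : DifferentiableAt ℝ u p) :
    HasDerivAt (fun s => u (s, χ (s, τ p))) (intrinsicDeriv f u p) p.1 := by
  have h1 : HasDerivAt (fun s => (s, χ (s, τ p))) ((1 : ℝ), f p) p.1 := by
    have := H.hasDerivAt (τ p) p.1
    rw [H.flow_label] at this
    exact (hasDerivAt_id _).prodMk this
  have h2 : HasFDerivAt u (fderiv ℝ u p) (p.1, χ (p.1, τ p)) := by
    rw [H.flow_label]
    exact hu.hasFDerivAt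
  exact h2.comp_hasDerivAt p.1 h1

theorem intrinsicDeriv_eq_of_hasDerivAt (H : IsCharFlow f χ τ) {u : ℝ × ℝ → ℝ} {p : ℝ × ℝ}
    (hu : DifferentiableAt ℝ u p) {d : ℝ}
    (hd : HasDerivAt (fun s => u (s, χ (s, τ p))) d p.1) : intrinsicDeriv f u p = d :=
  (H.hasDerivAt_comp hu).unique hd

theorem label_charQuot (H : IsCharFlow f χ τ) (h : ℝ) (p : ℝ × ℝ) :
    charQuot χ τ τ h p = h / (shift χ τ h p - p.2) := by
  rw [charQuot, H.label_shift, add_sub_cancel_left]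

theorem label_charQuot_pos (H : IsCharFlow f χ τ) {h : ℝ} (hh : 0 < h) (p : ℝ × ℝ) :
    0 < charQuot χ τ τ h p := by
  rw [H.label_charQuot]
  exact div_pos hh (sub_pos.2 (H.lt_shift hh p))

/-- The derivative of a difference quotient along a characteristic. -/
theorem hasDerivAt_charQuot (H : IsCharFlow f χ τ) {u : ℝ × ℝ → ℝ} {p : ℝ × ℝ} {h d d' : ℝ}
    (hh : 0 < h) (hd : HasDerivAt (fun s => u (s, χ (s, τ p))) d p.1)
    (hd' : HasDerivAt (fun s => u (s, χ (s, τ p + h))) d' p.1) :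
    HasDerivAt (fun s => charQuot χ τ u h (s, χ (s, τ p)))
      ((d' - d) / (shift χ τ h p - p.2) - charQuot χ τ u h p * charQuot χ τ f h p) p.1 := by
  have hpos := sub_pos.2 (H.lt_shift hh p)
  have e : (fun s => charQuot χ τ u h (s, χ (s, τ p))) = fun s =>
      (u (s, χ (s, τ p + h)) - u (s, χ (s, τ p))) / (χ (s, τ p + h) - χ (s, τ p)) := by
    funext s
    simp only [charQuot, H.shift_flow]
  rw [e]
  have hne : χ (p.1, τ p + h) - χ (p.1, τ p) ≠ 0 := by
    rw [H.flow_label]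
    exact hpos.ne'
  refine ((hd'.sub hd).div ((H.hasDerivAt (τ p + h) p.1).sub (H.hasDerivAt (τ p) p.1))
    hne).congr_deriv ?_
  simp only [charQuot, shift, Pi.sub_apply, H.flow_label] at hne ⊢
  field_simp

theorem hasDerivAt_label (H : IsCharFlow f χ τ) (s u : ℝ) :
    HasDerivAt (fun s => τ (s, χ (s, u))) 0 s := by
  simp only [H.label_flow]
  exact hasDerivAt_const _ _

theorem intrinsicDeriv_label_charQuot (H : IsCharFlow f χ τ) {p : ℝ × ℝ} {h : ℝ} (hh : 0 < h)
    (hd : DifferentiableAt ℝ (charQuot χ τ τ h) p) :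
    intrinsicDeriv f (charQuot χ τ τ h) p = -(charQuot χ τ τ h p * charQuot χ τ f h p) := by
  rw [H.intrinsicDeriv_eq_of_hasDerivAt hd (H.hasDerivAt_charQuot hh (H.hasDerivAt_label _ _)
    (H.hasDerivAt_label _ _))]
  simp

/-- The difference quotients of `τ` are bounded below by the reciprocal of a Lipschitz constant of
`χ`. -/
theorem fderiv_label_pos (H : IsCharFlow f χ τ) {p : ℝ × ℝ} (hd : DifferentiableAt ℝ τ p) :
    0 < fderiv ℝ τ p (0, 1) := by
  have hl := tendsto_one_div_add_atTop_nhds_zero_nat (𝕜 := ℝ)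
  have hl0 : ∀ n : ℕ, (0 : ℝ) < 1 / ((n : ℝ) + 1) := fun n => Nat.one_div_pos_of_nat
  have hl1 : ∀ n : ℕ, 1 / ((n : ℝ) + 1) ≤ 1 := fun n => by
    rw [div_le_one (by positivity)]
    linarith [n.cast_nonneg (α := ℝ)]
  obtain ⟨K, hK⟩ := locLip_exists_lipschitzOnWith H.locLip_flow (max |p.1| (|τ p| + 1))
  have hb : ∀ n : ℕ, 1 / ((K : ℝ) + 1) ≤ charQuot χ τ τ (1 / ((n : ℝ) + 1)) p := fun n => by
    rw [H.label_charQuot, div_le_div_iff₀ (by positivity) (sub_pos.2 (H.lt_shift (hl0 n) p)),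
      one_mul]
    have h1 := hK.dist_le_mul (p.1, τ p + 1 / ((n : ℝ) + 1)) (by
      rw [mem_closedBall_zero_iff, Prod.norm_def]
      refine max_le_max le_rfl ((abs_add_le _ _).trans ?_)
      rw [abs_of_pos (hl0 n)]
      gcongr
      exact hl1 n) (p.1, τ p) (by
      rw [mem_closedBall_zero_iff, Prod.norm_def]
      exact max_le_max le_rfl (by simp))
    rw [Real.dist_eq, Prod.dist_eq, dist_self, Real.dist_eq, add_sub_cancel_left,
      abs_of_pos (hl0 n), max_eq_right (hl0 n).le, H.flow_label] at h1
    have h2 := (le_abs_self _).trans h1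
    rw [shift]
    nlinarith [hl0 n]
  refine lt_of_lt_of_le (by positivity : 0 < 1 / ((K : ℝ) + 1))
    (ge_of_tendsto' (H.tendsto_charQuot hl hl0 hd) hb)

end IsCharFlow

theorem fderiv_mul_apply {u v : ℝ × ℝ → ℝ} {p : ℝ × ℝ} (hu : DifferentiableAt ℝ u p)
    (hv : DifferentiableAt ℝ v p) (w : ℝ × ℝ) :
    fderiv ℝ (fun q => u q * v q) p w = u p * fderiv ℝ v p w + fderiv ℝ u p w * v p := by
  have h : HasFDerivAt (fun q => u q * v q) _ p := hu.hasFDerivAt.mul hv.hasFDerivAt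
  rw [h.fderiv]
  simp [mul_comm]

theorem integral_linDeriv_eq_zero {f φ : ℝ × ℝ → ℝ} (hf : LocallyLipschitz f)
    (hφ : LocallyLipschitz φ) (hc : HasCompactSupport φ) : ∫ p, linDeriv f φ p = 0 := by
  have h1 := integral_fderiv_apply_eq_zero hφ hc (1, 0)
  have h2 := integral_fderiv_apply_eq_zero (locLip_mul hf hφ) hc.mul_left (0, 1)
  have hint : ∀ {u : ℝ × ℝ → ℝ}, LocallyLipschitz u → HasCompactSupport u → ∀ w : ℝ × ℝ,
      Integrable fun p => fderiv ℝ u p w := fun {u} hu hc w => by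
    obtain ⟨R, hR⟩ := hc.isCompact.isBounded.subset_closedBall 0
    obtain ⟨C, hC0, hC⟩ := locLip_exists_norm_fderiv_le hu R
    refine integrable_of_bounded R (C * ‖w‖)
      (measurable_fderiv_apply_const ℝ u w).aestronglyMeasurable
      (Eventually.of_forall fun p hp => ?_) fun p hp => ?_
    · exact ((fderiv ℝ u p).le_opNorm w).trans (by gcongr; exact (hC p hp).2)
    · rw [(tsupport_fderiv_apply_eq_zero fun h => hp (hR h)).2]
      rfl
  have h3 := integral_add (hint hφ hc (1, 0)) (hint (locLip_mul hf hφ) hc.mul_left (0, 1))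
  rw [h1, h2, add_zero] at h3
  rw [← h3]
  refine integral_congr_ae ?_
  filter_upwards [locLip_ae_differentiableAt hf, locLip_ae_differentiableAt hφ] with p hfp hφp
  rw [linDeriv, intrinsicDeriv_eq, fderiv_mul_apply hfp hφp]
  ring

theorem intrinsicDeriv_mul {f u v : ℝ × ℝ → ℝ} {p : ℝ × ℝ} (hu : DifferentiableAt ℝ u p)
    (hv : DifferentiableAt ℝ v p) :
    intrinsicDeriv f (fun q => u q * v q) p =
      u p * intrinsicDeriv f v p + intrinsicDeriv f u p * v p :=
  fderiv_mul_apply hu hv _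

/-- If `G` is a weak solution of the transport equation `∂_y G + f ∂_t G = 0` in `U`, then it is
also a weak solution with respect to the measure `∂_t τ dy dt`, for which `∂_y + f ∂_t` has no
divergence. The test functions are `ξ / J_h`, where `J_h` is the difference quotient of the flow in
the label, and `h → 0`. -/
theorem IsCharFlow.integral_transport {f χ τ : ℝ × ℝ → ℝ} (H : IsCharFlow f χ τ)
    {G : ℝ × ℝ → ℝ} (hGm : Measurable G) {M : ℝ} (hGb : ∀ p, |G p| ≤ M) {U : Set (ℝ × ℝ)}
    (hG : ∀ φ : ℝ × ℝ → ℝ, LocallyLipschitz φ → HasCompactSupport φ → tsupport φ ⊆ U →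
      ∫ p, G p * linDeriv f φ p = 0)
    {ξ : ℝ × ℝ → ℝ} (hξ : LocallyLipschitz ξ) (hc : HasCompactSupport ξ) (hU : tsupport ξ ⊆ U) :
    ∫ p, G p * (intrinsicDeriv f ξ p * fderiv ℝ τ p (0, 1)) = 0 := by
  have hl := tendsto_one_div_add_atTop_nhds_zero_nat (𝕜 := ℝ)
  have hl0 : ∀ n : ℕ, (0 : ℝ) < 1 / ((n : ℝ) + 1) := fun n => Nat.one_div_pos_of_nat
  have hl1 : ∀ n : ℕ, 1 / ((n : ℝ) + 1) ≤ 1 := fun n => by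
    rw [div_le_one (by positivity)]
    linarith [n.cast_nonneg (α := ℝ)]
  set l : ℕ → ℝ := fun n => 1 / ((n : ℝ) + 1) with hldef
  have hf := H.locLip_field
  have hfm := hf.continuous.measurable
  obtain ⟨R, hR⟩ := hc.isCompact.isBounded.subset_closedBall 0
  obtain ⟨C₁, hC₁0, hC₁⟩ := locLip_exists_norm_fderiv_le hf R
  obtain ⟨C₂, hC₂0, hC₂⟩ := locLip_exists_norm_fderiv_le hξ R
  obtain ⟨C₃, hC₃0, hC₃⟩ := H.exists_charQuot_le H.locLip_label R
  obtain ⟨C₄, hC₄0, hC₄⟩ := H.exists_charQuot_le hf R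
  have hM0 : 0 ≤ M := (abs_nonneg _).trans (hGb 0)
  have hk : ∀ n, LocallyLipschitz (charQuot χ τ τ (l n)) := fun n =>
    H.locLip_charQuot H.locLip_label (hl0 n)
  have hkm : ∀ n, Measurable (charQuot χ τ τ (l n)) := fun n => (hk n).continuous.measurable
  have hqm : ∀ n, Measurable (charQuot χ τ f (l n)) := fun n =>
    (H.locLip_charQuot hf (hl0 n)).continuous.measurable
  have hξm := hξ.continuous.measurable
  have hdm := measurable_intrinsicDeriv hfm ξ
  have hftm := measurable_fderiv_apply_const ℝ f (0, 1)
  have h := tendsto_integral_of_bounded R (M * (C₃ * (C₂ + C₁ * C₂ + C₂ * (C₁ + C₄))))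
    (F := fun n p => G p * (charQuot χ τ τ (l n) p *
      (intrinsicDeriv f ξ p + ξ p * (fderiv ℝ f p (0, 1) - charQuot χ τ f (l n) p))))
    (F' := fun p => G p * (intrinsicDeriv f ξ p * fderiv ℝ τ p (0, 1)))
    (fun n => (hGm.mul ((hkm n).mul (hdm.add (hξm.mul (hftm.sub (hqm n)))))).aestronglyMeasurable)
    (fun n => Eventually.of_forall fun p hp => ?_) (fun n p hp => ?_) ?_
  · refine tendsto_nhds_unique h (tendsto_const_nhds.congr fun n => ?_)
    have := hG (fun p => ξ p * charQuot χ τ τ (l n) p) (locLip_mul hξ (hk n)) hc.mul_right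
      ((tsupport_mul_subset_left).trans hU)
    refine this.symm.trans (integral_congr_ae ?_)
    filter_upwards [locLip_ae_differentiableAt hξ, locLip_ae_differentiableAt (hk n)]
      with p hξp hkp
    rw [linDeriv, intrinsicDeriv_mul hξp hkp, H.intrinsicDeriv_label_charQuot (h := l n) (hl0 n) hkp]
    ring
  · have e1 := hC₃ (l n) ⟨hl0 n, hl1 n⟩ p hp
    have e2 := hC₄ (l n) ⟨hl0 n, hl1 n⟩ p hp
    have e3 := abs_intrinsicDeriv_le (hC₁ p hp).1 (hC₂ p hp).2
    have e4 := (abs_fderiv_apply_le f p (hC₁ p hp).2).2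
    have e5 := (hC₂ p hp).1
    have e6 : |fderiv ℝ f p (0, 1) - charQuot χ τ f (l n) p| ≤ C₁ + C₄ :=
      (abs_sub _ _).trans (add_le_add e4 e2)
    rw [abs_mul, abs_mul]
    refine mul_le_mul (hGb p) (mul_le_mul e1 ((abs_add_le _ _).trans (add_le_add e3 ?_))
      (abs_nonneg _) hC₃0) (by positivity) hM0
    rw [abs_mul]
    exact mul_le_mul e5 e6 (abs_nonneg _) hC₂0
  · have := tsupport_fderiv_apply_eq_zero (fun h => hp (hR h) : p ∉ tsupport ξ)
    simp [intrinsicDeriv, this.1, this.2]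
  · filter_upwards [locLip_ae_differentiableAt hf, locLip_ae_differentiableAt H.locLip_label]
      with p hfp hτp
    have e1 := H.tendsto_charQuot hl hl0 hτp
    have e2 := H.tendsto_charQuot hl hl0 hfp
    have := (e1.mul ((((tendsto_const_nhds (x := fderiv ℝ f p (0, 1))).sub e2).const_mul
      (ξ p)).const_add (intrinsicDeriv f ξ p))).const_mul (G p)
    rw [sub_self, mul_zero, add_zero, mul_comm (fderiv ℝ τ p (0, 1))] at this
    exact this

theorem IsCharFlow.integral_intrinsicDeriv_eq_zero {f χ τ : ℝ × ℝ → ℝ} (H : IsCharFlow f χ τ)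
    {ξ : ℝ × ℝ → ℝ} (hξ : LocallyLipschitz ξ) (hc : HasCompactSupport ξ) :
    ∫ p, intrinsicDeriv f ξ p * fderiv ℝ τ p (0, 1) = 0 := by
  have := H.integral_transport (G := fun _ => 1) measurable_const (M := 1) (by simp) (U := univ)
    (fun φ hφ hc _ => by simpa using integral_linDeriv_eq_zero H.locLip_field hφ hc) hξ hc
    (subset_univ _)
  simpa using this

/-! ### Characteristics of a Lipschitz field -/

/-- Uniqueness of characteristics on an interval. -/
theorem eqOn_characteristic {f : ℝ × ℝ → ℝ} (hf : LocallyLipschitz f) {γ₁ γ₂ : ℝ → ℝ} {a b c : ℝ}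
    (hc : c ∈ Ioo a b) (h₁ : ∀ s ∈ Icc a b, HasDerivAt γ₁ (f (s, γ₁ s)) s)
    (h₂ : ∀ s ∈ Icc a b, HasDerivAt γ₂ (f (s, γ₂ s)) s) (heq : γ₁ c = γ₂ c) :
    EqOn γ₁ γ₂ (Icc a b) := by
  have c₁ : ContinuousOn γ₁ (Icc a b) := fun s hs => (h₁ s hs).continuousAt.continuousWithinAt
  have c₂ : ContinuousOn γ₂ (Icc a b) := fun s hs => (h₂ s hs).continuousAt.continuousWithinAt
  obtain ⟨R₁, hR₁⟩ := isCompact_Icc.exists_bound_of_continuousOn c₁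
  obtain ⟨R₂, hR₂⟩ := isCompact_Icc.exists_bound_of_continuousOn c₂
  set R := max (max |a| |b|) (max R₁ R₂) with hR
  obtain ⟨K, hK⟩ := locLip_exists_lipschitzOnWith hf R
  have hlip : ∀ s ∈ Ioo a b, LipschitzOnWith K (fun t => f (s, t)) (closedBall 0 R) := by
    intro s hs
    have hsR : |s| ≤ R := (abs_le_max_abs_abs hs.1.le hs.2.le).trans (le_max_left _ _)
    have hmem : ∀ t ∈ closedBall (0 : ℝ) R, (s, t) ∈ closedBall (0 : ℝ × ℝ) R := fun t ht => by
      rw [mem_closedBall_zero_iff] at ht ⊢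
      rw [Prod.norm_def]
      exact max_le hsR ht
    refine LipschitzOnWith.of_dist_le_mul fun t ht r hr => ?_
    have := hK.dist_le_mul _ (hmem t ht) _ (hmem r hr)
    rwa [Prod.dist_eq, dist_self, max_eq_right dist_nonneg] at this
  refine ODE_solution_unique_of_mem_Icc (v := fun s t => f (s, t)) (s := fun _ => closedBall 0 R)
    hlip hc c₁ (fun s hs => h₁ s (Ioo_subset_Icc_self hs)) (fun s hs => ?_) c₂
    (fun s hs => h₂ s (Ioo_subset_Icc_self hs)) (fun s hs => ?_) heq
  · rw [mem_closedBall_zero_iff]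
    exact (hR₁ s (Ioo_subset_Icc_self hs)).trans ((le_max_left _ _).trans (le_max_right _ _))
  · rw [mem_closedBall_zero_iff]
    exact (hR₂ s (Ioo_subset_Icc_self hs)).trans ((le_max_right _ _).trans (le_max_right _ _))

/-- Uniqueness of global characteristics. -/
theorem eq_of_characteristic {f : ℝ × ℝ → ℝ} (hf : LocallyLipschitz f) {γ₁ γ₂ : ℝ → ℝ} {c : ℝ}
    (h₁ : ∀ s, HasDerivAt γ₁ (f (s, γ₁ s)) s) (h₂ : ∀ s, HasDerivAt γ₂ (f (s, γ₂ s)) s)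
    (heq : γ₁ c = γ₂ c) (s : ℝ) : γ₁ s = γ₂ s := by
  refine eqOn_characteristic hf (a := min c s - 1) (b := max c s + 1) (c := c) ?_
    (fun r _ => h₁ r) (fun r _ => h₂ r) heq ?_
  · exact ⟨by linarith [min_le_left c s], by linarith [le_max_left c s]⟩
  · exact ⟨by linarith [min_le_right c s], by linarith [le_max_right c s]⟩

theorem abs_sub_le_of_abs_deriv_le {γ γ' : ℝ → ℝ} {M : ℝ} (h : ∀ s, HasDerivAt γ (γ' s) s)
    (hM : ∀ s, |γ' s| ≤ M) (r s : ℝ) : |γ s - γ r| ≤ M * |s - r| :=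
  convex_univ.norm_image_sub_le_of_norm_hasDerivWithin_le (fun x _ => (h x).hasDerivWithinAt)
    (fun x _ => hM x) (mem_univ r) (mem_univ s)

/-- Grönwall's inequality for characteristics, forward and backward in time. -/
theorem abs_sub_le_exp {f : ℝ × ℝ → ℝ} {K : ℝ≥0} (hf : LipschitzWith K f) {γ₁ γ₂ : ℝ → ℝ}
    (h₁ : ∀ s, HasDerivAt γ₁ (f (s, γ₁ s)) s) (h₂ : ∀ s, HasDerivAt γ₂ (f (s, γ₂ s)) s) (r s : ℝ) :
    |γ₁ s - γ₂ s| ≤ |γ₁ r - γ₂ r| * Real.exp (K * |s - r|) := by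
  have hl : ∀ s, LipschitzWith K fun t => f (s, t) := fun s => by
    refine LipschitzWith.of_dist_le_mul fun t t' => ?_
    have := hf.dist_le_mul (s, t) (s, t')
    rwa [Prod.dist_eq, dist_self, max_eq_right dist_nonneg] at this
  rcases le_total r s with h | h
  · have := dist_le_of_trajectories_ODE (v := fun s t => f (s, t)) hl
      (HasDerivAt.continuousOn fun x _ => h₁ x) (fun x _ => (h₁ x).hasDerivWithinAt)
      (HasDerivAt.continuousOn fun x _ => h₂ x) (fun x _ => (h₂ x).hasDerivWithinAt)
      (le_refl (dist (γ₁ r) (γ₂ r))) s ⟨h, le_rfl⟩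
    rwa [← abs_of_nonneg (sub_nonneg.2 h), Real.dist_eq, Real.dist_eq] at this
  · have hn : ∀ {γ : ℝ → ℝ}, (∀ s, HasDerivAt γ (f (s, γ s)) s) →
        ∀ x, HasDerivAt (fun x => γ (-x)) (-f (-x, γ (-x))) x := fun {γ} h x => by
      have h' : HasDerivAt (fun x => γ (-x)) _ x := (h (-x)).scomp x (hasDerivAt_neg x)
      simpa using h'
    have := dist_le_of_trajectories_ODE (v := fun s t => -f (-s, t)) (K := K)
      (fun s => (hl (-s)).neg)
      (HasDerivAt.continuousOn fun x _ => hn h₁ x) (fun x _ => (hn h₁ x).hasDerivWithinAt)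
      (HasDerivAt.continuousOn fun x _ => hn h₂ x) (fun x _ => (hn h₂ x).hasDerivWithinAt)
      (le_refl (dist (γ₁ (- -r)) (γ₂ (- -r)))) (-s) ⟨neg_le_neg h, le_rfl⟩
    rw [neg_neg, neg_neg, Real.dist_eq, Real.dist_eq,
      show -s - -r = -(s - r) by ring, ← abs_of_nonpos (sub_nonpos.2 h)] at this
    exact this

/-- Global characteristics of a bounded Lipschitz field, glued from Picard-Lindelöf solutions on the
intervals of radius `n`. -/
theorem exists_characteristic {f : ℝ × ℝ → ℝ} {K : ℝ≥0} (hf : LipschitzWith K f) {M : ℝ}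
    (hM : ∀ p, |f p| ≤ M) (p : ℝ × ℝ) :
    ∃ γ : ℝ → ℝ, γ p.1 = p.2 ∧ ∀ s, HasDerivAt γ (f (s, γ s)) s := by
  have hM0 : 0 ≤ M := (abs_nonneg _).trans (hM 0)
  have hex : ∀ n : ℕ, ∃ α : ℝ → ℝ, α p.1 = p.2 ∧
      ∀ s ∈ Ioo (p.1 - n) (p.1 + n), HasDerivAt α (f (s, α s)) s := fun n => by
    have hP : IsPicardLindelof (fun s t => f (s, t)) (tmin := p.1 - n) (tmax := p.1 + n)
        ⟨p.1, by simp, by simp⟩ p.2 (M.toNNReal * n) 0 M.toNNReal K :=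
      { lipschitzOnWith := fun s _ => LipschitzWith.lipschitzOnWith (by
          refine LipschitzWith.of_dist_le_mul fun t t' => ?_
          have := hf.dist_le_mul (s, t) (s, t')
          rwa [Prod.dist_eq, dist_self, max_eq_right dist_nonneg] at this)
        continuousOn := fun t _ => by
          have := hf.continuous
          fun_prop
        norm_le := fun s _ t _ => by
          rw [Real.coe_toNNReal M hM0]
          exact hM _
        mul_max_le := by simp }
    obtain ⟨α, hα, hα'⟩ := hP.exists_eq_forall_mem_Icc_hasDerivWithinAt₀
    exact ⟨α, hα, fun s hs => (hα' s (Ioo_subset_Icc_self hs)).hasDerivAt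
      (Icc_mem_nhds hs.1 hs.2)⟩
  choose α hα hα' using hex
  have hagree : ∀ m n : ℕ, ∀ s : ℝ, |s - p.1| < m → |s - p.1| < n → α m s = α n s := by
    intro m n s hm hn
    have hmin : |s - p.1| < (min m n : ℕ) := by
      rcases min_choice m n with h | h <;> rw [h] <;> assumption
    have hpos : (0 : ℝ) < (min m n : ℕ) := (abs_nonneg _).trans_lt hmin
    have hsub : ∀ k : ℕ, min m n ≤ k → ∀ x ∈ Ioo (p.1 - (min m n : ℕ)) (p.1 + (min m n : ℕ)),
        x ∈ Ioo (p.1 - k) (p.1 + k) := fun k hk x hx => by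
      have : ((min m n : ℕ) : ℝ) ≤ k := by exact_mod_cast hk
      exact ⟨by linarith [hx.1], by linarith [hx.2]⟩
    refine ODE_solution_unique_of_mem_Ioo (v := fun s t => f (s, t)) (s := fun _ => univ) (K := K)
      (t₀ := p.1) (a := p.1 - (min m n : ℕ)) (b := p.1 + (min m n : ℕ)) (fun s _ => ?_)
      ⟨by linarith, by linarith⟩
      (fun x hx => ⟨hα' m x (hsub m (min_le_left _ _) x hx), mem_univ _⟩)
      (fun x hx => ⟨hα' n x (hsub n (min_le_right _ _) x hx), mem_univ _⟩)
      ((hα m).trans (hα n).symm) ?_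
    · refine (LipschitzWith.of_dist_le_mul fun t t' => ?_).lipschitzOnWith
      have := hf.dist_le_mul (s, t) (s, t')
      rwa [Prod.dist_eq, dist_self, max_eq_right dist_nonneg] at this
    · rw [abs_lt] at hmin
      exact ⟨by linarith [hmin.1], by linarith [hmin.2]⟩
  have hlt : ∀ s : ℝ, |s - p.1| < (⌈|s - p.1|⌉₊ + 1 : ℕ) := fun s => by
    push_cast
    linarith [Nat.le_ceil |s - p.1|]
  refine ⟨fun s => α (⌈|s - p.1|⌉₊ + 1) s, hα _, fun s => ?_⟩
  have hs := hlt s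
  set N := ⌈|s - p.1|⌉₊ + 1
  have hsN : s ∈ Ioo (p.1 - N) (p.1 + N) := by
    rw [abs_lt] at hs
    exact ⟨by linarith [hs.1], by linarith [hs.2]⟩
  refine (hα' N s hsN).congr_of_eventuallyEq ?_
  filter_upwards [isOpen_Ioo.mem_nhds hsN] with r hr
  exact hagree _ _ r (hlt r) (abs_lt.2 ⟨by linarith [hr.1], by linarith [hr.2]⟩)

/-- A bounded Lipschitz field has a global flow `X`, where `X s p` is the position at time `s` of
the characteristic through `p`. -/
theorem exists_flow {f : ℝ × ℝ → ℝ} {K : ℝ≥0} (hf : LipschitzWith K f) {M : ℝ}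
    (hM : ∀ p, |f p| ≤ M) :
    ∃ X : ℝ → ℝ × ℝ → ℝ, (∀ p, X p.1 p = p.2) ∧
      (∀ p s, HasDerivAt (fun r => X r p) (f (s, X s p)) s) ∧
      LocallyLipschitz (fun q : ℝ × (ℝ × ℝ) => X q.1 q.2) := by
  choose γ h0 h using exists_characteristic hf hM
  have hM0 : 0 ≤ M := (abs_nonneg _).trans (hM 0)
  refine ⟨fun s p => γ p s, h0, h, ?_⟩
  rintro ⟨s₀, y₀, t₀⟩
  set D := |s₀ - y₀| + 2
  set E := Real.exp (K * D)
  refine ⟨(M + E * (1 + M)).toNNReal, ball (s₀, y₀, t₀) 1, ball_mem_nhds _ one_pos,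
    LipschitzOnWith.of_dist_le_mul ?_⟩
  rintro ⟨s, y, t⟩ hq ⟨s', y', t'⟩ -
  have hE : 0 ≤ E := (Real.exp_pos _).le
  rw [Real.coe_toNNReal _ (by positivity)]
  simp only [mem_ball, Prod.dist_eq, max_lt_iff, Real.dist_eq] at hq
  set d := dist (s, y, t) (s', y', t')
  have hd : |s - s'| ≤ d ∧ |y - y'| ≤ d ∧ |t - t'| ≤ d := by
    have : d = max |s - s'| (max |y - y'| |t - t'|) := by
      simp only [d, Prod.dist_eq, Real.dist_eq]
    rw [this]
    exact ⟨le_max_left _ _, (le_max_left _ _).trans (le_max_right _ _),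
      (le_max_right _ _).trans (le_max_right _ _)⟩
  have hD : |s - y| ≤ D := by
    have e : s - y = (s - s₀) + (s₀ - y₀) + -(y - y₀) := by ring
    rw [e]
    refine (abs_add_three _ _ _).trans ?_
    rw [abs_neg]
    linarith [hq.1, hq.2.1]
  have e1 := abs_sub_le_exp hf (h (y, t)) (h (y', t')) y s
  have e2 := abs_sub_le_of_abs_deriv_le (h (y', t')) (fun r => hM _) s' s
  have e3 := abs_sub_le_of_abs_deriv_le (h (y', t')) (fun r => hM _) y' y
  rw [h0 (y, t)] at e1
  rw [h0 (y', t')] at e3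
  simp only at e1 e2 e3
  rw [Real.dist_eq]
  have e4 : |t - γ (y', t') y| ≤ (1 + M) * d := by
    have : t - γ (y', t') y = (t - t') + -(γ (y', t') y - t') := by ring
    rw [this]
    refine (abs_add_le _ _).trans ?_
    rw [abs_neg]
    nlinarith [hd.2.1, hd.2.2]
  have e5 : Real.exp (K * |s - y|) ≤ E := Real.exp_le_exp.2 (by gcongr)
  have e6 : |γ (y, t) s - γ (y', t') s| ≤ (1 + M) * d * E :=
    e1.trans (mul_le_mul e4 e5 (Real.exp_pos _).le (by positivity))
  have e7 : γ (y, t) s - γ (y', t') s' =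
    (γ (y, t) s - γ (y', t') s) + (γ (y', t') s - γ (y', t') s') := by ring
  rw [e7]
  refine (abs_add_le _ _).trans ?_
  nlinarith [hd.1]

/-- A global flow of a locally Lipschitz field, labelled by the position at time `s₀`. -/
theorem isCharFlow_of_flow {f : ℝ × ℝ → ℝ} (hf : LocallyLipschitz f) {X : ℝ → ℝ × ℝ → ℝ}
    (h0 : ∀ p, X p.1 p = p.2) (h : ∀ p s, HasDerivAt (fun r => X r p) (f (s, X s p)) s)
    (hX : LocallyLipschitz (fun q : ℝ × (ℝ × ℝ) => X q.1 q.2)) (s₀ : ℝ) :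
    IsCharFlow f (fun p => X p.1 (s₀, p.2)) (fun p => X s₀ p) where
  locLip_field := hf
  locLip_flow := hX.comp (locLip_fst.prodMk ((LocallyLipschitz.const s₀).prodMk locLip_snd))
  locLip_label := hX.comp ((LocallyLipschitz.const s₀).prodMk LocallyLipschitz.id)
  flow_label p := by
    refine (eq_of_characteristic hf (c := s₀) (h _) (h p) ?_ p.1).trans (h0 p)
    exact h0 (s₀, X s₀ p)
  label_flow s u := by
    refine (eq_of_characteristic hf (c := s) (h _) (h (s₀, u)) ?_ s₀).trans (h0 (s₀, u))
    exact h0 (s, X s (s₀, u))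
  hasDerivAt u s := h (s₀, u) s
  exists_base := ⟨s₀, fun u => h0 (s₀, u)⟩

theorem exists_cutoff {f : ℝ × ℝ → ℝ} (hf : LocallyLipschitz f) {R : ℝ} (hR : 0 < R) :
    ∃ g : ℝ × ℝ → ℝ, LocallyLipschitz g ∧ HasCompactSupport g ∧ EqOn g f (closedBall 0 R) := by
  let b : ContDiffBump (0 : ℝ × ℝ) := ⟨R, R + 1, hR, lt_add_one R⟩
  refine ⟨fun p => b p * f p, locLip_mul ?_ hf, b.hasCompactSupport.mul_right, fun p hp => ?_⟩
  · exact ContDiff.locallyLipschitz (𝕂 := ℝ) b.contDiff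
  · simp only [b.one_of_mem_closedBall hp, one_mul]

theorem exists_flow_of_hasCompactSupport {g : ℝ × ℝ → ℝ} (hg : LocallyLipschitz g)
    (hc : HasCompactSupport g) :
    ∃ X : ℝ → ℝ × ℝ → ℝ, (∀ p, X p.1 p = p.2) ∧
      (∀ p s, HasDerivAt (fun r => X r p) (g (s, X s p)) s) ∧
      LocallyLipschitz (fun q : ℝ × (ℝ × ℝ) => X q.1 q.2) := by
  obtain ⟨K, hK⟩ := locLip_lipschitzWith hg hc
  obtain ⟨M, hM⟩ := hc.exists_bound_of_continuous hg.continuous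
  exact exists_flow hK hM

/-! ### Characteristics of a stationary function are parabolas -/

theorem ae_fst_ne (c : ℝ) : ∀ᵐ p : ℝ × ℝ, p.1 ≠ c :=
  (Measure.quasiMeasurePreserving_fst (μ := (volume : Measure ℝ)) (ν := (volume : Measure ℝ))).ae
    (Measure.ae_ne volume c)

theorem IsCharFlow.intrinsicDeriv_comp_label {f χ τ : ℝ × ℝ → ℝ} (H : IsCharFlow f χ τ) {m : ℝ → ℝ}
    {p : ℝ × ℝ} (hd : DifferentiableAt ℝ (fun q => m (τ q)) p) :
    intrinsicDeriv f (fun q => m (τ q)) p = 0 := by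
  refine H.intrinsicDeriv_eq_of_hasDerivAt hd ?_
  simp only [H.label_flow]
  exact hasDerivAt_const _ _

theorem IsCharFlow.integrable_transport {f χ τ : ℝ × ℝ → ℝ} (H : IsCharFlow f χ τ)
    {W : ℝ × ℝ → ℝ} (hW : Measurable W) {M : ℝ} (hM : ∀ p, |W p| ≤ M) {ξ : ℝ × ℝ → ℝ}
    (hξ : LocallyLipschitz ξ) (hc : HasCompactSupport ξ) :
    Integrable fun p => W p * (intrinsicDeriv f ξ p * fderiv ℝ τ p (0, 1)) := by
  have hM0 : 0 ≤ M := (abs_nonneg _).trans (hM 0)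
  obtain ⟨R, hR⟩ := hc.isCompact.isBounded.subset_closedBall 0
  obtain ⟨C₁, hC₁0, hC₁⟩ := locLip_exists_norm_fderiv_le H.locLip_field R
  obtain ⟨C₂, hC₂0, hC₂⟩ := locLip_exists_norm_fderiv_le hξ R
  obtain ⟨C₃, hC₃0, hC₃⟩ := locLip_exists_norm_fderiv_le H.locLip_label R
  refine integrable_of_bounded R (M * ((C₂ + C₁ * C₂) * C₃))
    (hW.mul ((measurable_intrinsicDeriv H.locLip_field.continuous.measurable ξ).mul
      (measurable_fderiv_apply_const ℝ τ (0, 1)))).aestronglyMeasurable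
    (Eventually.of_forall fun p hp => ?_) fun p hp => ?_
  · rw [abs_mul, abs_mul]
    exact mul_le_mul (hM p) (mul_le_mul (abs_intrinsicDeriv_le (hC₁ p hp).1 (hC₂ p hp).2)
      (abs_fderiv_apply_le τ p (hC₃ p hp).2).2 (abs_nonneg _) (by positivity)) (by positivity) hM0
  · simp [intrinsicDeriv, (tsupport_fderiv_apply_eq_zero fun h => hp (hR h)).2]

/-- A compactly supported function `ξ` that is constant along characteristics vanishes, because
`∇^f (y ξ²) = ξ²` has integral zero with respect to `∂_t τ dy dt`. -/
theorem IsCharFlow.eq_zero_of_intrinsicDeriv_eq_zero {f χ τ : ℝ × ℝ → ℝ} (H : IsCharFlow f χ τ)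
    {ξ : ℝ × ℝ → ℝ} (hξ : LocallyLipschitz ξ) (hc : HasCompactSupport ξ)
    (h : ∀ᵐ p, intrinsicDeriv f ξ p = 0) : ξ = 0 := by
  have h2 := H.integral_intrinsicDeriv_eq_zero (ξ := fun p => p.1 * (ξ p * ξ p))
    (locLip_mul locLip_fst (locLip_mul hξ hξ)) (hc.mul_left.mul_left)
  have hae : ∀ᵐ p, intrinsicDeriv f (fun p => p.1 * (ξ p * ξ p)) p * fderiv ℝ τ p (0, 1) =
      ξ p * ξ p * fderiv ℝ τ p (0, 1) := by
    filter_upwards [h, locLip_ae_differentiableAt hξ] with p hp hd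
    have hd2 : DifferentiableAt ℝ (fun q => ξ q * ξ q) p := hd.mul hd
    rw [intrinsicDeriv_mul differentiableAt_fst hd2, intrinsicDeriv_mul hd hd, hp]
    have : intrinsicDeriv f Prod.fst p = 1 := by
      rw [intrinsicDeriv, fderiv_fst]
      simp
    rw [this]
    ring
  rw [integral_congr_ae hae] at h2
  have hτ : ∀ᵐ p, 0 < fderiv ℝ τ p (0, 1) := by
    filter_upwards [locLip_ae_differentiableAt H.locLip_label] with p hp using H.fderiv_label_pos hp
  have hint : Integrable fun p => ξ p * ξ p * fderiv ℝ τ p (0, 1) := by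
    have := H.integrable_transport (W := fun _ => 1) measurable_const (M := 1) (by simp)
      (ξ := fun p => p.1 * (ξ p * ξ p))
      (locLip_mul locLip_fst (locLip_mul hξ hξ)) (hc.mul_left.mul_left)
    simp only [one_mul] at this
    exact this.congr hae
  rw [integral_eq_zero_iff_of_nonneg_ae
    (by filter_upwards [hτ] with p hp using mul_nonneg (mul_self_nonneg _) hp.le) hint] at h2
  refine (hξ.continuous.ae_eq_iff_eq volume continuous_const).1 ?_
  filter_upwards [h2, hτ] with p hp hpos
  have : ξ p * ξ p = 0 := (mul_eq_zero.1 hp).resolve_right hpos.ne'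
  exact mul_self_eq_zero.1 this

/-- Along a characteristic of a stationary `f`, the function `f` is affine. The test function is the
difference between `f` and its affine interpolation along characteristics, cut off in the label;
the monotonicity of `A ↦ A / √(1 + A²)` forces `∇^f f` to be equal to its mean along
characteristics. -/
theorem affine_along_characteristic {f : ℝ × ℝ → ℝ} (hf : LocallyLipschitz f)
    (hst : ∀ φ : ℝ × ℝ → ℝ, LocallyLipschitz φ → HasCompactSupport φ →
      ∫ p, areaSlope (intrinsicDeriv f f p) * linDeriv f φ p = 0)
    {γ : ℝ → ℝ} {a b : ℝ} (hab : a < b)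
    (hγ : ∀ s ∈ Icc a b, HasDerivAt γ (f (s, γ s)) s) :
    ∀ s ∈ Icc a b, f (s, γ s) = f (a, γ a) + (s - a) * ((f (b, γ b) - f (a, γ a)) / (b - a)) := by
  have hγc : ContinuousOn (fun s => (s, γ s)) (Icc a b) :=
    continuousOn_id.prodMk fun s hs => (hγ s hs).continuousAt.continuousWithinAt
  obtain ⟨R₀, hR₀⟩ := isCompact_Icc.exists_bound_of_continuousOn hγc
  have hamem : a ∈ Icc a b := left_mem_Icc.2 hab.le
  have hbmem : b ∈ Icc a b := right_mem_Icc.2 hab.le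
  have hR₀0 : 0 ≤ R₀ := (norm_nonneg _).trans (hR₀ a hamem)
  set R := R₀ + 1 with hR
  have hR0 : 0 < R := by linarith
  have hγU : ∀ s ∈ Icc a b, (s, γ s) ∈ ball (0 : ℝ × ℝ) R := fun s hs => by
    rw [mem_ball_zero_iff]
    linarith [hR₀ s hs]
  obtain ⟨g, hg, hgc, hgf⟩ := exists_cutoff hf hR0
  have hgf' : ∀ p ∈ ball (0 : ℝ × ℝ) R, g p = f p ∧ fderiv ℝ g p = fderiv ℝ f p := fun p hp =>
    ⟨hgf (ball_subset_closedBall hp), Filter.EventuallyEq.fderiv_eq (by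
      filter_upwards [isOpen_ball.mem_nhds hp] with q hq using hgf (ball_subset_closedBall hq))⟩
  obtain ⟨X, hX0, hX, hXl⟩ := exists_flow_of_hasCompactSupport hg hgc
  have H := isCharFlow_of_flow hg hX0 hX hXl a
  set χ : ℝ × ℝ → ℝ := fun p => X p.1 (a, p.2) with hχ
  set τ : ℝ × ℝ → ℝ := fun p => X a p with hτ
  have hχa : ∀ u, χ (a, u) = u := fun u => hX0 (a, u)
  have hτa : ∀ t, τ (a, t) = t := fun t => hX0 (a, t)
  -- on `[a, b]` the given curve is the characteristic of `g` with label `γ a`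
  have hγχ : ∀ s ∈ Icc a b, χ (s, γ a) = γ s := by
    have hl : ∃ K : ℝ≥0, ∀ s, LipschitzWith K fun t => g (s, t) := by
      obtain ⟨K, hK⟩ := locLip_lipschitzWith hg hgc
      refine ⟨K, fun s => LipschitzWith.of_dist_le_mul fun t t' => ?_⟩
      have := hK.dist_le_mul (s, t) (s, t')
      rwa [Prod.dist_eq, dist_self, max_eq_right dist_nonneg] at this
    obtain ⟨K, hK⟩ := hl
    refine ODE_solution_unique (v := fun s t => g (s, t)) hK
      (HasDerivAt.continuousOn fun s _ => H.hasDerivAt (γ a) s)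
      (fun s _ => (H.hasDerivAt (γ a) s).hasDerivWithinAt)
      (HasDerivAt.continuousOn fun s hs => hγ s hs) (fun s hs => ?_) (hχa _)
    have hs' := Ico_subset_Icc_self hs
    rw [(hgf' _ (hγU s hs')).1]
    exact (hγ s hs').hasDerivWithinAt
  -- the characteristics with labels near `γ a` stay where `g = f` for times in `[a, b]`
  obtain ⟨ε, hε, hεU⟩ : ∃ ε > 0, ∀ s ∈ Icc a b, ∀ u ∈ closedBall (γ a) ε,
      (s, χ (s, u)) ∈ ball (0 : ℝ × ℝ) R := by
    have hcont : Continuous fun q : ℝ × ℝ => (q.1, χ q) :=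
      continuous_fst.prodMk H.locLip_flow.continuous
    obtain ⟨u, v, -, hv, hsu, hsv, huv⟩ := generalized_tube_lemma (isCompact_Icc (a := a) (b := b))
      (isCompact_singleton (x := γ a)) (isOpen_ball.preimage hcont) (by
        rintro ⟨s, t⟩ ⟨hs, ht⟩
        rw [mem_singleton_iff] at ht
        subst ht
        simp only [mem_preimage, hγχ s hs]
        exact hγU s hs)
    obtain ⟨ε, hε, hεv⟩ := Metric.nhds_basis_closedBall.mem_iff.1
      (hv.mem_nhds (hsv (mem_singleton _)))
    exact ⟨ε, hε, fun s hs t ht => huv (show (s, t) ∈ u ×ˢ v from ⟨hsu hs, hεv ht⟩)⟩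
  let α : ContDiffBump (γ a) := ⟨ε / 2, ε, by linarith, by linarith⟩
  have hα : LocallyLipschitz α := ContDiff.locallyLipschitz (𝕂 := ℝ) α.contDiff
  set m : ℝ → ℝ := fun u => (g (b, χ (b, u)) - g (a, u)) / (b - a) with hm
  have hml : LocallyLipschitz m := by
    have := locLip_mul (locLip_sub
      (hg.comp ((LocallyLipschitz.const b).prodMk
        (H.locLip_flow.comp ((LocallyLipschitz.const b).prodMk LocallyLipschitz.id))))
      (hg.comp ((LocallyLipschitz.const a).prodMk LocallyLipschitz.id)))
      (LocallyLipschitz.const (α := ℝ) (b - a)⁻¹)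
    simpa only [hm, div_eq_mul_inv] using! this
  set E : ℝ × ℝ → ℝ := fun q => g (q.1, χ q) - g (a, q.2) - (q.1 - a) * m q.2 with hE
  have hEl : LocallyLipschitz E :=
    locLip_sub (locLip_sub (hg.comp (locLip_fst.prodMk H.locLip_flow))
      (hg.comp ((LocallyLipschitz.const a).prodMk locLip_snd)))
      (locLip_mul (locLip_sub locLip_fst (LocallyLipschitz.const a)) (hml.comp locLip_snd))
  have hba : b - a ≠ 0 := by linarith
  have hEa : ∀ u, E (a, u) = 0 := fun u => by simp [hE, hχa]
  have hEb : ∀ u, E (b, u) = 0 := fun u => by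
    simp only [hE, hm]
    field_simp
    ring
  set cl : ℝ → ℝ := fun s => max a (min b s) with hcl
  have hcll : LocallyLipschitz cl :=
    (LocallyLipschitz.const a).max ((LocallyLipschitz.const b).min LocallyLipschitz.id)
  have hcl_of_le : ∀ s, s ≤ a → cl s = a := fun s hs => by
    simp only [hcl, min_eq_right (hs.trans hab.le), max_eq_left hs]
  have hcl_of_ge : ∀ s, b ≤ s → cl s = b := fun s hs => by
    simp only [hcl, min_eq_left hs, max_eq_right hab.le]
  have hcl_of_mem : ∀ s ∈ Icc a b, cl s = s := fun s hs => by
    simp only [hcl, min_eq_right hs.2, max_eq_right hs.1]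
  set ξ : ℝ × ℝ → ℝ := fun p => α (τ p) * E (cl p.1, τ p) with hξ
  have hξl : LocallyLipschitz ξ := locLip_mul (hα.comp H.locLip_label)
    (hEl.comp ((hcll.comp locLip_fst).prodMk H.locLip_label))
  have hξts : tsupport ξ ⊆ {p | p.1 ∈ Icc a b ∧ τ p ∈ closedBall (γ a) ε} := by
    refine closure_minimal (fun p hp => ?_) ((isClosed_Icc.preimage continuous_fst).inter
      (isClosed_closedBall.preimage H.locLip_label.continuous))
    rw [Function.mem_support] at hp
    refine ⟨?_, ?_⟩
    · by_contra hcon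
      rw [mem_Icc, not_and_or, not_le, not_le] at hcon
      rcases hcon with h | h
      · exact hp (by simp only [hξ, hcl_of_le _ h.le, hEa, mul_zero])
      · exact hp (by simp only [hξ, hcl_of_ge _ h.le, hEb, mul_zero])
    · by_contra hcon
      have : α (τ p) = 0 := α.zero_of_le_dist (by
        rw [mem_closedBall, not_le] at hcon
        exact hcon.le)
      exact hp (by simp only [hξ, this, zero_mul])
  have hξU : tsupport ξ ⊆ ball 0 R := fun p hp => by
    have := hεU p.1 (hξts hp).1 (τ p) (hξts hp).2
    rwa [H.flow_label] at this
  have hξc : HasCompactSupport ξ :=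
    (isCompact_closedBall (0 : ℝ × ℝ) R).of_isClosed_subset (isClosed_tsupport _)
      (hξU.trans ball_subset_closedBall)
  have hgm := hg.continuous.measurable
  -- the derivative of the test function along characteristics
  have hξd : ∀ᵐ p, (intrinsicDeriv g ξ p = α (τ p) * (intrinsicDeriv g g p - m (τ p)) ∨
      intrinsicDeriv g ξ p = 0) := by
    filter_upwards [locLip_ae_differentiableAt hξl, locLip_ae_differentiableAt hg,
      ae_fst_ne a, ae_fst_ne b] with p hξp hgp hpa hpb
    rcases lt_or_gt_of_ne hpa with h | h
    · right
      refine H.intrinsicDeriv_eq_of_hasDerivAt hξp ((hasDerivAt_const _ 0).congr_of_eventuallyEq ?_)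
      filter_upwards [isOpen_Iio.mem_nhds h] with s hs
      simp only [hξ, hcl_of_le s (le_of_lt hs), hEa, mul_zero]
    · rcases lt_or_gt_of_ne hpb with h' | h'
      · left
        refine H.intrinsicDeriv_eq_of_hasDerivAt hξp ?_
        have hd : HasDerivAt (fun s => α (τ p) * E (s, τ p))
            (α (τ p) * (intrinsicDeriv g g p - m (τ p))) p.1 := by
          have h1 := ((H.hasDerivAt_comp hgp).sub_const (g (a, τ p))).sub
            (((hasDerivAt_id p.1).sub_const a).mul_const (m (τ p)))
          rw [one_mul] at h1
          exact h1.const_mul _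
        refine hd.congr_of_eventuallyEq ?_
        filter_upwards [isOpen_Ioo.mem_nhds ⟨h, h'⟩] with s hs
        simp only [hξ, hcl_of_mem s (Ioo_subset_Icc_self hs), H.label_flow]
      · right
        refine H.intrinsicDeriv_eq_of_hasDerivAt hξp
          ((hasDerivAt_const _ 0).congr_of_eventuallyEq ?_)
        filter_upwards [isOpen_Ioi.mem_nhds h'] with s hs
        simp only [hξ, hcl_of_ge s (le_of_lt hs), hEb, mul_zero]
  -- the stationarity of `f`, transported to the measure `∂_t τ dy dt`
  have hSm : Measurable fun p => areaSlope (intrinsicDeriv g g p) :=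
    continuous_areaSlope.measurable.comp (measurable_intrinsicDeriv hgm g)
  have T1 := H.integral_transport (G := fun p => areaSlope (intrinsicDeriv g g p)) hSm
    (M := 1) (fun p => abs_areaSlope_le_one _) (U := ball 0 R) (fun φ hφ hφc hφU => by
      rw [← hst φ hφ hφc]
      refine integral_congr_ae (Eventually.of_forall fun p => ?_)
      by_cases hp : p ∈ tsupport φ
      · have e := hgf' p (hφU hp)
        simp only [linDeriv, intrinsicDeriv, e.1, e.2]
      · have e := tsupport_fderiv_apply_eq_zero hp
        simp [linDeriv, intrinsicDeriv, e.1, e.2]) hξl hξc hξU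
  set N : ℝ × ℝ → ℝ := fun p => areaSlope (m (τ p)) with hN
  have hNl : LocallyLipschitz N := (locLip_comp_contDiffAt hml
    fun u => contDiff_areaSlope.contDiffAt).comp H.locLip_label
  have T2 := H.integral_intrinsicDeriv_eq_zero (ξ := fun p => N p * ξ p) (locLip_mul hNl hξl)
    hξc.mul_left
  have T2' : ∫ p, N p * (intrinsicDeriv g ξ p * fderiv ℝ τ p (0, 1)) = 0 := by
    refine (integral_congr_ae ?_).trans T2
    filter_upwards [locLip_ae_differentiableAt hξl, locLip_ae_differentiableAt hNl] with p h1 h2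
    rw [intrinsicDeriv_mul h2 h1, H.intrinsicDeriv_comp_label (m := fun u => areaSlope (m u)) h2]
    ring
  have i1 := H.integrable_transport hSm (fun p => abs_areaSlope_le_one _) hξl hξc
  have i2 := H.integrable_transport hNl.continuous.measurable
    (fun p => abs_areaSlope_le_one _) hξl hξc
  have i3 : Integrable fun p =>
      areaSlope (intrinsicDeriv g g p) * (intrinsicDeriv g ξ p * fderiv ℝ τ p (0, 1)) -
        N p * (intrinsicDeriv g ξ p * fderiv ℝ τ p (0, 1)) := i1.sub i2
  have T3 := integral_sub i1 i2
  rw [T1, T2', sub_zero] at T3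
  have hτpos : ∀ᵐ p, 0 < fderiv ℝ τ p (0, 1) := by
    filter_upwards [locLip_ae_differentiableAt H.locLip_label] with p hp using H.fderiv_label_pos hp
  rw [integral_eq_zero_iff_of_nonneg_ae ?_ i3] at T3
  · have hzero : ξ = 0 := by
      refine H.eq_zero_of_intrinsicDeriv_eq_zero hξl hξc ?_
      filter_upwards [T3, hτpos, hξd] with p h1 h2 h3
      rcases h3 with h3 | h3
      · simp only [Pi.zero_apply, ← sub_mul, mul_eq_zero, h2.ne', or_false] at h1
        rcases h1 with h1 | h1
        · rw [h3, areaSlope_strictMono.injective (sub_eq_zero.1 h1), sub_self, mul_zero]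
        · exact h1
      · exact h3
    intro s hs
    have h1 := congrFun hzero (s, γ s)
    have e1 : τ (s, γ s) = γ a := by rw [← hγχ s hs, H.label_flow]
    have e2 : α (γ a) = 1 := α.one_of_mem_closedBall (mem_closedBall_self α.rIn_pos.le)
    simp only [hξ, e1, e2, one_mul, hcl_of_mem s hs, hE, hm, hγχ s hs, hγχ b hbmem,
      Pi.zero_apply] at h1
    rw [(hgf' _ (hγU s hs)).1, (hgf' _ (hγU a hamem)).1, (hgf' _ (hγU b hbmem)).1] at h1
    linarith
  · filter_upwards [hτpos, hξd] with p h2 h3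
    rcases h3 with h3 | h3
    · have h4 : 0 ≤ (areaSlope (intrinsicDeriv g g p) - areaSlope (m (τ p))) *
          (intrinsicDeriv g g p - m (τ p)) := by
        rcases le_total (intrinsicDeriv g g p) (m (τ p)) with h | h
        · exact mul_nonneg_of_nonpos_of_nonpos
            (sub_nonpos.2 (areaSlope_strictMono.monotone h)) (sub_nonpos.2 h)
        · exact mul_nonneg (sub_nonneg.2 (areaSlope_strictMono.monotone h)) (sub_nonneg.2 h)
      have h5 : 0 ≤ α (τ p) := α.nonneg
      simp only [Pi.zero_apply, hN, h3]
      have := mul_nonneg (mul_nonneg h4 h5) h2.le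
      linarith
    · simp [h3]

/-! ### Global extension of the parabolas -/

/-- The parabola through `p` with slope `f p` and second derivative `m` there. -/
noncomputable def parabola (f : ℝ × ℝ → ℝ) (p : ℝ × ℝ) (m s : ℝ) : ℝ :=
  p.2 + f p * (s - p.1) + m * (s - p.1) ^ 2 / 2

theorem parabola_self (f : ℝ × ℝ → ℝ) (p : ℝ × ℝ) (m : ℝ) : parabola f p m p.1 = p.2 := by
  simp [parabola]

theorem hasDerivAt_parabola (f : ℝ × ℝ → ℝ) (p : ℝ × ℝ) (m s : ℝ) :
    HasDerivAt (parabola f p m) (f p + m * (s - p.1)) s := by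
  have h1 := (hasDerivAt_id s).sub_const p.1
  have h : HasDerivAt (parabola f p m) _ s :=
    ((h1.const_mul (f p)).const_add p.2).add (((h1.pow 2).const_mul m).div_const 2)
  refine h.congr_deriv ?_
  simp
  ring

theorem continuous_parabola (f : ℝ × ℝ → ℝ) (p : ℝ × ℝ) (m : ℝ) : Continuous (parabola f p m) := by
  unfold parabola
  fun_prop

/-- Near `p` the characteristic through `p` is the parabola with second derivative `m`. -/
def IsCharSlope (f : ℝ × ℝ → ℝ) (p : ℝ × ℝ) (m δ : ℝ) : Prop :=
  ∀ s ∈ Icc (p.1 - δ) (p.1 + δ), f (s, parabola f p m s) = f p + m * (s - p.1)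

theorem IsCharSlope.mono {f : ℝ × ℝ → ℝ} {p : ℝ × ℝ} {m δ δ' : ℝ} (h : IsCharSlope f p m δ)
    (hδ : δ' ≤ δ) : IsCharSlope f p m δ' := fun s hs =>
  h s ⟨by linarith [hs.1], by linarith [hs.2]⟩

theorem IsCharSlope.hasDerivAt {f : ℝ × ℝ → ℝ} {p : ℝ × ℝ} {m δ : ℝ} (h : IsCharSlope f p m δ) :
    ∀ s ∈ Icc (p.1 - δ) (p.1 + δ),
      HasDerivAt (parabola f p m) (f (s, parabola f p m s)) s := fun s hs => by
  rw [h s hs]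
  exact hasDerivAt_parabola f p m s

theorem IsCharSlope.unique {f : ℝ × ℝ → ℝ} (hf : LocallyLipschitz f) {p : ℝ × ℝ} {m m' δ δ' : ℝ}
    (hδ : 0 < δ) (hδ' : 0 < δ') (h : IsCharSlope f p m δ) (h' : IsCharSlope f p m' δ') :
    m = m' := by
  have hpos := lt_min hδ hδ'
  have := eqOn_characteristic hf (c := p.1) ⟨by linarith, by linarith⟩
    (h.mono (min_le_left δ δ')).hasDerivAt (h'.mono (min_le_right δ δ')).hasDerivAt
    (by rw [parabola_self, parabola_self])
    (show p.1 + min δ δ' ∈ Icc (p.1 - min δ δ') (p.1 + min δ δ') from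
      ⟨by linarith, le_rfl⟩)
  simp only [parabola, add_sub_cancel_left] at this
  have h2 : m * min δ δ' ^ 2 = m' * min δ δ' ^ 2 := by linarith
  exact mul_right_cancel₀ (pow_pos hpos 2).ne' h2

/-- Stationarity, tested against compactly supported Lipschitz functions. -/
def IsLipStationary (f : ℝ × ℝ → ℝ) : Prop :=
  ∀ φ : ℝ × ℝ → ℝ, LocallyLipschitz φ → HasCompactSupport φ →
    ∫ p, areaSlope (intrinsicDeriv f f p) * linDeriv f φ p = 0

/-- Local characteristics of a stationary `f` are parabolas, since `f` is affine along them. -/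
theorem IsLipStationary.exists_isCharSlope {f : ℝ × ℝ → ℝ} (hst : IsLipStationary f)
    (hf : LocallyLipschitz f) {p : ℝ × ℝ} {γ : ℝ → ℝ} {r : ℝ} (hr : 0 < r) (hp : γ p.1 = p.2)
    (hγ : ∀ s ∈ Icc (p.1 - r) (p.1 + r), HasDerivAt γ (f (s, γ s)) s) :
    ∃ m, IsCharSlope f p m r ∧ EqOn γ (parabola f p m) (Icc (p.1 - r) (p.1 + r)) := by
  have haff := affine_along_characteristic hf hst (by linarith) hγ
  set m := (f (p.1 + r, γ (p.1 + r)) - f (p.1 - r, γ (p.1 - r))) / (p.1 + r - (p.1 - r))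
  have hmem : p.1 ∈ Icc (p.1 - r) (p.1 + r) := ⟨by linarith, by linarith⟩
  have hf' : ∀ s ∈ Icc (p.1 - r) (p.1 + r), f (s, γ s) = f p + m * (s - p.1) := fun s hs => by
    have h1 := haff s hs
    have h2 := haff p.1 hmem
    rw [hp] at h2
    rw [h1, show f p = f (p.1, p.2) from rfl, h2]
    ring
  have heq : EqOn γ (parabola f p m) (Icc (p.1 - r) (p.1 + r)) := fun s hs => by
    have h := (convex_Icc (p.1 - r) (p.1 + r)).norm_image_sub_le_of_norm_hasDerivWithin_le
      (f := fun s => γ s - parabola f p m s) (f' := fun _ => 0) (C := 0)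
      (fun x hx => by
        have := ((hγ x hx).sub (hasDerivAt_parabola f p m x)).hasDerivWithinAt
          (s := Icc (p.1 - r) (p.1 + r))
        rw [hf' x hx, sub_self] at this
        exact this) (by simp) hmem hs
    rw [zero_mul, norm_le_zero_iff, hp, parabola_self, sub_self, sub_zero, sub_eq_zero] at h
    exact h
  exact ⟨m, fun s hs => by rw [← heq hs, hf' s hs], heq⟩

/-- The second derivative of the parabola through `p` is read off from the flow of a cut-off of `f` at
a fixed positive time, so it is locally Lipschitz in `p`. -/
theorem IsLipStationary.exists_locLip_slope {f : ℝ × ℝ → ℝ} (hst : IsLipStationary f)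
    (hf : LocallyLipschitz f) :
    ∃ A : ℝ × ℝ → ℝ, LocallyLipschitz A ∧ ∀ p, ∃ δ > 0, IsCharSlope f p (A p) δ := by
  have key : ∀ p₀ : ℝ × ℝ, ∃ B : ℝ × ℝ → ℝ, LocallyLipschitz B ∧ ∃ δ > 0, ∀ p ∈ ball p₀ 1,
      IsCharSlope f p (B p) δ := fun p₀ => by
    obtain ⟨g, hg, hgc, hgf⟩ := exists_cutoff hf (R := ‖p₀‖ + 2) (by positivity)
    obtain ⟨X, hX0, hX, hXl⟩ := exists_flow_of_hasCompactSupport hg hgc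
    obtain ⟨M, hM⟩ := hgc.exists_bound_of_continuous hg.continuous
    have hM0 : 0 ≤ M := (norm_nonneg _).trans (hM 0)
    set δ := 1 / (M + 1) with hδ
    have hδ0 : 0 < δ := by positivity
    have hδ1 : δ ≤ 1 := by
      rw [hδ, div_le_one (by positivity)]
      linarith
    have hMδ : M * δ ≤ 1 := by
      rw [hδ, mul_one_div, div_le_one (by positivity)]
      linarith
    refine ⟨fun p => (X (p.1 + δ) p - p.2 - f p * δ) * (2 / δ ^ 2), ?_, δ, hδ0, fun p hp => ?_⟩
    · have hX1 : LocallyLipschitz fun p : ℝ × ℝ => X (p.1 + δ) p :=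
        hXl.comp ((locLip_add locLip_fst (LocallyLipschitz.const δ)).prodMk LocallyLipschitz.id)
      exact locLip_mul (locLip_sub (locLip_sub hX1 locLip_snd)
        (locLip_mul hf (LocallyLipschitz.const _))) (LocallyLipschitz.const _)
    · have hp' : ‖p‖ ≤ ‖p₀‖ + 1 := by
        have := norm_le_norm_add_norm_sub' p p₀
        rw [mem_ball, dist_eq_norm] at hp
        linarith
      have hpn := hp'
      rw [Prod.norm_def, max_le_iff] at hp'
      have hchar : ∀ s ∈ Icc (p.1 - δ) (p.1 + δ),
          HasDerivAt (fun s => X s p) (f (s, X s p)) s := fun s hs => by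
        rw [← hgf]
        · exact hX p s
        · have h1 : |s - p.1| ≤ δ := abs_le.2 ⟨by linarith [hs.1], by linarith [hs.2]⟩
          have h2 := abs_sub_le_of_abs_deriv_le (hX p) (fun r => hM _) p.1 s
          rw [hX0] at h2
          rw [mem_closedBall_zero_iff, Prod.norm_def]
          have h3 : ‖s‖ ≤ ‖p.1‖ + |s - p.1| := norm_le_norm_add_norm_sub' s p.1
          have h4 : ‖X s p‖ ≤ ‖p.2‖ + |X s p - p.2| := norm_le_norm_add_norm_sub' _ _
          refine max_le (by linarith [hp'.1]) ?_
          have : M * |s - p.1| ≤ M * δ := by gcongr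
          simp only
          linarith [hp'.2]
      obtain ⟨m, hm, heq⟩ := hst.exists_isCharSlope hf hδ0 (hX0 p) hchar
      have e := heq (show p.1 + δ ∈ Icc (p.1 - δ) (p.1 + δ) from ⟨by linarith, le_rfl⟩)
      simp only [parabola, add_sub_cancel_left] at e
      have : (X (p.1 + δ) p - p.2 - f p * δ) * (2 / δ ^ 2) = m := by
        rw [e]
        field_simp
        ring
      beta_reduce
      rw [this]
      exact hm
  choose B hB δ hδ hBδ using key
  refine ⟨fun p => B p p, fun p₀ => ?_, fun p => ⟨δ p, hδ p, hBδ p p (mem_ball_self one_pos)⟩⟩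
  obtain ⟨K, s, hs, hK⟩ := hB p₀ p₀
  refine ⟨K, s ∩ ball p₀ 1, inter_mem hs (ball_mem_nhds _ one_pos), ?_⟩
  have heq : EqOn (fun p => B p p) (B p₀) (s ∩ ball p₀ 1) := fun p hp =>
    IsCharSlope.unique hf (hδ p) (hδ p₀) (hBδ p p (mem_ball_self one_pos)) (hBδ p₀ p hp.2)
  intro x hx y hy
  rw [heq hx, heq hy]
  exact hK hx.1 hy.1

/-- Every characteristic of a stationary function is a parabola, defined for all times. -/
theorem IsLipStationary.exists_parabola {f : ℝ × ℝ → ℝ} (hst : IsLipStationary f)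
    (hf : LocallyLipschitz f) :
    ∃ A : ℝ × ℝ → ℝ, LocallyLipschitz A ∧
      ∀ p s, f (s, parabola f p (A p) s) = f p + A p * (s - p.1) := by
  obtain ⟨A, hA, hA'⟩ := hst.exists_locLip_slope hf
  refine ⟨A, hA, fun p s => ?_⟩
  obtain ⟨δ, hδ, hδ'⟩ := hA' p
  set T := |s - p.1| + 1 with hT
  have hT0 : 0 < T := by positivity
  set P := parabola f p (A p) with hP
  have hPc : Continuous P := continuous_parabola f p (A p)
  obtain ⟨R, hR⟩ := (isCompact_Icc (a := p.1 - T) (b := p.1 + T)).exists_bound_of_continuousOn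
    (f := fun s => (s, P s)) (by fun_prop)
  have hR0 : 0 ≤ R := (norm_nonneg _).trans (hR p.1 ⟨by linarith, by linarith⟩)
  obtain ⟨g, hg, hgc, hgf⟩ := exists_cutoff hf (R := R + 1) (by positivity)
  obtain ⟨X, hX0, hX, hXl⟩ := exists_flow_of_hasCompactSupport hg hgc
  obtain ⟨M, hM⟩ := hgc.exists_bound_of_continuous hg.continuous
  have hM0 : 0 ≤ M := (norm_nonneg _).trans (hM 0)
  have hXc : Continuous fun s => X s p :=
    continuous_iff_continuousAt.2 fun s => (hX p s).continuousAt
  -- as long as the flow of the cut-off field stays in the ball, it follows the parabola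
  have step : ∀ r, 0 < r → (∀ s ∈ Icc (p.1 - r) (p.1 + r), ‖(s, X s p)‖ ≤ R + 1) →
      IsCharSlope f p (A p) r ∧ EqOn (fun s => X s p) P (Icc (p.1 - r) (p.1 + r)) :=
    fun r hr hball => by
      obtain ⟨m, hm, heq⟩ := hst.exists_isCharSlope hf (γ := fun s => X s p) hr (hX0 p)
        (fun s hs => by
          rw [← hgf (mem_closedBall_zero_iff.2 (hball s hs))]
          exact hX p s)
      have : m = A p := hm.unique hf hr hδ hδ'
      rw [this] at hm heq
      exact ⟨hm, heq⟩
  let S : Set ℝ := {r | ∀ θ ∈ Icc (-1 : ℝ) 1, X (p.1 + θ * r) p = P (p.1 + θ * r)}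
  have hScl : IsClosed S := by
    have : S = ⋂ θ ∈ Icc (-1 : ℝ) 1, {r | X (p.1 + θ * r) p = P (p.1 + θ * r)} := by
      ext r
      simp [S]
    rw [this]
    exact isClosed_biInter fun θ _ => isClosed_eq (hXc.comp (by fun_prop)) (hPc.comp (by fun_prop))
  have hsub : Icc 0 T ⊆ S := by
    refine IsClosed.Icc_subset_of_forall_exists_gt (hScl.inter isClosed_Icc) ?_ ?_
    · intro θ _
      simp only [mul_zero, add_zero, hX0, hP, parabola_self]
    · rintro r ⟨hrS, hr0, hrT⟩ y hy
      have hη : 0 < 1 / (M + 1) := by positivity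
      set r' := min y (r + 1 / (M + 1)) with hr'
      have hrr' : r < r' := lt_min hy (by linarith)
      have hr'1 : r' ≤ r + 1 / (M + 1) := min_le_right _ _
      refine ⟨r', ?_, hrr', min_le_left _ _⟩
      have hη1 : 1 / (M + 1) ≤ 1 := by
        rw [div_le_one (by positivity)]
        linarith
      have hMη : M * (1 / (M + 1)) ≤ 1 := by
        rw [mul_one_div, div_le_one (by positivity)]
        linarith
      have hr'0 : 0 < r' := hr0.trans_lt hrr'
      obtain ⟨-, heq⟩ := step r' hr'0 (fun s hs => by
        obtain ⟨θ, hθ, rfl⟩ : ∃ θ ∈ Icc (-1 : ℝ) 1, s = p.1 + θ * r' := by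
          refine ⟨(s - p.1) / r', ⟨?_, ?_⟩, ?_⟩
          · rw [le_div_iff₀ hr'0]
            linarith [hs.1]
          · rw [div_le_one hr'0]
            linarith [hs.2]
          · field_simp
            ring
        have hθ1 : |θ| ≤ 1 := abs_le.2 hθ
        have h1 := hR (p.1 + θ * r) (by
          have : |θ * r| ≤ T := by
            rw [abs_mul, abs_of_nonneg hr0]
            nlinarith [abs_nonneg θ]
          rw [abs_le] at this
          exact ⟨by linarith, by linarith⟩)
        rw [← hrS θ hθ, Prod.norm_def, max_le_iff] at h1
        have h2 : |(p.1 + θ * r') - (p.1 + θ * r)| ≤ 1 / (M + 1) := by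
          rw [show (p.1 + θ * r') - (p.1 + θ * r) = θ * (r' - r) by ring, abs_mul,
            abs_of_pos (sub_pos.2 hrr')]
          nlinarith [abs_nonneg θ]
        have h3 := abs_sub_le_of_abs_deriv_le (hX p) (fun r => hM _) (p.1 + θ * r) (p.1 + θ * r')
        have h4 : M * |(p.1 + θ * r') - (p.1 + θ * r)| ≤ M * (1 / (M + 1)) := by gcongr
        have h5 := norm_le_norm_add_norm_sub' (p.1 + θ * r') (p.1 + θ * r)
        have h6 := norm_le_norm_add_norm_sub' (X (p.1 + θ * r') p) (X (p.1 + θ * r) p)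
        rw [Real.norm_eq_abs (_ - _)] at h5 h6
        rw [Prod.norm_def]
        simp only at h1 ⊢
        exact max_le (by linarith [h1.1]) (by linarith [h1.2]))
      intro θ hθ
      have hθ1 : |θ * r'| ≤ r' := by
        rw [abs_mul, abs_of_pos hr'0]
        nlinarith [abs_nonneg θ, abs_le.2 hθ]
      rw [abs_le] at hθ1
      exact heq ⟨by linarith, by linarith⟩
  have hTS := hsub (right_mem_Icc.2 hT0.le)
  refine (step T hT0 fun s hs => ?_).1 s ?_
  · obtain ⟨θ, hθ, rfl⟩ : ∃ θ ∈ Icc (-1 : ℝ) 1, s = p.1 + θ * T := by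
      refine ⟨(s - p.1) / T, ⟨?_, ?_⟩, ?_⟩
      · rw [le_div_iff₀ hT0]
        linarith [hs.1]
      · rw [div_le_one hT0]
        linarith [hs.2]
      · field_simp
        ring
    rw [hTS θ hθ]
    linarith [hR _ hs]
  · have := abs_le.1 (show |s - p.1| ≤ T by linarith)
    exact ⟨by linarith, by linarith⟩

/-! ### Locally bounded families -/

/-- A family of measurable functions, bounded on every ball uniformly in the index. -/
structure LocBdd {ι : Type*} (F : ι → ℝ × ℝ → ℝ) : Prop where
  measurable : ∀ i, Measurable (F i)
  bounded : ∀ R : ℝ, ∃ C : ℝ, ∀ i, ∀ p ∈ closedBall (0 : ℝ × ℝ) R, |F i p| ≤ C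

namespace LocBdd

variable {ι : Type*} {F G : ι → ℝ × ℝ → ℝ}

theorem mul (hF : LocBdd F) (hG : LocBdd G) : LocBdd fun i p => F i p * G i p :=
  ⟨fun i => (hF.1 i).mul (hG.1 i), fun R => by
    obtain ⟨C, hC⟩ := hF.2 R
    obtain ⟨D, hD⟩ := hG.2 R
    refine ⟨C * D, fun i p hp => ?_⟩
    rw [abs_mul]
    exact mul_le_mul (hC i p hp) (hD i p hp) (abs_nonneg _) ((abs_nonneg _).trans (hC i p hp))⟩

theorem add (hF : LocBdd F) (hG : LocBdd G) : LocBdd fun i p => F i p + G i p :=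
  ⟨fun i => (hF.1 i).add (hG.1 i), fun R => by
    obtain ⟨C, hC⟩ := hF.2 R
    obtain ⟨D, hD⟩ := hG.2 R
    exact ⟨C + D, fun i p hp => (abs_add_le _ _).trans (add_le_add (hC i p hp) (hD i p hp))⟩⟩

theorem sub (hF : LocBdd F) (hG : LocBdd G) : LocBdd fun i p => F i p - G i p :=
  ⟨fun i => (hF.1 i).sub (hG.1 i), fun R => by
    obtain ⟨C, hC⟩ := hF.2 R
    obtain ⟨D, hD⟩ := hG.2 R
    exact ⟨C + D, fun i p hp => (abs_sub _ _).trans (add_le_add (hC i p hp) (hD i p hp))⟩⟩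

theorem of_locLip {u : ℝ × ℝ → ℝ} (hu : LocallyLipschitz u) : LocBdd fun _ : ι => u :=
  ⟨fun _ => hu.continuous.measurable, fun R => by
    obtain ⟨C, -, hC⟩ := locLip_exists_norm_fderiv_le hu R
    exact ⟨C, fun _ p hp => (hC p hp).1⟩⟩

theorem const (c : ℝ) : LocBdd fun (_ : ι) (_ : ℝ × ℝ) => c := of_locLip (LocallyLipschitz.const c)

theorem fderiv_apply {u : ℝ × ℝ → ℝ} (hu : LocallyLipschitz u) (w : ℝ × ℝ) :
    LocBdd fun (_ : ι) p => fderiv ℝ u p w :=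
  ⟨fun _ => measurable_fderiv_apply_const ℝ u w, fun R => by
    obtain ⟨C, -, hC⟩ := locLip_exists_norm_fderiv_le hu R
    exact ⟨C * ‖w‖, fun _ p hp => ((fderiv ℝ u p).le_opNorm w).trans
      (by gcongr; exact (hC p hp).2)⟩⟩

theorem intrinsicDeriv {f u : ℝ × ℝ → ℝ} (hf : LocallyLipschitz f) (hu : LocallyLipschitz u) :
    LocBdd fun (_ : ι) p => intrinsicDeriv f u p := by
  have := (fderiv_apply (ι := ι) hu (1, 0)).add ((of_locLip hf).mul (fderiv_apply hu (0, 1)))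
  simpa only [← intrinsicDeriv_eq] using this

theorem linDeriv {f u : ℝ × ℝ → ℝ} (hf : LocallyLipschitz f) (hu : LocallyLipschitz u) :
    LocBdd fun (_ : ι) p => linDeriv f u p :=
  (intrinsicDeriv hf hu).add ((fderiv_apply hf (0, 1)).mul (of_locLip hu))

theorem charQuot {f χ τ u : ℝ × ℝ → ℝ} (H : IsCharFlow f χ τ) (hu : LocallyLipschitz u)
    {l : ι → ℝ} (hl : ∀ i, l i ∈ Ioc (0 : ℝ) 1) : LocBdd fun i => charQuot χ τ u (l i) :=
  ⟨fun i => (H.locLip_charQuot hu (hl i).1).continuous.measurable, fun R => by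
    obtain ⟨C, -, hC⟩ := H.exists_charQuot_le hu R
    exact ⟨C, fun i p hp => hC (l i) (hl i) p hp⟩⟩

theorem integrable (hF : LocBdd F) {u : ℝ × ℝ → ℝ} (hu : HasCompactSupport u)
    (hz : ∀ i, ∀ p ∉ tsupport u, F i p = 0) (i : ι) : Integrable (F i) := by
  obtain ⟨R, hR⟩ := hu.isCompact.isBounded.subset_closedBall 0
  obtain ⟨C, hC⟩ := hF.2 R
  exact integrable_of_bounded R C (hF.1 i).aestronglyMeasurable
    (Eventually.of_forall fun p hp => hC i p hp) fun p hp => hz i p fun h => hp (hR h)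

theorem tendsto_integral {F : ℕ → ℝ × ℝ → ℝ} (hF : LocBdd F) {u : ℝ × ℝ → ℝ}
    (hu : HasCompactSupport u) (hz : ∀ i, ∀ p ∉ tsupport u, F i p = 0) {F' : ℝ × ℝ → ℝ}
    (hl : ∀ᵐ p, Tendsto (fun n => F n p) atTop (𝓝 (F' p))) :
    Tendsto (fun n => ∫ p, F n p) atTop (𝓝 (∫ p, F' p)) := by
  obtain ⟨R, hR⟩ := hu.isCompact.isBounded.subset_closedBall 0
  obtain ⟨C, hC⟩ := hF.2 R
  exact tendsto_integral_of_bounded R C (fun n => (hF.1 n).aestronglyMeasurable)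
    (fun n => Eventually.of_forall fun p hp => hC n p hp)
    (fun n p hp => hz n p fun h => hp (hR h)) hl

end LocBdd

theorem exists_null_sequence : ∃ l : ℕ → ℝ, Tendsto l atTop (𝓝 0) ∧ ∀ n, l n ∈ Ioc (0 : ℝ) 1 :=
  ⟨fun n => 1 / ((n : ℝ) + 1), tendsto_one_div_add_atTop_nhds_zero_nat, fun n =>
    ⟨Nat.one_div_pos_of_nat, by
      rw [div_le_one (by positivity)]
      linarith [n.cast_nonneg (α := ℝ)]⟩⟩

/-! ### The second variation along parabolic characteristics -/

theorem fderiv_comp_apply {g : ℝ → ℝ} {g' : ℝ} {u : ℝ × ℝ → ℝ} {p : ℝ × ℝ}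
    (hg : HasDerivAt g g' (u p)) (hu : DifferentiableAt ℝ u p) (w : ℝ × ℝ) :
    fderiv ℝ (fun q => g (u q)) p w = g' * fderiv ℝ u p w := by
  have h : HasFDerivAt (fun q => g (u q)) _ p := hg.comp_hasFDerivAt p hu.hasFDerivAt
  rw [h.fderiv]
  simp

section SecondVariation

variable {f χ τ A : ℝ × ℝ → ℝ}

/-- The second variation, when `∇^f f` is represented by a locally Lipschitz function `A`. -/
theorem secondVariation_nonneg (hf : LocallyLipschitz f) (hA : LocallyLipschitz A)
    (hAf : ∀ᵐ p, intrinsicDeriv f f p = A p) {φ : ℝ × ℝ → ℝ} (hφ : LocallyLipschitz φ)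
    (hc : HasCompactSupport φ)
    (h : 0 ≤ ∫ p, areaCurv (intrinsicDeriv f f p) * linDeriv f φ p ^ 2 +
      2 * areaSlope (intrinsicDeriv f f p) * (φ p * fderiv ℝ φ p (0, 1))) :
    0 ≤ ∫ p, areaCurv (A p) * (linDeriv f φ p * linDeriv f φ p -
      fderiv ℝ A p (0, 1) * (φ p * φ p)) := by
  have hS : LocallyLipschitz fun p => areaSlope (A p) :=
    locLip_comp_contDiffAt hA fun p => contDiff_areaSlope.contDiffAt
  have hw : LocallyLipschitz fun p => areaCurv (A p) :=
    locLip_comp_contDiffAt hA fun p => contDiff_areaCurv.contDiffAt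
  have hZ := locLip_mul hS (locLip_mul hφ hφ)
  have hZc : HasCompactSupport fun p => areaSlope (A p) * (φ p * φ p) := hc.mul_left.mul_left
  have hZ0 := integral_fderiv_apply_eq_zero hZ hZc (0, 1)
  have i1 : Integrable fun p => areaCurv (A p) * (linDeriv f φ p * linDeriv f φ p -
      fderiv ℝ A p (0, 1) * (φ p * φ p)) :=
    LocBdd.integrable (ι := Unit) (F := fun _ p => areaCurv (A p) *
      (linDeriv f φ p * linDeriv f φ p - fderiv ℝ A p (0, 1) * (φ p * φ p)))
      ((LocBdd.of_locLip hw).mul (((LocBdd.linDeriv hf hφ).mul (LocBdd.linDeriv hf hφ)).sub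
        ((LocBdd.fderiv_apply hA _).mul ((LocBdd.of_locLip hφ).mul (LocBdd.of_locLip hφ)))))
      hc (fun _ p hp => by
        have e := tsupport_fderiv_apply_eq_zero hp
        simp [linDeriv, intrinsicDeriv, e.1, e.2]) ()
  have i2 : Integrable fun p => fderiv ℝ (fun p => areaSlope (A p) * (φ p * φ p)) p (0, 1) :=
    LocBdd.integrable (ι := Unit) (LocBdd.fderiv_apply hZ (0, 1)) hZc (fun _ p hp => by
      rw [(tsupport_fderiv_apply_eq_zero hp).2]
      rfl) ()
  have h3 := integral_add i1 i2
  rw [hZ0, add_zero] at h3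
  rw [← h3]
  refine h.trans_eq (integral_congr_ae ?_)
  filter_upwards [hAf, locLip_ae_differentiableAt hA, locLip_ae_differentiableAt hφ,
    locLip_ae_differentiableAt hS] with p h1 h2 h3 h4
  have h5 : DifferentiableAt ℝ (fun q => φ q * φ q) p := h3.mul h3
  rw [fderiv_mul_apply h4 h5, fderiv_mul_apply h3 h3,
    fderiv_comp_apply (hasDerivAt_areaSlope (A p)) h2, h1]
  ring

/-- The second variation in the directions `ψ √(1/J)`, where `J` is the Jacobian of the flow. These
are obtained from `ψ √(1/J_h)` with difference quotients `J_h` as `h → 0`. -/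
theorem IsCharFlow.secondVariation_sqrt_nonneg (H : IsCharFlow f χ τ) (hA : LocallyLipschitz A)
    (h2 : ∀ φ : ℝ × ℝ → ℝ, LocallyLipschitz φ → HasCompactSupport φ →
      0 ≤ ∫ p, areaCurv (A p) * (linDeriv f φ p * linDeriv f φ p -
        fderiv ℝ A p (0, 1) * (φ p * φ p)))
    {ψ : ℝ × ℝ → ℝ} (hψ : LocallyLipschitz ψ) (hc : HasCompactSupport ψ) :
    0 ≤ ∫ p, areaCurv (A p) * fderiv ℝ τ p (0, 1) *
      ((intrinsicDeriv f ψ p + ψ p * (fderiv ℝ f p (0, 1) - 1 / 2 * fderiv ℝ f p (0, 1))) *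
        (intrinsicDeriv f ψ p + ψ p * (fderiv ℝ f p (0, 1) - 1 / 2 * fderiv ℝ f p (0, 1))) -
        fderiv ℝ A p (0, 1) * (ψ p * ψ p)) := by
  obtain ⟨l, hl, hl1⟩ := exists_null_sequence
  have hf := H.locLip_field
  have hw : LocallyLipschitz fun p => areaCurv (A p) :=
    locLip_comp_contDiffAt hA fun p => contDiff_areaCurv.contDiffAt
  have hQ : LocBdd fun n : ℕ => charQuot χ τ f (l n) := LocBdd.charQuot H hf hl1
  have hk : LocBdd fun n : ℕ => charQuot χ τ τ (l n) := LocBdd.charQuot H H.locLip_label hl1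
  have hL : LocBdd fun (n : ℕ) p => intrinsicDeriv f ψ p +
      ψ p * (fderiv ℝ f p (0, 1) - 1 / 2 * charQuot χ τ f (l n) p) :=
    (LocBdd.intrinsicDeriv hf hψ).add ((LocBdd.of_locLip hψ).mul
      ((LocBdd.fderiv_apply hf _).sub ((LocBdd.const _).mul hQ)))
  have hF : LocBdd fun (n : ℕ) p => areaCurv (A p) * charQuot χ τ τ (l n) p *
      ((intrinsicDeriv f ψ p + ψ p * (fderiv ℝ f p (0, 1) - 1 / 2 * charQuot χ τ f (l n) p)) *
        (intrinsicDeriv f ψ p + ψ p * (fderiv ℝ f p (0, 1) - 1 / 2 * charQuot χ τ f (l n) p)) -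
        fderiv ℝ A p (0, 1) * (ψ p * ψ p)) :=
    ((LocBdd.of_locLip hw).mul hk).mul ((hL.mul hL).sub ((LocBdd.fderiv_apply hA _).mul
      ((LocBdd.of_locLip hψ).mul (LocBdd.of_locLip hψ))))
  refine ge_of_tendsto' (hF.tendsto_integral hc (fun n p hp => ?_) ?_) fun n => ?_
  · have e := tsupport_fderiv_apply_eq_zero hp
    simp [intrinsicDeriv, e.1, e.2]
  · filter_upwards [locLip_ae_differentiableAt hf, locLip_ae_differentiableAt H.locLip_label]
      with p hfp hτp
    have e1 := H.tendsto_charQuot hl (fun n => (hl1 n).1) hτp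
    have e2 := H.tendsto_charQuot hl (fun n => (hl1 n).1) hfp
    have e3 := (((e2.const_mul (1 / 2)).const_sub (fderiv ℝ f p (0, 1))).const_mul (ψ p)).const_add
      (intrinsicDeriv f ψ p)
    exact (e1.const_mul _).mul ((e3.mul e3).sub tendsto_const_nhds)
  · have hkl : LocallyLipschitz (charQuot χ τ τ (l n)) :=
      H.locLip_charQuot H.locLip_label (hl1 n).1
    have hkpos := H.label_charQuot_pos (hl1 n).1
    have hsl := locLip_sqrt hkl hkpos
    refine (h2 (fun p => ψ p * √(charQuot χ τ τ (l n) p)) (locLip_mul hψ hsl)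
      hc.mul_right).trans_eq (integral_congr_ae ?_)
    filter_upwards [locLip_ae_differentiableAt hψ, locLip_ae_differentiableAt hkl,
      locLip_ae_differentiableAt hsl] with p h3 h4 h5
    have e1 : intrinsicDeriv f (fun q => √(charQuot χ τ τ (l n) q)) p =
        -(1 / 2 * √(charQuot χ τ τ (l n) p) * charQuot χ τ f (l n) p) := by
      have e2 := H.intrinsicDeriv_label_charQuot (hl1 n).1 h4
      rw [intrinsicDeriv] at e2
      rw [intrinsicDeriv, fderiv_comp_apply (Real.hasDerivAt_sqrt (hkpos p).ne') h4, e2]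
      have hs := Real.sqrt_pos.2 (hkpos p)
      have hs2 := Real.sq_sqrt (hkpos p).le
      field_simp
      rw [hs2]
    have hs2 := Real.mul_self_sqrt (hkpos p).le
    rw [linDeriv, intrinsicDeriv_mul h3 h5, e1]
    linear_combination (areaCurv (A p) * ((intrinsicDeriv f ψ p +
      ψ p * (fderiv ℝ f p (0, 1) - 1 / 2 * charQuot χ τ f (l n) p)) *
        (intrinsicDeriv f ψ p + ψ p * (fderiv ℝ f p (0, 1) - 1 / 2 * charQuot χ τ f (l n) p)) -
        fderiv ℝ A p (0, 1) * (ψ p * ψ p))) * hs2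

/-- Integration by parts of `f_t ∇^f (ψ²)` along characteristics, where `∇^f f_t = A_t - f_t²` holds
in the limit of difference quotients. -/
theorem IsCharFlow.integral_parts (H : IsCharFlow f χ τ) (hA : LocallyLipschitz A)
    (hfA : ∀ u s, HasDerivAt (fun r => f (r, χ (r, u))) (A (s, χ (s, u))) s)
    (hAA : ∀ u s, HasDerivAt (fun r => A (r, χ (r, u))) 0 s)
    {ψ : ℝ × ℝ → ℝ} (hψ : LocallyLipschitz ψ) (hc : HasCompactSupport ψ) :
    ∫ p, areaCurv (A p) * fderiv ℝ τ p (0, 1) *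
      (2 * (ψ p * intrinsicDeriv f ψ p) * fderiv ℝ f p (0, 1) + ψ p * ψ p *
        (fderiv ℝ A p (0, 1) - fderiv ℝ f p (0, 1) * fderiv ℝ f p (0, 1))) = 0 := by
  obtain ⟨l, hl, hl1⟩ := exists_null_sequence
  have hf := H.locLip_field
  have hw : LocallyLipschitz fun p => areaCurv (A p) :=
    locLip_comp_contDiffAt hA fun p => contDiff_areaCurv.contDiffAt
  have hQ : LocBdd fun n : ℕ => charQuot χ τ f (l n) := LocBdd.charQuot H hf hl1
  have hQA : LocBdd fun n : ℕ => charQuot χ τ A (l n) := LocBdd.charQuot H hA hl1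
  have hψb : LocBdd fun _ : ℕ => ψ := LocBdd.of_locLip hψ
  have hF : LocBdd fun (n : ℕ) p => areaCurv (A p) * fderiv ℝ τ p (0, 1) *
      (2 * (ψ p * intrinsicDeriv f ψ p) * charQuot χ τ f (l n) p + ψ p * ψ p *
        (charQuot χ τ A (l n) p - charQuot χ τ f (l n) p * charQuot χ τ f (l n) p)) :=
    ((LocBdd.of_locLip hw).mul (LocBdd.fderiv_apply H.locLip_label _)).mul
      ((((LocBdd.const 2).mul (hψb.mul (LocBdd.intrinsicDeriv hf hψ))).mul hQ).add
        ((hψb.mul hψb).mul (hQA.sub (hQ.mul hQ))))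
  refine tendsto_nhds_unique (hF.tendsto_integral hc (fun n p hp => ?_) ?_)
    (tendsto_const_nhds.congr fun n => ?_)
  · have e := tsupport_fderiv_apply_eq_zero hp
    simp [e.1]
  · filter_upwards [locLip_ae_differentiableAt hf, locLip_ae_differentiableAt hA] with p hfp hAp
    have e1 := H.tendsto_charQuot hl (fun n => (hl1 n).1) hAp
    have e2 := H.tendsto_charQuot hl (fun n => (hl1 n).1) hfp
    exact ((e2.const_mul _).add ((e1.sub (e2.mul e2)).const_mul _)).const_mul _
  · have hql := H.locLip_charQuot hf (hl1 n).1
    have hψ2 := locLip_mul hψ hψ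
    have hψ2q := locLip_mul hψ2 hql
    have h0 := H.integral_intrinsicDeriv_eq_zero
      (ξ := fun p => areaCurv (A p) * (ψ p * ψ p * charQuot χ τ f (l n) p))
      (locLip_mul hw hψ2q) hc.mul_left.mul_right.mul_left
    refine h0.symm.trans (integral_congr_ae ?_)
    filter_upwards [locLip_ae_differentiableAt hψ, locLip_ae_differentiableAt hql,
      locLip_ae_differentiableAt hw, locLip_ae_differentiableAt hψ2,
      locLip_ae_differentiableAt hψ2q] with p h3 h4 h5 h6 h7
    have e1 : intrinsicDeriv f (charQuot χ τ f (l n)) p = charQuot χ τ A (l n) p -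
        charQuot χ τ f (l n) p * charQuot χ τ f (l n) p := by
      refine H.intrinsicDeriv_eq_of_hasDerivAt h4 ?_
      have := H.hasDerivAt_charQuot (hl1 n).1 (hfA (τ p) p.1) (hfA (τ p + l n) p.1)
      rw [H.flow_label] at this
      exact this
    have e2 : intrinsicDeriv f (fun q => areaCurv (A q)) p = 0 := by
      refine H.intrinsicDeriv_eq_of_hasDerivAt h5 ?_
      have hd : HasDerivAt areaCurv (deriv areaCurv (A (p.1, χ (p.1, τ p))))
        (A (p.1, χ (p.1, τ p))) :=
        ((contDiff_areaCurv.differentiable one_ne_zero) _).hasDerivAt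
      have h : HasDerivAt (areaCurv ∘ fun s => A (s, χ (s, τ p))) _ p.1 :=
        hd.comp p.1 (hAA (τ p) p.1)
      rw [mul_zero] at h
      exact h
    rw [intrinsicDeriv_mul h5 h7, intrinsicDeriv_mul h6 h4, intrinsicDeriv_mul h3 h3, e1, e2]
    ring

/-- The second variation inequality in its final form. -/
theorem IsCharFlow.stability_inequality (H : IsCharFlow f χ τ) (hA : LocallyLipschitz A)
    (hfA : ∀ u s, HasDerivAt (fun r => f (r, χ (r, u))) (A (s, χ (s, u))) s)
    (hAA : ∀ u s, HasDerivAt (fun r => A (r, χ (r, u))) 0 s)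
    (h2 : ∀ φ : ℝ × ℝ → ℝ, LocallyLipschitz φ → HasCompactSupport φ →
      0 ≤ ∫ p, areaCurv (A p) * (linDeriv f φ p * linDeriv f φ p -
        fderiv ℝ A p (0, 1) * (φ p * φ p)))
    {ψ : ℝ × ℝ → ℝ} (hψ : LocallyLipschitz ψ) (hc : HasCompactSupport ψ) :
    ∫ p, areaCurv (A p) * fderiv ℝ τ p (0, 1) * (3 / 4 *
        (2 * fderiv ℝ A p (0, 1) - fderiv ℝ f p (0, 1) * fderiv ℝ f p (0, 1)) * (ψ p * ψ p)) ≤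
      ∫ p, areaCurv (A p) * fderiv ℝ τ p (0, 1) * (intrinsicDeriv f ψ p * intrinsicDeriv f ψ p) := by
  have h3 := H.secondVariation_sqrt_nonneg hA h2 hψ hc
  have h4 := H.integral_parts hA hfA hAA hψ hc
  have hf := H.locLip_field
  have hw : LocallyLipschitz fun p => areaCurv (A p) :=
    locLip_comp_contDiffAt hA fun p => contDiff_areaCurv.contDiffAt
  have hψb : LocBdd fun _ : Unit => ψ := LocBdd.of_locLip hψ
  have hdb : LocBdd fun (_ : Unit) p => intrinsicDeriv f ψ p := LocBdd.intrinsicDeriv hf hψ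
  have hwb : LocBdd fun (_ : Unit) p => areaCurv (A p) * fderiv ℝ τ p (0, 1) :=
    (LocBdd.of_locLip hw).mul (LocBdd.fderiv_apply H.locLip_label _)
  have hfb : LocBdd fun (_ : Unit) p => fderiv ℝ f p (0, 1) := LocBdd.fderiv_apply hf _
  have hAb : LocBdd fun (_ : Unit) p => fderiv ℝ A p (0, 1) := LocBdd.fderiv_apply hA _
  have hz : ∀ p ∉ tsupport ψ, ψ p = 0 ∧ intrinsicDeriv f ψ p = 0 := fun p hp => by
    have e := tsupport_fderiv_apply_eq_zero hp
    exact ⟨e.1, by simp [intrinsicDeriv, e.2]⟩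
  have i1 := (hwb.mul (((LocBdd.const (3 / 4)).mul (((LocBdd.const 2).mul hAb).sub
    (hfb.mul hfb))).mul (hψb.mul hψb))).integrable hc (fun _ p hp => by simp [hz p hp]) ()
  have i2 := (hwb.mul (hdb.mul hdb)).integrable hc (fun _ p hp => by simp [hz p hp]) ()
  have i3 := (hwb.mul ((((LocBdd.const 2).mul (hψb.mul hdb)).mul hfb).add ((hψb.mul hψb).mul
    (hAb.sub (hfb.mul hfb))))).integrable hc (fun _ p hp => by simp [hz p hp]) ()
  have e1 := integral_sub i2 i1
  have e2 := integral_add (i2.sub i1) (i3.const_mul (1 / 2))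
  simp only [Pi.sub_apply] at e2
  rw [integral_const_mul, h4, mul_zero, add_zero, e1] at e2
  rw [← sub_nonneg, ← e2]
  refine h3.trans_eq (integral_congr_ae (Eventually.of_forall fun p => ?_))
  simp only
  ring

end SecondVariation

/-! ### Test functions that are products along characteristics -/

section Product

variable {f χ τ : ℝ × ℝ → ℝ}

theorem IsCharFlow.hasCompactSupport_label_mul (H : IsCharFlow f χ τ) {α κ : ℝ → ℝ}
    (hα : HasCompactSupport α) (hκ : HasCompactSupport κ) :
    HasCompactSupport fun p : ℝ × ℝ => α (τ p) * κ p.1 := by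
  have hc : Continuous fun q : ℝ × ℝ => (q.1, χ q) := by
    have := H.locLip_flow.continuous
    fun_prop
  refine HasCompactSupport.intro ((hκ.isCompact.prod hα.isCompact).image hc) fun p hp => ?_
  by_contra h
  refine hp ⟨(p.1, τ p), ⟨subset_tsupport _ (right_ne_zero_of_mul h),
    subset_tsupport _ (left_ne_zero_of_mul h)⟩, ?_⟩
  simp only [H.flow_label]

theorem IsCharFlow.intrinsicDeriv_comp_fst (H : IsCharFlow f χ τ) {κ : ℝ → ℝ} {d : ℝ}
    {p : ℝ × ℝ} (hκ : HasDerivAt κ d p.1) : intrinsicDeriv f (fun q => κ q.1) p = d :=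
  H.intrinsicDeriv_eq_of_hasDerivAt (hκ.differentiableAt.comp p differentiableAt_fst) hκ

theorem locLip_comp_fst {κ κ' : ℝ → ℝ} (hκ : ∀ s, HasDerivAt κ (κ' s) s) (hκ' : Continuous κ') :
    LocallyLipschitz fun p : ℝ × ℝ => κ p.1 := by
  have h1 : ContDiff ℝ 1 κ := contDiff_one_iff_deriv.2
    ⟨fun s => (hκ s).differentiableAt, by rwa [show deriv κ = κ' from funext fun s => (hκ s).deriv]⟩
  exact (ContDiff.locallyLipschitz (𝕂 := ℝ) h1).comp locLip_fst

/-- If `G` is constant along characteristics, then the integral of `G α(τ) ∂_t τ` over a line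
`y = const` does not depend on the line; this is the weak form of that statement. -/
theorem IsCharFlow.integral_mul_deriv_eq_zero (H : IsCharFlow f χ τ) {G : ℝ × ℝ → ℝ}
    (hG : LocallyLipschitz G) (hGG : ∀ u s, HasDerivAt (fun r => G (r, χ (r, u))) 0 s)
    {κ κ' : ℝ → ℝ} (hκ : ∀ s, HasDerivAt κ (κ' s) s) (hκ' : Continuous κ')
    (hκc : HasCompactSupport κ) {α : ℝ → ℝ} (hα : LocallyLipschitz α) (hαc : HasCompactSupport α) :
    ∫ p, G p * fderiv ℝ τ p (0, 1) * (α (τ p) * κ' p.1) = 0 := by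
  have h1 : LocallyLipschitz fun p => α (τ p) := hα.comp H.locLip_label
  have h2 := locLip_comp_fst hκ hκ'
  have h12 := locLip_mul h1 h2
  have h := H.integral_intrinsicDeriv_eq_zero (locLip_mul hG h12)
    (H.hasCompactSupport_label_mul hαc hκc).mul_left
  refine Eq.trans (integral_congr_ae ?_) h
  filter_upwards [locLip_ae_differentiableAt hG, locLip_ae_differentiableAt h1,
    locLip_ae_differentiableAt h2, locLip_ae_differentiableAt h12] with p e e1 e2 e12
  have h0 : intrinsicDeriv f G p = 0 := H.intrinsicDeriv_eq_of_hasDerivAt e (hGG _ _)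
  rw [intrinsicDeriv_mul e e12, intrinsicDeriv_mul e1 e2, H.intrinsicDeriv_comp_label e1, h0,
    H.intrinsicDeriv_comp_fst (hκ p.1)]
  ring

/-- The squared derivative of `y ↦ b (y / T)` differs from `1 / T` times that of `b` by the derivative
of a compactly supported function, so that the Dirichlet integral of `b (y / T)` is proportional
to `1 / T`. The witness is `(B (y / T) - B y) / T`, where `B` is a primitive of `b'²`. -/
theorem exists_primitive_scaling (b : ContDiffBump (0 : ℝ)) {T : ℝ} (hT : 1 ≤ T) :
    ∃ κ : ℝ → ℝ, HasCompactSupport κ ∧ ∀ s, HasDerivAt κ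
      ((deriv b (s / T) * (1 / T)) * (deriv b (s / T) * (1 / T)) -
        1 / T * (deriv b s * deriv b s)) s := by
  have hT0 : 0 < T := by linarith
  have hbc : Continuous (deriv b) := (b.contDiff (n := 1)).continuous_deriv le_rfl
  set B : ℝ → ℝ := fun y => ∫ r in (0 : ℝ)..y, deriv b r * deriv b r with hBdef
  have hB : ∀ y, HasDerivAt B (deriv b y * deriv b y) y := fun y =>
    ((hbc.mul hbc).integral_hasStrictDerivAt 0 y).hasDerivAt
  have hz : ∀ r, b.rOut < |r| → deriv b r = 0 := fun r hr => by
    have : (b : ℝ → ℝ) =ᶠ[𝓝 r] fun _ => 0 := by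
      filter_upwards [(isOpen_lt continuous_const continuous_abs).mem_nhds hr] with x hx
      refine b.zero_of_le_dist ?_
      rw [dist_zero_right, Real.norm_eq_abs]
      exact le_of_lt hx
    rw [this.deriv_eq, deriv_const]
  have hconst : ∀ x y, (∀ r ∈ uIcc x y, b.rOut < |r|) → B x = B y := fun x y h => by
    have e := intervalIntegral.integral_interval_sub_left
      ((hbc.mul hbc).intervalIntegrable (μ := volume) 0 y)
      ((hbc.mul hbc).intervalIntegrable (μ := volume) 0 x)
    have e0 : ∫ r in x..y, (deriv b * deriv b) r = 0 := by
      rw [intervalIntegral.integral_congr (g := fun _ => 0) fun r hr => by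
        simp [hz r (h r hr)], intervalIntegral.integral_zero]
    rw [e0, sub_eq_zero] at e
    exact e.symm
  refine ⟨fun y => 1 / T * (B (y / T) - B y), ?_, fun s => ?_⟩
  · refine HasCompactSupport.intro (isCompact_closedBall (0 : ℝ) (T * (b.rOut + 1)))
      fun y hy => ?_
    have hro := b.rOut_pos
    rw [mem_closedBall_zero_iff, not_le, Real.norm_eq_abs] at hy
    have : B (y / T) = B y := by
      rcases lt_abs.1 hy with h | h
      · have h1 : b.rOut + 1 < y / T := by
          rw [lt_div_iff₀ hT0]
          linarith
        have hy0 : 0 < y := lt_of_le_of_lt (by positivity) h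
        refine hconst _ _ fun r hr => ?_
        rw [uIcc_of_le (div_le_self hy0.le hT)] at hr
        exact lt_of_lt_of_le (by linarith [hr.1]) (le_abs_self r)
      · have h1 : y / T < -(b.rOut + 1) := by
          rw [div_lt_iff₀ hT0]
          linarith
        have hy0 : 0 < -y := lt_of_le_of_lt (by positivity) h
        have h2 := div_le_self hy0.le hT
        rw [neg_div] at h2
        refine hconst _ _ fun r hr => ?_
        rw [uIcc_of_ge (by linarith)] at hr
        exact lt_of_lt_of_le (by linarith [hr.2]) (neg_le_abs r)
    rw [this, sub_self, mul_zero]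
  · have h1 : HasDerivAt (fun y => y / T) (1 / T) s := (hasDerivAt_id s).div_const T
    have h2 : HasDerivAt (B ∘ fun y => y / T) _ s := (hB (s / T)).comp s h1
    refine ((h2.sub (hB s)).const_mul (1 / T)).congr_deriv ?_
    ring

theorem hasDerivAt_bump_div (b : ContDiffBump (0 : ℝ)) (T s : ℝ) :
    HasDerivAt (fun y => b (y / T)) (deriv b (s / T) * (1 / T)) s := by
  have h : HasDerivAt (b ∘ fun y => y / T) _ s :=
    (((b.contDiff (n := 1)).differentiable one_ne_zero) (s / T)).hasDerivAt.comp s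
      ((hasDerivAt_id s).div_const T)
  exact h

theorem continuous_deriv_bump_div (b : ContDiffBump (0 : ℝ)) (T : ℝ) :
    Continuous fun s => deriv b (s / T) * (1 / T) :=
  (((b.contDiff (n := 1)).continuous_deriv le_rfl).comp (by fun_prop)).mul continuous_const

theorem bump_div_eq_zero (b : ContDiffBump (0 : ℝ)) {T y : ℝ} (hT : 0 < T)
    (hy : T * b.rOut ≤ |y|) : b (y / T) = 0 := by
  refine b.zero_of_le_dist ?_
  rw [dist_zero_right, Real.norm_eq_abs, abs_div, abs_of_pos hT, le_div_iff₀ hT]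
  linarith

theorem bump_div_eq_one (b : ContDiffBump (0 : ℝ)) {T y : ℝ} (hT : 0 < T)
    (hy : |y| ≤ T * b.rIn) : b (y / T) = 1 := by
  refine b.one_of_mem_closedBall ?_
  rw [mem_closedBall_zero_iff, Real.norm_eq_abs, abs_div, abs_of_pos hT, div_le_iff₀ hT]
  linarith

theorem hasCompactSupport_bump_div (b : ContDiffBump (0 : ℝ)) {T : ℝ} (hT : 0 < T) :
    HasCompactSupport fun y : ℝ => b (y / T) := by
  refine HasCompactSupport.intro (isCompact_closedBall (0 : ℝ) (T * b.rOut)) fun y hy => ?_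
  rw [mem_closedBall_zero_iff, not_le, Real.norm_eq_abs] at hy
  exact bump_div_eq_zero b hT hy.le

theorem locLip_bump (a : ContDiffBump (0 : ℝ)) : LocallyLipschitz a :=
  ContDiff.locallyLipschitz (𝕂 := ℝ) a.contDiff

/-- The test functions `a(τ) b(y / T)`. -/
noncomputable def stretchedBump (a b : ContDiffBump (0 : ℝ)) (τ : ℝ × ℝ → ℝ) (T : ℝ)
    (p : ℝ × ℝ) : ℝ := a (τ p) * b (p.1 / T)

theorem IsCharFlow.locLip_stretchedBump (H : IsCharFlow f χ τ) (a b : ContDiffBump (0 : ℝ))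
    (T : ℝ) : LocallyLipschitz (stretchedBump a b τ T) :=
  locLip_mul ((locLip_bump a).comp H.locLip_label)
    (locLip_comp_fst (hasDerivAt_bump_div b T) (continuous_deriv_bump_div b T))

theorem IsCharFlow.hasCompactSupport_stretchedBump (H : IsCharFlow f χ τ)
    (a b : ContDiffBump (0 : ℝ)) {T : ℝ} (hT : 0 < T) :
    HasCompactSupport (stretchedBump a b τ T) := by
  have ha : HasCompactSupport (a : ℝ → ℝ) := a.hasCompactSupport
  have h := H.hasCompactSupport_label_mul ha (hasCompactSupport_bump_div b hT)
  exact h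

theorem IsCharFlow.intrinsicDeriv_stretchedBump (H : IsCharFlow f χ τ)
    (a b : ContDiffBump (0 : ℝ)) (T : ℝ) : ∀ᵐ p, intrinsicDeriv f (stretchedBump a b τ T) p =
      a (τ p) * (deriv b (p.1 / T) * (1 / T)) := by
  have l1 : LocallyLipschitz fun p => a (τ p) := (locLip_bump a).comp H.locLip_label
  have l2 := locLip_comp_fst (hasDerivAt_bump_div b T) (continuous_deriv_bump_div b T)
  filter_upwards [locLip_ae_differentiableAt l1, locLip_ae_differentiableAt l2] with p e1 e2
  unfold stretchedBump
  rw [intrinsicDeriv_mul e1 e2, H.intrinsicDeriv_comp_label e1,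
    H.intrinsicDeriv_comp_fst (hasDerivAt_bump_div b T p.1), zero_mul, add_zero]

theorem IsCharFlow.integrable_stretchedBump (H : IsCharFlow f χ τ) (a b : ContDiffBump (0 : ℝ))
    {P : ℝ × ℝ → ℝ} (hP : LocBdd fun _ : Unit => P) {T : ℝ} (hT : 0 < T) :
    Integrable fun p => P p * (intrinsicDeriv f (stretchedBump a b τ T) p *
      intrinsicDeriv f (stretchedBump a b τ T) p) :=
  (hP.mul ((LocBdd.intrinsicDeriv H.locLip_field (H.locLip_stretchedBump a b T)).mul
    (LocBdd.intrinsicDeriv H.locLip_field (H.locLip_stretchedBump a b T)))).integrable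
    (H.hasCompactSupport_stretchedBump a b hT) (fun _ p hp => by
      simp [intrinsicDeriv, (tsupport_fderiv_apply_eq_zero hp).2]) ()

theorem IsCharFlow.integral_stretchedBump (H : IsCharFlow f χ τ) (a b : ContDiffBump (0 : ℝ))
    {W : ℝ × ℝ → ℝ} (hw : LocallyLipschitz W)
    (hww : ∀ u s, HasDerivAt (fun r => W (r, χ (r, u))) 0 s) {T : ℝ} (hT : 1 ≤ T) :
    ∫ p, W p * fderiv ℝ τ p (0, 1) * (intrinsicDeriv f (stretchedBump a b τ T) p *
      intrinsicDeriv f (stretchedBump a b τ T) p) =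
    1 / T * ∫ p, W p * fderiv ℝ τ p (0, 1) * (intrinsicDeriv f (stretchedBump a b τ 1) p *
      intrinsicDeriv f (stretchedBump a b τ 1) p) := by
  have hP : LocBdd fun (_ : Unit) p => W p * fderiv ℝ τ p (0, 1) :=
    (LocBdd.of_locLip hw).mul (LocBdd.fderiv_apply H.locLip_label _)
  have hbc : Continuous (deriv b) := (b.contDiff (n := 1)).continuous_deriv le_rfl
  obtain ⟨κ, hκc, hκ⟩ := exists_primitive_scaling b hT
  have hc := continuous_deriv_bump_div b T
  have h := H.integral_mul_deriv_eq_zero hw hww hκ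
    ((hc.mul hc).sub (continuous_const.mul (hbc.mul hbc)))
    hκc (locLip_mul (locLip_bump a) (locLip_bump a)) a.hasCompactSupport.mul_left
  rw [← sub_eq_zero, ← integral_const_mul, ← integral_sub
    (H.integrable_stretchedBump a b hP (by linarith))
    ((H.integrable_stretchedBump a b hP one_pos).const_mul _)]
  refine Eq.trans (integral_congr_ae ?_) h
  filter_upwards [H.intrinsicDeriv_stretchedBump a b T, H.intrinsicDeriv_stretchedBump a b 1]
    with p e1 e2
  rw [e1, e2, div_one, div_one]
  ring

/-- A stability inequality with a nonnegative potential `N` forces `N = 0`: it is tested with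
`a(τ) b(y / T)`, where `a` is fixed and `T → ∞`, and then the right-hand side is proportional to
`1 / T`. -/
theorem IsCharFlow.ae_eq_zero_of_stability {W N : ℝ × ℝ → ℝ} (H : IsCharFlow f χ τ)
    (hw : LocallyLipschitz W) (hww : ∀ u s, HasDerivAt (fun r => W (r, χ (r, u))) 0 s)
    (hWpos : ∀ p, 0 < W p) (hNb : LocBdd fun _ : Unit => N) (hNnn : ∀ᵐ p, 0 ≤ N p)
    (hst : ∀ ψ : ℝ × ℝ → ℝ, LocallyLipschitz ψ → HasCompactSupport ψ →
      ∫ p, W p * fderiv ℝ τ p (0, 1) * (3 / 4 * N p * (ψ p * ψ p)) ≤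
        ∫ p, W p * fderiv ℝ τ p (0, 1) * (intrinsicDeriv f ψ p * intrinsicDeriv f ψ p)) :
    ∀ᵐ p, N p = 0 := by
  obtain ⟨b, hb1, hb2⟩ : ∃ b : ContDiffBump (0 : ℝ), b.rIn = 1 ∧ b.rOut = 2 :=
    ⟨⟨1, 2, one_pos, one_lt_two⟩, rfl, rfl⟩
  set P : ℝ × ℝ → ℝ := fun p => W p * fderiv ℝ τ p (0, 1) with hP
  have hPpos : ∀ᵐ p, 0 < P p := by
    filter_upwards [locLip_ae_differentiableAt H.locLip_label] with p hp
    exact mul_pos (hWpos p) (H.fderiv_label_pos hp)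
  have hPb : LocBdd fun _ : Unit => P :=
    (LocBdd.of_locLip hw).mul (LocBdd.fderiv_apply H.locLip_label _)
  have key : ∀ n : ℕ, ∀ᵐ p, |τ p| ≤ n → |p.1| ≤ n → N p = 0 := fun n => by
    obtain ⟨a, ha⟩ : ∃ a : ContDiffBump (0 : ℝ), a.rIn = n + 1 :=
      ⟨⟨n + 1, n + 2, by positivity, by linarith⟩, rfl⟩
    set ψ : ℝ → ℝ × ℝ → ℝ := stretchedBump a b τ with hψ
    have hψl : ∀ T, LocallyLipschitz (ψ T) := H.locLip_stretchedBump a b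
    have hψc : ∀ T, 0 < T → HasCompactSupport (ψ T) := fun T hT =>
      H.hasCompactSupport_stretchedBump a b hT
    have hI : ∀ T, 0 < T → Integrable fun p => P p * (3 / 4 * N p * (ψ T p * ψ T p)) :=
      fun T hT => (hPb.mul (((LocBdd.const (3 / 4)).mul hNb).mul ((LocBdd.of_locLip (hψl T)).mul
        (LocBdd.of_locLip (hψl T))))).integrable (hψc T hT) (fun _ p hp => by
          simp [(tsupport_fderiv_apply_eq_zero hp).1]) ()
    set S : ℝ := n + 1 with hS
    have hS0 : 0 < S := by positivity
    have hnn : ∀ᵐ p, 0 ≤ P p * (3 / 4 * N p * (ψ S p * ψ S p)) := by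
      filter_upwards [hPpos, hNnn] with p h1 h2
      exact mul_nonneg h1.le (mul_nonneg (by positivity) (mul_self_nonneg _))
    have hle : ∀ T, max 1 (2 * S) ≤ T → ∫ p, P p * (3 / 4 * N p * (ψ S p * ψ S p)) ≤
        1 / T * ∫ p, P p * (intrinsicDeriv f (ψ 1) p * intrinsicDeriv f (ψ 1) p) := fun T hT => by
      rw [max_le_iff] at hT
      have hT0 : 0 < T := by linarith
      rw [← H.integral_stretchedBump a b hw hww hT.1]
      refine (integral_mono_ae (hI S hS0) (hI T hT0) ?_).trans (hst _ (hψl T) (hψc T hT0))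
      filter_upwards [hPpos, hNnn] with p h1 h2
      have h3 : |b (p.1 / S)| ≤ |b (p.1 / T)| := by
        rcases le_or_gt |p.1| T with h | h
        · rw [bump_div_eq_one b hT0 (by rw [hb1]; linarith), abs_of_nonneg b.nonneg, abs_one]
          exact b.le_one
        · rw [bump_div_eq_zero b hS0 (by rw [hb2]; linarith), abs_zero]
          exact abs_nonneg _
      have h4 : ψ S p * ψ S p ≤ ψ T p * ψ T p := by
        rw [← abs_le_iff_mul_self_le]
        simp only [hψ, stretchedBump, abs_mul]
        exact mul_le_mul_of_nonneg_left h3 (abs_nonneg _)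
      exact mul_le_mul_of_nonneg_left (mul_le_mul_of_nonneg_left h4 (by positivity)) h1.le
    have hzero : ∫ p, P p * (3 / 4 * N p * (ψ S p * ψ S p)) = 0 := by
      refine le_antisymm ?_ (integral_nonneg_of_ae hnn)
      have hlim := tendsto_inv_atTop_zero.mul_const
        (∫ p, P p * (intrinsicDeriv f (ψ 1) p * intrinsicDeriv f (ψ 1) p))
      rw [zero_mul] at hlim
      refine ge_of_tendsto hlim ((eventually_ge_atTop (max 1 (2 * S))).mono fun T hT => ?_)
      rw [inv_eq_one_div]
      exact hle T hT
    rw [integral_eq_zero_iff_of_nonneg_ae hnn (hI S hS0)] at hzero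
    filter_upwards [hzero, hPpos] with p h1 h2 h3 h4
    have e1 : a (τ p) = 1 := a.one_of_mem_closedBall (by
      rw [mem_closedBall_zero_iff, Real.norm_eq_abs, ha]
      linarith)
    have e2 : b (p.1 / S) = 1 := bump_div_eq_one b hS0 (by rw [hb1]; linarith)
    simp only [hψ, stretchedBump, e1, e2, Pi.zero_apply, mul_one] at h1
    have := (mul_eq_zero.1 h1).resolve_left h2.ne'
    linarith
  filter_upwards [ae_all_iff.2 key] with p hp
  obtain ⟨n, hn⟩ := exists_nat_ge (max |τ p| |p.1|)
  exact hp n ((le_max_left _ _).trans hn) ((le_max_right _ _).trans hn)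

end Product

/-! ### Stability forces `f` to be affine -/

section Affine

variable {f A : ℝ × ℝ → ℝ}

theorem hasDerivAt_parabola_of_isCharacteristic
    (hA' : ∀ p s, f (s, parabola f p (A p) s) = f p + A p * (s - p.1)) (p : ℝ × ℝ) (s : ℝ) :
    HasDerivAt (parabola f p (A p)) (f (s, parabola f p (A p) s)) s := by
  rw [hA']
  exact hasDerivAt_parabola f p (A p) s

theorem locLip_parabola (hf : LocallyLipschitz f) (hA : LocallyLipschitz A) :
    LocallyLipschitz fun q : ℝ × (ℝ × ℝ) => parabola f q.2 (A q.2) q.1 := by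
  have h1 : LocallyLipschitz fun q : ℝ × (ℝ × ℝ) => q.2 := LipschitzWith.prod_snd.locallyLipschitz
  have h0 : LocallyLipschitz fun q : ℝ × (ℝ × ℝ) => q.1 := LipschitzWith.prod_fst.locallyLipschitz
  have hs := locLip_sub h0 (locLip_fst.comp h1)
  have := locLip_add (locLip_add (locLip_snd.comp h1) (locLip_mul (hf.comp h1) hs))
    (locLip_mul (locLip_mul (hA.comp h1) (locLip_mul hs hs)) (LocallyLipschitz.const (1 / 2)))
  have e : (fun q : ℝ × (ℝ × ℝ) => parabola f q.2 (A q.2) q.1) = fun q =>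
      q.2.2 + f q.2 * (q.1 - q.2.1) + A q.2 * ((q.1 - q.2.1) * (q.1 - q.2.1)) * (1 / 2) := by
    funext q
    unfold parabola
    ring
  rw [e]
  exact this

/-- The flow of parabolas, labelled at time `s₀`. -/
theorem isCharFlow_parabola (hf : LocallyLipschitz f) (hA : LocallyLipschitz A)
    (hA' : ∀ p s, f (s, parabola f p (A p) s) = f p + A p * (s - p.1)) (s₀ : ℝ) :
    IsCharFlow f (fun p => parabola f (s₀, p.2) (A (s₀, p.2)) p.1)
      (fun p => parabola f p (A p) s₀) :=
  isCharFlow_of_flow hf (X := fun s p => parabola f p (A p) s) (fun p => parabola_self f p (A p))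
    (hasDerivAt_parabola_of_isCharacteristic hA') (locLip_parabola hf hA) s₀

theorem slope_parabola (hf : LocallyLipschitz f)
    (hA' : ∀ p s, f (s, parabola f p (A p) s) = f p + A p * (s - p.1)) (p : ℝ × ℝ) (s : ℝ) :
    A (s, parabola f p (A p) s) = A p := by
  set q : ℝ × ℝ := (s, parabola f p (A p) s) with hq
  have h := eq_of_characteristic hf (c := s) (hasDerivAt_parabola_of_isCharacteristic hA' q)
    (hasDerivAt_parabola_of_isCharacteristic hA' p) (parabola_self f q (A q)) (s + 1)
  have h1 := hA' q (s + 1)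
  rw [h, hA' p (s + 1), show f q = _ from hA' p s] at h1
  simp only [hq] at h1 ⊢
  linarith

/-- The parabolas do not cross, infinitesimally: the expression is the `t`-derivative of the position at
time `p.1 + σ` of the parabola through `p`, which is the label function for that reference time. -/
theorem one_add_deriv_parabola_pos (hf : LocallyLipschitz f) (hA : LocallyLipschitz A)
    (hA' : ∀ p s, f (s, parabola f p (A p) s) = f p + A p * (s - p.1)) {p : ℝ × ℝ}
    (hfp : DifferentiableAt ℝ f p) (hAp : DifferentiableAt ℝ A p) (σ : ℝ) :
    0 < 1 + fderiv ℝ f p (0, 1) * σ + fderiv ℝ A p (0, 1) * σ ^ 2 / 2 := by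
  have hd : HasFDerivAt (fun q : ℝ × ℝ => p.1 + σ - q.1) (-ContinuousLinearMap.fst ℝ ℝ ℝ) p :=
    hasFDerivAt_fst.const_sub _
  have h : HasFDerivAt (fun q => parabola f q (A q) (p.1 + σ)) _ p :=
    ((hasFDerivAt_snd (𝕜 := ℝ) (p := p)).add (hfp.hasFDerivAt.mul hd)).add
      ((hAp.hasFDerivAt.mul (hd.pow 2)).mul_const (2⁻¹))
  have hpos := (isCharFlow_parabola hf hA hA' (p.1 + σ)).fderiv_label_pos h.differentiableAt
  rw [h.fderiv] at hpos
  simp at hpos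
  nlinarith [hpos]

/-- The stability inequality has a nonnegative potential `2 A_t - f_t²`, since the parabolas do not
cross. -/
theorem two_mul_fderiv_slope_eq (hf : LocallyLipschitz f) (hA : LocallyLipschitz A)
    (hA' : ∀ p s, f (s, parabola f p (A p) s) = f p + A p * (s - p.1))
    (h2 : ∀ φ : ℝ × ℝ → ℝ, LocallyLipschitz φ → HasCompactSupport φ →
      0 ≤ ∫ p, areaCurv (A p) * (linDeriv f φ p * linDeriv f φ p -
        fderiv ℝ A p (0, 1) * (φ p * φ p))) :
    ∀ᵐ p, 2 * fderiv ℝ A p (0, 1) - fderiv ℝ f p (0, 1) * fderiv ℝ f p (0, 1) = 0 := by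
  have H := isCharFlow_parabola hf hA hA' 0
  set χ : ℝ × ℝ → ℝ := fun p => parabola f (0, p.2) (A (0, p.2)) p.1 with hχ
  set τ : ℝ × ℝ → ℝ := fun p => parabola f p (A p) 0 with hτ
  have hfA : ∀ u s, HasDerivAt (fun r => f (r, χ (r, u))) (A (s, χ (s, u))) s := fun u s => by
    simp only [hχ, hA', slope_parabola hf hA']
    simpa using (((hasDerivAt_id s).sub_const 0).const_mul (A (0, u))).const_add (f (0, u))
  have hAA : ∀ u s, HasDerivAt (fun r => A (r, χ (r, u))) 0 s := fun u s => by
    simp only [hχ, slope_parabola hf hA']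
    exact hasDerivAt_const _ _
  have hw : LocallyLipschitz fun p => areaCurv (A p) :=
    locLip_comp_contDiffAt hA fun p => contDiff_areaCurv.contDiffAt
  have hww : ∀ u s, HasDerivAt (fun r => areaCurv (A (r, χ (r, u)))) 0 s := fun u s => by
    simp only [hχ, slope_parabola hf hA']
    exact hasDerivAt_const _ _
  refine H.ae_eq_zero_of_stability hw hww (fun p => areaCurv_pos _)
    (((LocBdd.const 2).mul (LocBdd.fderiv_apply hA _)).sub
      ((LocBdd.fderiv_apply hf _).mul (LocBdd.fderiv_apply hf _))) ?_
    fun ψ hψ hc => H.stability_inequality hA hfA hAA h2 hψ hc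
  filter_upwards [locLip_ae_differentiableAt hf, locLip_ae_differentiableAt hA] with p hfp hAp
  have := discrim_le_zero (a := fderiv ℝ A p (0, 1) / 2) (b := fderiv ℝ f p (0, 1)) (c := 1)
    fun σ => by
      have := one_add_deriv_parabola_pos hf hA hA' hfp hAp σ
      linarith
  rw [discrim] at this
  linarith

/-- Equality `2 A_t = f_t²` with `f_t ≠ 0` would make infinitesimally close parabolas meet at the
time `y - 2 / f_t`. -/
theorem fderiv_snd_eq_zero (hf : LocallyLipschitz f) (hA : LocallyLipschitz A)
    (hA' : ∀ p s, f (s, parabola f p (A p) s) = f p + A p * (s - p.1))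
    (h : ∀ᵐ p, 2 * fderiv ℝ A p (0, 1) - fderiv ℝ f p (0, 1) * fderiv ℝ f p (0, 1) = 0) :
    ∀ᵐ p, fderiv ℝ f p (0, 1) = 0 := by
  filter_upwards [h, locLip_ae_differentiableAt hf, locLip_ae_differentiableAt hA] with p hp h1 h2
  by_contra hne
  have h3 := one_add_deriv_parabola_pos hf hA hA' h1 h2 (-2 / fderiv ℝ f p (0, 1))
  have e : fderiv ℝ A p (0, 1) = fderiv ℝ f p (0, 1) * fderiv ℝ f p (0, 1) / 2 := by linarith
  rw [e] at h3
  have : 1 + fderiv ℝ f p (0, 1) * (-2 / fderiv ℝ f p (0, 1)) + fderiv ℝ f p (0, 1) *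
      fderiv ℝ f p (0, 1) / 2 * (-2 / fderiv ℝ f p (0, 1)) ^ 2 / 2 = 0 := by
    field_simp
    ring
  linarith

theorem eq_of_fderiv_snd_eq_zero (hf : LocallyLipschitz f)
    (h : ∀ᵐ p, fderiv ℝ f p (0, 1) = 0) (y t : ℝ) : f (y, t) = f (y, 0) := by
  have hc := hf.continuous
  have h1 : ∀ᵐ p : ℝ × ℝ, HasDerivAt (fun r => f (p.1, r)) 0 p.2 := by
    filter_upwards [h, locLip_ae_differentiableAt hf] with p hp hd
    rw [← hp]
    exact hasDerivAt_snd_of_differentiableAt hd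
  have h2 : ∀ᵐ y : ℝ, f (y, t) = f (y, 0) := by
    rw [Measure.volume_eq_prod] at h1
    filter_upwards [Measure.ae_ae_of_ae_prod h1] with y hy
    have hl : LocallyLipschitz fun r : ℝ => f (y, r) :=
      hf.comp ((LocallyLipschitz.const y).prodMk LocallyLipschitz.id)
    obtain ⟨K, hK⟩ := hl.locallyLipschitzOn.exists_lipschitzOnWith_of_compact
      (isCompact_uIcc (a := (0 : ℝ)) (b := t))
    obtain ⟨C, hC⟩ := hK.absolutelyContinuousOnInterval.const_of_ae_hasDerivAt_zero
      (hy.mono fun r hr _ => hr)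
    rw [hC t right_mem_uIcc, hC 0 left_mem_uIcc]
  have h3 := ((hc.comp (by fun_prop : Continuous fun y : ℝ => (y, t))).ae_eq_iff_eq volume
    (hc.comp (by fun_prop : Continuous fun y : ℝ => (y, (0 : ℝ))))).1 h2
  exact congrFun h3 y

/-- A stable function is affine in `y` and does not depend on `t`. -/
theorem IsStable.exists_affine (hs : IsStable f) (hf : LocallyLipschitz f) :
    ∃ a b : ℝ, ∀ p : ℝ × ℝ, f p = a * p.1 + b := by
  have hst : IsLipStationary f := fun φ hφ hc => (hs.variation hf hφ hc).1
  obtain ⟨A, hA, hA'⟩ := hst.exists_parabola hf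
  have H := isCharFlow_parabola hf hA hA' 0
  have hAf : ∀ᵐ p, intrinsicDeriv f f p = A p := by
    filter_upwards [locLip_ae_differentiableAt hf] with p hp
    have hd := (isCharFlow_parabola hf hA hA' p.1).intrinsicDeriv_eq_of_hasDerivAt (d := A p) hp
    refine hd ?_
    simp only [parabola_self, Prod.mk.eta, hA']
    simpa using (((hasDerivAt_id p.1).sub_const p.1).const_mul (A p)).const_add (f p)
  have ht := eq_of_fderiv_snd_eq_zero hf (fderiv_snd_eq_zero hf hA hA'
    (two_mul_fderiv_slope_eq hf hA hA' fun φ hφ hc =>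
      secondVariation_nonneg hf hA hAf hφ hc (hs.variation hf hφ hc).2))
  refine ⟨A 0, f 0, fun p => ?_⟩
  have h := hA' 0 p.1
  rw [ht, ← ht p.1 p.2] at h
  simp only [Prod.fst_zero, sub_zero, Prod.mk.eta] at h
  rw [h]
  ring

end Affine

/-! ### Affine functions -/

section AffineFunctions

variable {f : ℝ × ℝ → ℝ} {a b : ℝ}

theorem absolutelyContinuousOnInterval_of_contDiff {g : ℝ → ℝ} (hg : ContDiff ℝ 1 g) (r s : ℝ) :
    AbsolutelyContinuousOnInterval g r s := by
  obtain ⟨K, hK⟩ := (ContDiff.locallyLipschitz (𝕂 := ℝ) hg).locallyLipschitzOn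
    |>.exists_lipschitzOnWith_of_compact (isCompact_uIcc (a := r) (b := s))
  exact hK.absolutelyContinuousOnInterval

theorem contDiff_quadratic (a b c : ℝ) : ContDiff ℝ 1 fun s : ℝ => a * s ^ 2 / 2 + b * s + c := by
  fun_prop

theorem hasDerivAt_quadratic (a b c s : ℝ) :
    HasDerivAt (fun s : ℝ => a * s ^ 2 / 2 + b * s + c) (a * s + b) s := by
  have h : HasDerivAt (fun s : ℝ => a * s ^ 2 / 2 + b * s + c) _ s :=
    (((((hasDerivAt_id s).pow 2).const_mul a).div_const 2).add
      ((hasDerivAt_id s).const_mul b)).add_const c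
  refine h.congr_deriv ?_
  simp
  ring

theorem isLagrangianParametrization_of_affine (h : ∀ p, f p = a * p.1 + b) :
    IsLagrangianParametrization f fun p => a * p.1 ^ 2 / 2 + b * p.1 + p.2 where
  continuous := by fun_prop
  surjective p := ⟨(p.1, p.2 - (a * p.1 ^ 2 / 2 + b * p.1)), by ext <;> simp⟩
  monotone s u v huv := by
    simp only
    linarith
  absolutelyContinuous u := absolutelyContinuousOnInterval_of_contDiff (contDiff_quadratic a b u)
  hasDerivAt u := Eventually.of_forall fun s => by
    rw [h]
    exact hasDerivAt_quadratic a b u s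

theorem IsLagrangianParametrization.eq_of_affine {χ : ℝ × ℝ → ℝ}
    (hχ : IsLagrangianParametrization f χ) (h : ∀ p, f p = a * p.1 + b)
    (h0 : ∀ u, χ (0, u) = u) (s u : ℝ) : χ (s, u) = a * s ^ 2 / 2 + b * s + u := by
  have hac := (hχ.absolutelyContinuous u 0 s).sub
    (absolutelyContinuousOnInterval_of_contDiff (contDiff_quadratic a b u) 0 s)
  obtain ⟨C, hC⟩ := hac.const_of_ae_hasDerivAt_zero ((hχ.hasDerivAt u).mono fun r hr _ => by
    have := hr.sub (hasDerivAt_quadratic a b u r)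
    rwa [h, sub_self] at this)
  have h1 := hC s right_mem_uIcc
  have h2 := hC 0 left_mem_uIcc
  simp only [Pi.sub_apply, h0] at h1 h2
  linarith

theorem hasFDerivAt_of_affine (h : ∀ p, f p = a * p.1 + b) (p : ℝ × ℝ) :
    HasFDerivAt f (a • ContinuousLinearMap.fst ℝ ℝ ℝ) p := by
  rw [show f = fun p => a * p.1 + b from funext h]
  exact (hasFDerivAt_fst.const_mul a).add_const b

/-- The subgroup `{x = a y}`. -/
def planeSubgroup (a : ℝ) : Subgroup Heis where
  carrier := {p | p.x = a * p.y}
  mul_mem' {p q} hp hq := by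
    simp only [mem_ofPred_eq, mul_def] at *
    rw [hp, hq]
    ring
  one_mem' := by simp [one_def]
  inv_mem' {p} hp := by
    simp only [mem_ofPred_eq, inv_def] at *
    rw [hp]
    ring

theorem mem_planeSubgroup {a : ℝ} {p : Heis} : p ∈ planeSubgroup a ↔ p.x = a * p.y := Iff.rfl

theorem continuous_coords : Continuous fun p : Heis => (p.x, p.y, p.z) := continuous_induced_dom

theorem isTwoDimLieSubgroup_planeSubgroup (a : ℝ) : IsTwoDimLieSubgroup (planeSubgroup a) where
  isClosed := by
    have hc := continuous_coords
    exact isClosed_eq (f := fun p : Heis => p.x) (g := fun p : Heis => a * p.y)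
      (continuous_fst.comp hc)
      (continuous_const.mul ((continuous_fst.comp continuous_snd).comp hc))
  isConnected := by
    have hc : Continuous fun q : ℝ × ℝ => (⟨a * q.1, q.1, q.2⟩ : Heis) :=
      continuous_induced_rng.2 (by
        simp only [Function.comp_def]
        fun_prop)
    have : ((planeSubgroup a : Subgroup Heis) : Set Heis) =
        range fun q : ℝ × ℝ => (⟨a * q.1, q.1, q.2⟩ : Heis) := by
      ext p
      rw [SetLike.mem_coe, mem_planeSubgroup]
      constructor
      · intro hp
        exact ⟨(p.y, p.z), Heis.ext hp.symm rfl rfl⟩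
      · rintro ⟨q, rfl⟩
        rfl
    rw [this]
    exact isConnected_range hc
  lieAlgebra := by
    let e : ℝ × ℝ →ₗ[ℝ] ℝ × ℝ × ℝ :=
      (a • LinearMap.fst ℝ ℝ ℝ).prod (LinearMap.id)
    have he : Function.Injective e := fun p q hpq => by
      simpa [e] using congrArg Prod.snd hpq
    refine ⟨LinearMap.range e, ?_, fun v => ?_⟩
    · rw [LinearMap.finrank_range_of_inj he]
      simp
    · constructor
      · rintro ⟨q, rfl⟩ s
        rw [mem_planeSubgroup]
        simp only [exp, e, LinearMap.prod_apply, Function.prod_apply, LinearMap.smul_apply,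
          LinearMap.fst_apply, LinearMap.id_apply, Prod.smul_mk, Prod.smul_fst, smul_eq_mul]
        ring
      · intro hv
        have h := hv 1
        rw [mem_planeSubgroup, one_smul] at h
        exact ⟨v.2, Prod.ext h.symm rfl⟩

/-- The intrinsic graph of `(y, t) ↦ a y + b` is the left translate by `(b, 0, 0)` of the subgroup
`{x = a y}`. -/
theorem isIntrinsicPlane_of_affine (h : ∀ p, f p = a * p.1 + b) :
    IsIntrinsicPlane (intrinsicGraph f) := by
  refine ⟨planeSubgroup a, ⟨b, 0, 0⟩, isTwoDimLieSubgroup_planeSubgroup a, ?_⟩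
  ext w
  constructor
  · rintro ⟨p, rfl⟩
    refine ⟨⟨a * p.1, p.1, p.2 - f p * p.1 / 2 - b * p.1 / 2⟩, rfl, ?_⟩
    simp only [mul_def, h, Heis.mk.injEq]
    exact ⟨by ring, by ring, by ring⟩
  · rintro ⟨w, hw, rfl⟩
    rw [SetLike.mem_coe, mem_planeSubgroup] at hw
    refine ⟨(w.y, w.z + b * w.y / 2 + (a * w.y + b) * w.y / 2), ?_⟩
    simp only [mul_def, h, hw, Heis.mk.injEq]
    exact ⟨by ring, by ring, by ring⟩

end AffineFunctions

end Heis

theorem theorem1p1 (f : ℝ × ℝ → ℝ) (hf : LocallyLipschitz f) (hstable : Heis.IsStable f) :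
    (Differentiable ℝ f ∧ ∃ c : ℝ, ∀ p : ℝ × ℝ, Heis.intrinsicDeriv f f p = c) ∧
    Heis.IsIntrinsicPlane (Heis.intrinsicGraph f) ∧
    (∃! χ : ℝ × ℝ → ℝ, Heis.IsLagrangianParametrization f χ ∧ ∀ τ : ℝ, χ (0, τ) = τ) ∧
    ∃ a b : ℝ, ∀ χ : ℝ × ℝ → ℝ,
      Heis.IsLagrangianParametrization f χ → (∀ τ : ℝ, χ (0, τ) = τ) →
      ∀ s τ : ℝ, χ (s, τ) = a * s ^ 2 / 2 + b * s + τ := by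
  obtain ⟨a, b, h⟩ := hstable.exists_affine hf
  refine ⟨⟨fun p => (Heis.hasFDerivAt_of_affine h p).differentiableAt, a, fun p => ?_⟩,
    Heis.isIntrinsicPlane_of_affine h,
    ⟨_, ⟨Heis.isLagrangianParametrization_of_affine h, fun τ => by simp⟩, fun χ hχ => ?_⟩,
    a, b, fun χ hχ h0 s τ => hχ.eq_of_affine h h0 s τ⟩
  · rw [Heis.intrinsicDeriv, (Heis.hasFDerivAt_of_affine h p).fderiv]
    simp
  · funext p
    exact hχ.1.eq_of_affine h hχ.2 p.1 p.2
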